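/- **Schur–Weyl duality for the Temperley–Lieb algebra, $v$ not a root of unity.** Let $\Bbbk$ be a field, let $0\neq v\in\Bbbk$ be not a root of unity (i.e. $v^m\ne 1$ for all $m\ge 1$), let $\delta=\pm(v+v^{-1})$ (either sign), and let $n$ be a positive integer. *The quantum group.* Let $U=U_v(\mathfrak{sl}_2)$ be the $\Bbbk$-algebra generated by $E,F,K^{\pm1}$ with relations $KK^{-1}=1=K^{-1}K$, $KEK^{-1}=v^2E$, $KFK^{-1}=v^{-2}F$, $EF-FE=\frac{K-K^{-1}}{v-v^{-1}}$, with coproduct $\Delta(E)=E\otimes 1+K\otimes E$, $\Delta(F)=F\otimes K^{-1}+1\otimes F$, $\Delta(K)=K\otimes K$. For $m\ge 0$ let $V(m)$ be the simple $U$-module of type $\mathbf 1$ and dimension $m+1$: it has a basis $x_0,\dots,x_m$ with $Kx_p=v^{m-2p}x_p$, $Ex_p=[m-p+1]x_{p-1}$, $Fx_p=[p+1]x_{p+1}$, where $[j]=\frac{v^j-v^{-j}}{v-v^{-1}}$ and $x_{-1}=x_{m+1}=0$. Put $V=V(1)$, and let $U$ act on $V^{\otimes n}$ through the iterated coproduct.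 *The Temperley–Lieb algebra.* Let $\mathrm{TL}_n(\delta)$ be the unital $\Bbbk$-algebra generated by $e_1,\dots,e_{n-1}$ with relations $e_i^2=\delta e_i$, $e_ie_je_i=e_i$ if $|i-j|=1$, $e_ie_j=e_je_i$ if $|i-j|>1$. Let $u$ be the endomorphism of $V\otimes V$ with matrix $$\frac1{v+v^{-1}}\begin{bmatrix}0&0&0&0\\0&v^{-1}&-1&0\\0&-1&v&0\\0&0&0&0\end{bmatrix}$$ in the basis $x_0\otimes x_0,\ x_0\otimes x_1,\ x_1\otimes x_0,\ x_1\otimes x_1$. *Half-diagrams.* A half-diagram on $n$ vertices consists of $n$ vertices on a line, some of them joined in pairs by pairwise non-crossing arcs (links) drawn below the line, with no unpaired vertex (defect) lying under a link. Let $\Lambda(n)=\{n,n-2,\dots,n-2\lfloor n/2\rfloor\}$, and for $k\in\Lambda(n)$ let $H(k)$ be the $\Bbbk$-vector space with basis the half-diagrams $h$ on $n$ vertices with $k$ defects. Put $e_ih=\delta h$ if $i,i+1$ are linked in $h$. Otherwise put $e_ih=0$ if $i$ and $i+1$ are both defects of $h$; and in the remaining cases $e_ih=h'$, where in $h'$ the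 vertices $i,i+1$ are linked to each other, the former partners of $i$ and $i+1$ are linked to each other if both exist, the only former partner becomes a defect if just one of them exists, and everything else is as in $h$. **Theorem.** 1. The assignment $e_i\mapsto \delta\cdot 1^{\otimes (i-1)}\otimes u\otimes 1^{\otimes(n-i-1)}$ defines an action of $\mathrm{TL}_n(\delta)$ on $V^{\otimes n}$, the rule above defines a $\mathrm{TL}_n(\delta)$-module structure on each $H(k)$, $k\in\Lambda(n)$, and the actions of $U$ and of $\mathrm{TL}_n(\delta)$ on $V^{\otimes n}$ commute. 2. The induced algebra morphism $U\to\mathrm{End}_{\mathrm{TL}_n(\delta)}(V^{\otimes n})$ is surjective. 3. The induced algebra morphism $\mathrm{TL}_n(\delta)\to\mathrm{End}_U(V^{\otimes n})$ is an isomorphism. 4. Each $V(k)\otimes H(k)$, $k\in\Lambda(n)$, is a simple $U\otimes\mathrm{TL}_n(\delta)$-module, and $$V^{\otimes n}\;\cong\;\bigoplus_{k\in\Lambda(n)}V(k)\otimes H(k)$$ as $U\otimes\mathrm{TL}_n(\delta)$-modules. -/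

import Mathlib

open scoped TensorProduct DirectSum

noncomputable section

namespace SchurWeyl

/-! ## The quantized enveloping algebra of `sl₂` -/

/-- The generators of the quantized enveloping algebra of `sl₂`; `Kinv` stands for `K⁻¹`. -/
inductive UGen : Type
  | E | F | K | Kinv

/-- The defining relations of the quantized enveloping algebra of `sl₂` at the parameter `v`. -/
inductive URel {𝕜 : Type*} [Field 𝕜] (v : 𝕜ˣ) :
    FreeAlgebra 𝕜 UGen → FreeAlgebra 𝕜 UGen → Prop
  | K_Kinv : URel v (FreeAlgebra.ι 𝕜 UGen.K * FreeAlgebra.ι 𝕜 UGen.Kinv) 1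
  | Kinv_K : URel v (FreeAlgebra.ι 𝕜 UGen.Kinv * FreeAlgebra.ι 𝕜 UGen.K) 1
  | K_E : URel v
      (FreeAlgebra.ι 𝕜 UGen.K * FreeAlgebra.ι 𝕜 UGen.E * FreeAlgebra.ι 𝕜 UGen.Kinv)
      ((v : 𝕜) ^ 2 • FreeAlgebra.ι 𝕜 UGen.E)
  | K_F : URel v
      (FreeAlgebra.ι 𝕜 UGen.K * FreeAlgebra.ι 𝕜 UGen.F * FreeAlgebra.ι 𝕜 UGen.Kinv)
      (((v : 𝕜) ^ 2)⁻¹ • FreeAlgebra.ι 𝕜 UGen.F)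
  | E_F : URel v
      (FreeAlgebra.ι 𝕜 UGen.E * FreeAlgebra.ι 𝕜 UGen.F
        - FreeAlgebra.ι 𝕜 UGen.F * FreeAlgebra.ι 𝕜 UGen.E)
      (((v : 𝕜) - (v : 𝕜)⁻¹)⁻¹ •
        (FreeAlgebra.ι 𝕜 UGen.K - FreeAlgebra.ι 𝕜 UGen.Kinv))

/-- The quantized enveloping algebra `U = U_v(sl₂)`, by generators and relations
(meaningful for `v ≠ ±1`). -/
abbrev Uq {𝕜 : Type*} [Field 𝕜] (v : 𝕜ˣ) : Type _ := RingQuot (URel v)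

/-- The generators of `U`. -/
def Uq.gen {𝕜 : Type*} [Field 𝕜] (v : 𝕜ˣ) (g : UGen) : Uq v :=
  RingQuot.mkAlgHom 𝕜 (URel v) (FreeAlgebra.ι 𝕜 g)

/-- The algebra morphism out of `U` with prescribed values on the generators. -/
def Uq.lift {𝕜 : Type*} [Field 𝕜] (v : 𝕜ˣ) {A : Type*} [Ring A] [Algebra 𝕜 A] (f : UGen → A)
    (h₁ : f .K * f .Kinv = 1) (h₂ : f .Kinv * f .K = 1)
    (h₃ : f .K * f .E * f .Kinv = (v : 𝕜) ^ 2 • f .E)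
    (h₄ : f .K * f .F * f .Kinv = ((v : 𝕜) ^ 2)⁻¹ • f .F)
    (h₅ : f .E * f .F - f .F * f .E = ((v : 𝕜) - (v : 𝕜)⁻¹)⁻¹ • (f .K - f .Kinv)) :
    Uq v →ₐ[𝕜] A :=
  RingQuot.liftAlgHom 𝕜 ⟨FreeAlgebra.lift 𝕜 f, by
    intro a b hab
    cases hab <;> simp [h₁, h₂, h₃, h₄, h₅]⟩

theorem Uq.lift_gen {𝕜 : Type*} [Field 𝕜] (v : 𝕜ˣ) {A : Type*} [Ring A] [Algebra 𝕜 A]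
    (f : UGen → A) (h₁ h₂ h₃ h₄ h₅) (g : UGen) :
    Uq.lift v f h₁ h₂ h₃ h₄ h₅ (Uq.gen v g) = f g := by
  simp [Uq.lift, Uq.gen]

section relations

variable {𝕜 : Type*} [Field 𝕜] (v : 𝕜ˣ)

theorem Uq.K_Kinv : Uq.gen v .K * Uq.gen v .Kinv = 1 := by
  simpa [Uq.gen] using RingQuot.mkAlgHom_rel 𝕜 (URel.K_Kinv (v := v))

theorem Uq.Kinv_K : Uq.gen v .Kinv * Uq.gen v .K = 1 := by
  simpa [Uq.gen] using RingQuot.mkAlgHom_rel 𝕜 (URel.Kinv_K (v := v))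

theorem Uq.K_E : Uq.gen v .K * Uq.gen v .E * Uq.gen v .Kinv = (v : 𝕜) ^ 2 • Uq.gen v .E := by
  simpa [Uq.gen] using RingQuot.mkAlgHom_rel 𝕜 (URel.K_E (v := v))

theorem Uq.K_F :
    Uq.gen v .K * Uq.gen v .F * Uq.gen v .Kinv = ((v : 𝕜) ^ 2)⁻¹ • Uq.gen v .F := by
  simpa [Uq.gen] using RingQuot.mkAlgHom_rel 𝕜 (URel.K_F (v := v))

theorem Uq.E_F : Uq.gen v .E * Uq.gen v .F - Uq.gen v .F * Uq.gen v .E =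
    ((v : 𝕜) - (v : 𝕜)⁻¹)⁻¹ • (Uq.gen v .K - Uq.gen v .Kinv) := by
  simpa [Uq.gen] using RingQuot.mkAlgHom_rel 𝕜 (URel.E_F (v := v))

theorem Uq.K_mul_E : Uq.gen v .K * Uq.gen v .E = (v : 𝕜) ^ 2 • (Uq.gen v .E * Uq.gen v .K) := by
  have h := congrArg (· * Uq.gen v .K) (Uq.K_E v)
  simpa [mul_assoc, Uq.Kinv_K] using h

theorem Uq.K_mul_F :
    Uq.gen v .K * Uq.gen v .F = ((v : 𝕜) ^ 2)⁻¹ • (Uq.gen v .F * Uq.gen v .K) := by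
  have h := congrArg (· * Uq.gen v .K) (Uq.K_F v)
  simpa [mul_assoc, Uq.Kinv_K] using h

theorem Uq.E_mul_Kinv :
    Uq.gen v .E * Uq.gen v .Kinv = (v : 𝕜) ^ 2 • (Uq.gen v .Kinv * Uq.gen v .E) := by
  have h := congrArg (Uq.gen v .Kinv * ·) (Uq.K_E v)
  simpa [← mul_assoc, Uq.Kinv_K] using h

end relations

/-- The values of the coproduct on the generators:
`E ↦ E ⊗ 1 + K ⊗ E`, `F ↦ F ⊗ K⁻¹ + 1 ⊗ F`, `K ↦ K ⊗ K`, `K⁻¹ ↦ K⁻¹ ⊗ K⁻¹`. -/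
def comulGen {𝕜 : Type*} [Field 𝕜] (v : 𝕜ˣ) : UGen → Uq v ⊗[𝕜] Uq v
  | .E => Uq.gen v .E ⊗ₜ[𝕜] 1 + Uq.gen v .K ⊗ₜ[𝕜] Uq.gen v .E
  | .F => Uq.gen v .F ⊗ₜ[𝕜] Uq.gen v .Kinv + 1 ⊗ₜ[𝕜] Uq.gen v .F
  | .K => Uq.gen v .K ⊗ₜ[𝕜] Uq.gen v .K
  | .Kinv => Uq.gen v .Kinv ⊗ₜ[𝕜] Uq.gen v .Kinv

/-- The coproduct `Δ : U → U ⊗ U`. -/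
def comul {𝕜 : Type*} [Field 𝕜] (v : 𝕜ˣ) : Uq v →ₐ[𝕜] Uq v ⊗[𝕜] Uq v :=
  Uq.lift v (comulGen v)
    (by simp [comulGen, Uq.K_Kinv, Algebra.TensorProduct.one_def])
    (by simp [comulGen, Uq.Kinv_K, Algebra.TensorProduct.one_def])
    (by
      have h : Uq.gen v .K * Uq.gen v .K * Uq.gen v .Kinv = Uq.gen v .K := by
        rw [mul_assoc, Uq.K_Kinv, mul_one]
      simp only [comulGen, mul_add, add_mul, Algebra.TensorProduct.tmul_mul_tmul, mul_one,
        Uq.K_E, Uq.K_Kinv, h, TensorProduct.tmul_smul, TensorProduct.smul_tmul', smul_add])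
    (by
      simp only [comulGen, mul_add, add_mul, Algebra.TensorProduct.tmul_mul_tmul, mul_one,
        one_mul, Uq.K_F, Uq.K_Kinv, TensorProduct.tmul_smul, TensorProduct.smul_tmul', smul_add])
    (by
      have hv : (v : 𝕜) ≠ 0 := v.ne_zero
      have h : (Uq.gen v .K * Uq.gen v .F) ⊗ₜ[𝕜] (Uq.gen v .E * Uq.gen v .Kinv)
          = (Uq.gen v .F * Uq.gen v .K) ⊗ₜ[𝕜] (Uq.gen v .Kinv * Uq.gen v .E) := by
        rw [Uq.K_mul_F, Uq.E_mul_Kinv, TensorProduct.smul_tmul, smul_smul,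
          inv_mul_cancel₀ (pow_ne_zero 2 hv), one_smul]
      have e1 := Uq.E_F v
      calc _ = (Uq.gen v .E * Uq.gen v .F - Uq.gen v .F * Uq.gen v .E) ⊗ₜ[𝕜] Uq.gen v .Kinv
            + Uq.gen v .K ⊗ₜ[𝕜] (Uq.gen v .E * Uq.gen v .F - Uq.gen v .F * Uq.gen v .E) := by
              simp only [comulGen, mul_add, add_mul, Algebra.TensorProduct.tmul_mul_tmul,
                one_mul, mul_one, TensorProduct.sub_tmul, TensorProduct.tmul_sub, h]
              abel
        _ = _ := by
              rw [e1]
              rw [TensorProduct.tmul_smul, ← TensorProduct.smul_tmul', ← smul_add,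
                TensorProduct.sub_tmul, TensorProduct.tmul_sub, sub_add_sub_cancel']
              rfl)

/-- The counit `ε : U → 𝕜`, with `E, F ↦ 0` and `K, K⁻¹ ↦ 1`. -/
def counit {𝕜 : Type*} [Field 𝕜] (v : 𝕜ˣ) : Uq v →ₐ[𝕜] 𝕜 :=
  Uq.lift v (fun g => match g with | .E => 0 | .F => 0 | .K => 1 | .Kinv => 1)
    (by simp) (by simp) (by simp) (by simp) (by simp)

/-! ## The simple modules `V(m)` -/

/-- The quantum integer `[j] = (v^j - v^(-j)) / (v - v⁻¹)`. -/
def qint {𝕜 : Type*} [Field 𝕜] (v : 𝕜ˣ) (j : ℤ) : 𝕜 :=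
  ((v : 𝕜) ^ j - (v : 𝕜) ^ (-j)) / ((v : 𝕜) - (v : 𝕜)⁻¹)

/-- The underlying space of `V(m)`, of dimension `m + 1`. -/
abbrev VMod (𝕜 : Type*) [Field 𝕜] (m : ℕ) : Type _ := Fin (m + 1) → 𝕜

/-- The basis vectors `x_0, …, x_m` of `V(m)`, with `x_p = 0` for any other integer `p`. -/
def xvec (𝕜 : Type*) [Field 𝕜] (m : ℕ) (p : ℤ) : VMod 𝕜 m :=
  fun j => if (j : ℤ) = p then 1 else 0

/-- The linear map on `V(m)` with prescribed values on `x_0, …, x_m`. -/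
def ofBasisValues (𝕜 : Type*) [Field 𝕜] (m : ℕ) (f : ℤ → VMod 𝕜 m) :
    Module.End 𝕜 (VMod 𝕜 m) :=
  (Pi.basisFun 𝕜 (Fin (m + 1))).constr 𝕜 (fun p => f (p : ℤ))

/-- The action of the generators on `V(m)`:
`E x_p = [m - p + 1] x_{p-1}`, `F x_p = [p + 1] x_{p+1}`, `K x_p = v^(m - 2p) x_p`. -/
def VGen {𝕜 : Type*} [Field 𝕜] (v : 𝕜ˣ) (m : ℕ) : UGen → Module.End 𝕜 (VMod 𝕜 m)
  | .E => ofBasisValues 𝕜 m fun p => qint v (m - p + 1) • xvec 𝕜 m (p - 1)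
  | .F => ofBasisValues 𝕜 m fun p => qint v (p + 1) • xvec 𝕜 m (p + 1)
  | .K => ofBasisValues 𝕜 m fun p => (v : 𝕜) ^ ((m : ℤ) - 2 * p) • xvec 𝕜 m p
  | .Kinv => ofBasisValues 𝕜 m fun p => (v : 𝕜) ^ (-((m : ℤ) - 2 * p)) • xvec 𝕜 m p

section VMod

variable {𝕜 : Type*} [Field 𝕜] (v : 𝕜ˣ) (m : ℕ)

theorem xvec_coe (p : Fin (m + 1)) : xvec 𝕜 m (p : ℤ) = Pi.basisFun 𝕜 (Fin (m + 1)) p := by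
  ext j
  simp [xvec, Pi.single_apply, Fin.ext_iff]

theorem xvec_eq_zero (p : ℤ) (h : p < 0 ∨ (m : ℤ) < p) : xvec 𝕜 m p = 0 := by
  ext j
  have := j.2
  simp only [xvec, Pi.zero_apply, ite_eq_right_iff]
  intro hj
  omega

theorem ofBasisValues_xvec (f : ℤ → VMod 𝕜 m) (hf : ∀ p : ℤ, p < 0 ∨ (m : ℤ) < p → f p = 0)
    (p : ℤ) : ofBasisValues 𝕜 m f (xvec 𝕜 m p) = f p := by
  by_cases h : p < 0 ∨ (m : ℤ) < p
  · rw [xvec_eq_zero m p h, map_zero, hf p h]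
  · obtain ⟨q, rfl⟩ : ∃ q : Fin (m + 1), p = (q : ℤ) :=
      ⟨⟨p.toNat, by omega⟩, by simp; omega⟩
    rw [xvec_coe, ofBasisValues, Module.Basis.constr_basis]

theorem qint_zero : qint v 0 = 0 := by simp [qint]

theorem VGen_E (p : ℤ) :
    VGen v m .E (xvec 𝕜 m p) = qint v (m - p + 1) • xvec 𝕜 m (p - 1) := by
  refine ofBasisValues_xvec m (fun p => qint v (m - p + 1) • xvec 𝕜 m (p - 1))
    (fun p hp => ?_) p
  by_cases h : p = m + 1
  · subst h; simp [qint_zero]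
  · rw [xvec_eq_zero m (p - 1) (by omega), smul_zero]

theorem VGen_F (p : ℤ) : VGen v m .F (xvec 𝕜 m p) = qint v (p + 1) • xvec 𝕜 m (p + 1) := by
  refine ofBasisValues_xvec m (fun p => qint v (p + 1) • xvec 𝕜 m (p + 1))
    (fun p hp => ?_) p
  by_cases h : p = -1
  · subst h; simp [qint_zero]
  · rw [xvec_eq_zero m (p + 1) (by omega), smul_zero]

theorem VGen_K (p : ℤ) :
    VGen v m .K (xvec 𝕜 m p) = (v : 𝕜) ^ ((m : ℤ) - 2 * p) • xvec 𝕜 m p :=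
  ofBasisValues_xvec m (fun p => (v : 𝕜) ^ ((m : ℤ) - 2 * p) • xvec 𝕜 m p)
    (fun p hp => by simp only [xvec_eq_zero m p hp, smul_zero]) p

theorem VGen_Kinv (p : ℤ) :
    VGen v m .Kinv (xvec 𝕜 m p) = (v : 𝕜) ^ (-((m : ℤ) - 2 * p)) • xvec 𝕜 m p :=
  ofBasisValues_xvec m (fun p => (v : 𝕜) ^ (-((m : ℤ) - 2 * p)) • xvec 𝕜 m p)
    (fun p hp => by simp only [xvec_eq_zero m p hp, smul_zero]) p

theorem end_ext {f g : Module.End 𝕜 (VMod 𝕜 m)}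
    (h : ∀ p : ℤ, f (xvec 𝕜 m p) = g (xvec 𝕜 m p)) : f = g :=
  (Pi.basisFun 𝕜 (Fin (m + 1))).ext fun p => by simpa only [xvec_coe] using h (p : ℤ)

theorem sub_inv_ne_zero (hv : ¬ IsOfFinOrder v) : (v : 𝕜) - (v : 𝕜)⁻¹ ≠ 0 := by
  intro h
  apply hv
  rw [isOfFinOrder_iff_pow_eq_one]
  refine ⟨2, by norm_num, ?_⟩
  ext
  have hv0 : (v : 𝕜) ≠ 0 := v.ne_zero
  field_simp at h
  push_cast
  linear_combination h

end VMod

/-- For `v` not a root of unity, the simple `U`-module `V(m)` of type `1` and dimension `m + 1`. -/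
def VRep {𝕜 : Type*} [Field 𝕜] (v : 𝕜ˣ) (hv : ¬ IsOfFinOrder v) (m : ℕ) :
    Uq v →ₐ[𝕜] Module.End 𝕜 (VMod 𝕜 m) :=
  Uq.lift v (VGen v m)
    (end_ext m fun p => by
      simp [VGen_K, VGen_Kinv, smul_smul, ← zpow_add₀ v.ne_zero])
    (end_ext m fun p => by
      simp [VGen_K, VGen_Kinv, smul_smul, ← zpow_add₀ v.ne_zero])
    (end_ext m fun p => by
      have hv0 : (v : 𝕜) ≠ 0 := v.ne_zero
      simp only [Module.End.mul_apply, VGen_K, VGen_Kinv, VGen_E, map_smul, smul_smul,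
        LinearMap.smul_apply]
      congr 1
      have : (v : 𝕜) ^ (-((m : ℤ) - 2 * p)) * (v : 𝕜) ^ ((m : ℤ) - 2 * (p - 1)) = (v : 𝕜) ^ 2 := by
        rw [← zpow_add₀ hv0, ← zpow_natCast]
        congr 1
        push_cast
        ring
      linear_combination qint v (m - p + 1) * this)
    (end_ext m fun p => by
      have hv0 : (v : 𝕜) ≠ 0 := v.ne_zero
      simp only [Module.End.mul_apply, VGen_K, VGen_Kinv, VGen_F, map_smul, smul_smul,
        LinearMap.smul_apply]
      congr 1
      have : (v : 𝕜) ^ (-((m : ℤ) - 2 * p)) * (v : 𝕜) ^ ((m : ℤ) - 2 * (p + 1))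
          = ((v : 𝕜) ^ 2)⁻¹ := by
        rw [← zpow_add₀ hv0, ← zpow_natCast, ← zpow_neg]
        congr 1
        push_cast
        ring
      linear_combination qint v (p + 1) * this)
    (end_ext m fun p => by
      have hv0 : (v : 𝕜) ≠ 0 := v.ne_zero
      have h1 := sub_inv_ne_zero v hv
      simp only [Module.End.mul_apply, VGen_K, VGen_Kinv, VGen_F, VGen_E, map_smul, smul_smul,
        LinearMap.smul_apply, LinearMap.sub_apply, add_sub_cancel_right, sub_add_cancel]
      rw [← sub_smul, ← sub_smul, smul_smul]
      congr 1
      have a1 : (v : 𝕜) ^ ((m : ℤ) - (p + 1) + 1) = (v : 𝕜) ^ (m : ℤ) * ((v : 𝕜) ^ p)⁻¹ := by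
        rw [← zpow_neg, ← zpow_add₀ hv0]; congr 1; ring
      have a2 : (v : 𝕜) ^ (-((m : ℤ) - (p + 1) + 1)) = ((v : 𝕜) ^ (m : ℤ))⁻¹ * (v : 𝕜) ^ p := by
        rw [← zpow_neg, ← zpow_add₀ hv0]; congr 1; ring
      have a3 : (v : 𝕜) ^ ((m : ℤ) - p + 1) = (v : 𝕜) ^ (m : ℤ) * ((v : 𝕜) ^ p)⁻¹ * v := by
        rw [← zpow_neg, ← zpow_add₀ hv0, ← zpow_add_one₀ hv0]; congr 1
      have a4 : (v : 𝕜) ^ (-((m : ℤ) - p + 1))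
          = ((v : 𝕜) ^ (m : ℤ))⁻¹ * (v : 𝕜) ^ p * (v : 𝕜)⁻¹ := by
        rw [← zpow_neg, ← zpow_add₀ hv0, ← zpow_sub_one₀ hv0]; congr 1; ring
      have a5 : (v : 𝕜) ^ (p + 1) = (v : 𝕜) ^ p * v := zpow_add_one₀ hv0 p
      have a6 : (v : 𝕜) ^ (-(p + 1)) = ((v : 𝕜) ^ p)⁻¹ * (v : 𝕜)⁻¹ := by
        rw [← zpow_neg, ← zpow_sub_one₀ hv0]; congr 1; ring
      have a7 : (v : 𝕜) ^ ((m : ℤ) - 2 * p)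
          = (v : 𝕜) ^ (m : ℤ) * (((v : 𝕜) ^ p)⁻¹ * ((v : 𝕜) ^ p)⁻¹) := by
        rw [← zpow_neg, ← zpow_add₀ hv0, ← zpow_add₀ hv0]; congr 1; ring
      have a8 : (v : 𝕜) ^ (-((m : ℤ) - 2 * p))
          = ((v : 𝕜) ^ (m : ℤ))⁻¹ * ((v : 𝕜) ^ p * (v : 𝕜) ^ p) := by
        rw [← zpow_neg, ← zpow_add₀ hv0, ← zpow_add₀ hv0]; congr 1; ring
      have a9 : (v : 𝕜) ^ (-p) = ((v : 𝕜) ^ p)⁻¹ := zpow_neg _ _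
      have hm : (v : 𝕜) ^ (m : ℤ) ≠ 0 := zpow_ne_zero _ hv0
      have hp : (v : 𝕜) ^ p ≠ 0 := zpow_ne_zero _ hv0
      simp only [qint, a1, a2, a3, a4, a5, a6, a7, a8, a9]
      generalize (v : 𝕜) ^ (m : ℤ) = M at *
      generalize (v : 𝕜) ^ p = P at *
      generalize hw : (v : 𝕜) = w at *
      have h2 : w ^ 2 - 1 ≠ 0 := by
        intro h
        apply h1
        field_simp
        simpa using h
      field_simp
      ring)

/-! ## Tensor space -/

/-- Tensor product of two representations of `U`, through the coproduct. -/
def tensorRep {𝕜 : Type*} [Field 𝕜] (v : 𝕜ˣ) {M N : Type*} [AddCommGroup M] [Module 𝕜 M]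
    [AddCommGroup N] [Module 𝕜 N] (ρ : Uq v →ₐ[𝕜] Module.End 𝕜 M)
    (σ : Uq v →ₐ[𝕜] Module.End 𝕜 N) : Uq v →ₐ[𝕜] Module.End 𝕜 (M ⊗[𝕜] N) :=
  (Module.endTensorEndAlgHom (R := 𝕜) (S := 𝕜) (A := 𝕜)).comp
    ((Algebra.TensorProduct.map ρ σ).comp (comul v))

/-- Tensor space `V^{⊗n}`, where `V = V(1)`. -/
abbrev TSpace (𝕜 : Type*) [Field 𝕜] (n : ℕ) : Type _ := ⨂[𝕜]^n (VMod 𝕜 1)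

/-- `V ≅ V^{⊗1}`. -/
def oneEquiv (𝕜 : Type*) [Field 𝕜] : VMod 𝕜 1 ≃ₗ[𝕜] TSpace 𝕜 1 :=
  (PiTensorProduct.subsingletonEquiv (R := 𝕜) (s := fun _ : Fin 1 => VMod 𝕜 1) 0).symm

/-- `V^{⊗n} ⊗ V ≅ V^{⊗(n+1)}`, by juxtaposition. -/
def succEquiv (𝕜 : Type*) [Field 𝕜] (n : ℕ) :
    TSpace 𝕜 n ⊗[𝕜] VMod 𝕜 1 ≃ₗ[𝕜] TSpace 𝕜 (n + 1) :=
  (TensorProduct.congr (LinearEquiv.refl 𝕜 _) (oneEquiv 𝕜)).trans TensorPower.mulEquiv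

/-- The action of `U` on `V^{⊗n}` by means of the iterated coproduct: `V^{⊗(n+1)}` is
`V^{⊗n} ⊗ V` with the action through `Δ`, so that `U` acts on `(⋯(V ⊗ V) ⊗ ⋯) ⊗ V`
through `⋯ (Δ ⊗ 1 ⊗ 1) (Δ ⊗ 1) Δ`; on `V^{⊗0}` it acts through the counit. -/
def UTensor {𝕜 : Type*} [Field 𝕜] (v : 𝕜ˣ) (hv : ¬ IsOfFinOrder v) :
    (n : ℕ) → Uq v →ₐ[𝕜] Module.End 𝕜 (TSpace 𝕜 n)
  | 0 => (Algebra.ofId 𝕜 (Module.End 𝕜 (TSpace 𝕜 0))).comp (counit v)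
  | n + 1 => ((succEquiv 𝕜 n).conjAlgEquiv 𝕜).toAlgHom.comp
      (tensorRep v (UTensor v hv n) (VRep v hv 1))

/-! ## The Temperley–Lieb algebra and its action on tensor space -/

/-- The defining relations of the Temperley–Lieb algebra; the generators `e_1, …, e_{n-1}` are
indexed here by `0, …, n-2`. -/
inductive TLRel {𝕜 : Type*} [Field 𝕜] (n : ℕ) (δ : 𝕜) :
    FreeAlgebra 𝕜 (Fin (n - 1)) → FreeAlgebra 𝕜 (Fin (n - 1)) → Prop
  | sq (i : Fin (n - 1)) : TLRel n δ
      (FreeAlgebra.ι 𝕜 i * FreeAlgebra.ι 𝕜 i) (δ • FreeAlgebra.ι 𝕜 i)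
  | adj (i j : Fin (n - 1)) (h : (i : ℕ) + 1 = j ∨ (j : ℕ) + 1 = i) : TLRel n δ
      (FreeAlgebra.ι 𝕜 i * FreeAlgebra.ι 𝕜 j * FreeAlgebra.ι 𝕜 i) (FreeAlgebra.ι 𝕜 i)
  | comm (i j : Fin (n - 1)) (h : (i : ℕ) + 1 < j ∨ (j : ℕ) + 1 < i) : TLRel n δ
      (FreeAlgebra.ι 𝕜 i * FreeAlgebra.ι 𝕜 j) (FreeAlgebra.ι 𝕜 j * FreeAlgebra.ι 𝕜 i)

/-- The Temperley–Lieb algebra `TL_n(δ)`. -/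
abbrev TL {𝕜 : Type*} [Field 𝕜] (n : ℕ) (δ : 𝕜) : Type _ := RingQuot (TLRel n δ)

/-- The generators of `TL_n(δ)`. -/
def TL.gen {𝕜 : Type*} [Field 𝕜] (n : ℕ) (δ : 𝕜) (i : Fin (n - 1)) : TL n δ :=
  RingQuot.mkAlgHom 𝕜 (TLRel n δ) (FreeAlgebra.ι 𝕜 i)

/-- The ordered basis `x_0 ⊗ x_0, x_0 ⊗ x_1, x_1 ⊗ x_0, x_1 ⊗ x_1` of `V ⊗ V`. -/
def pairBasis (𝕜 : Type*) [Field 𝕜] : Module.Basis (Fin 4) 𝕜 (VMod 𝕜 1 ⊗[𝕜] VMod 𝕜 1) :=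
  ((Pi.basisFun 𝕜 (Fin 2)).tensorProduct (Pi.basisFun 𝕜 (Fin 2))).reindex
    (finProdFinEquiv (m := 2) (n := 2))

/-- The projection `u` of `V ⊗ V` onto its summand `V(0)`. -/
def uMap {𝕜 : Type*} [Field 𝕜] (v : 𝕜ˣ) : Module.End 𝕜 (VMod 𝕜 1 ⊗[𝕜] VMod 𝕜 1) :=
  Matrix.toLin (pairBasis 𝕜) (pairBasis 𝕜)
    (((v : 𝕜) + (v : 𝕜)⁻¹)⁻¹ •
      !![0, 0, 0, 0;
         0, (v : 𝕜)⁻¹, -1, 0;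
         0, -1, (v : 𝕜), 0;
         0, 0, 0, 0])

/-- `V^{⊗i} ⊗ (V ⊗ V) ⊗ V^{⊗(n-2-i)} ≅ V^{⊗n}`, by juxtaposition. -/
def splitEquiv (𝕜 : Type*) [Field 𝕜] (n : ℕ) (i : Fin (n - 1)) :
    (TSpace 𝕜 i ⊗[𝕜] (VMod 𝕜 1 ⊗[𝕜] VMod 𝕜 1)) ⊗[𝕜] TSpace 𝕜 (n - 2 - i) ≃ₗ[𝕜] TSpace 𝕜 n :=
  (TensorProduct.congr
      ((TensorProduct.congr (LinearEquiv.refl 𝕜 (TSpace 𝕜 i))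
          ((TensorProduct.congr (oneEquiv 𝕜) (oneEquiv 𝕜)).trans TensorPower.mulEquiv)).trans
        TensorPower.mulEquiv)
      (LinearEquiv.refl 𝕜 (TSpace 𝕜 (n - 2 - i)))).trans
    (TensorPower.mulEquiv.trans
      (TensorPower.cast 𝕜 (VMod 𝕜 1)
        (show (i : ℕ) + (1 + 1) + (n - 2 - i) = n by have := i.2; omega)))

/-- The endomorphism `1 ⊗ ⋯ ⊗ 1 ⊗ u ⊗ 1 ⊗ ⋯ ⊗ 1` of `V^{⊗n}`, with `u` in the tensor positions
`i, i + 1` (counted from `0`). -/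
def uAt {𝕜 : Type*} [Field 𝕜] (v : 𝕜ˣ) (n : ℕ) (i : Fin (n - 1)) :
    Module.End 𝕜 (TSpace 𝕜 n) :=
  (splitEquiv 𝕜 n i).conj
    (TensorProduct.map (TensorProduct.map LinearMap.id (uMap v)) LinearMap.id)

/-! ## Half-diagrams and the cell modules `H(k)` -/

/-- A half-diagram on `n` vertices, encoded as the involution of the vertices that exchanges the
two endpoints of each link and fixes each defect. Planarity: below a link from `a` to `σ a` there
are no defects, and links with one endpoint below it have both endpoints below it. -/
def IsHalfDiagram {n : ℕ} (σ : Fin n → Fin n) : Prop :=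
  (∀ a, σ (σ a) = a) ∧ ∀ a b, a < b → b < σ a → a < σ b ∧ σ b < σ a ∧ σ b ≠ b

/-- The number of defects. -/
def defects {n : ℕ} (σ : Fin n → Fin n) : ℕ := (Finset.univ.filter fun a => σ a = a).card

/-- The set `M(k)` of half-diagrams on `n` vertices with `k` defects. -/
abbrev HalfDiagram (n k : ℕ) : Type :=
  {σ : Fin n → Fin n // IsHalfDiagram σ ∧ defects σ = k}

/-- The index set `Λ(n) = {n, n - 2, …, n - 2⌊n/2⌋}`. -/
def Lam (n : ℕ) : Finset ℕ := (Finset.range (n / 2 + 1)).image fun p => n - 2 * p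

/-- The underlying space of `H(k)`, with basis `M(k)`. -/
abbrev HMod (𝕜 : Type*) [Field 𝕜] (n k : ℕ) : Type _ := HalfDiagram n k →₀ 𝕜

/-- The vertex `i` of the link of the diagram `e_i`. -/
def lo {n : ℕ} (i : Fin (n - 1)) : Fin n := ⟨i, by have := i.2; omega⟩

/-- The vertex `i + 1` of the link of the diagram `e_i`. -/
def hi {n : ℕ} (i : Fin (n - 1)) : Fin n := ⟨i + 1, by have := i.2; omega⟩

/-- The half-diagram obtained by stacking the diagram of `e_i` above `σ`, when `i, i + 1` are not
linked in `σ`: `i` and `i + 1` become linked, the vertices linked to them in `σ` become linked to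
each other, a vertex whose partner was linked to a defect becomes a defect, and everything else
stays. -/
def stack {n : ℕ} (i : Fin (n - 1)) (σ : Fin n → Fin n) (a : Fin n) : Fin n :=
  if a = lo i then hi i
  else if a = hi i then lo i
  else if σ a = lo i then (if σ (hi i) = hi i then a else σ (hi i))
  else if σ a = hi i then (if σ (lo i) = lo i then a else σ (lo i))
  else σ a

open Classical in
/-- The diagrammatic action of `e_i` on `H(k)`: stack `e_i` above the half-diagram `h`; if this
closes a loop the result is `δ h`, and otherwise it is the resulting half-diagram if this still
has `k` defects, and `0` if it has fewer. -/
def eH {𝕜 : Type*} [Field 𝕜] (n : ℕ) (δ : 𝕜) (k : ℕ) (i : Fin (n - 1)) :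
    Module.End 𝕜 (HMod 𝕜 n k) :=
  Finsupp.linearCombination 𝕜 fun h : HalfDiagram n k =>
    if h.1 (lo i) = hi i then Finsupp.single h δ
    else if h' : IsHalfDiagram (stack i h.1) ∧ defects (stack i h.1) = k then
      Finsupp.single ⟨stack i h.1, h'⟩ 1
    else 0

/-! ## Endomorphism algebras, simplicity, outer tensor products -/

/-- `End_A(M)`: the linear endomorphisms that commute with the action of `A` on `M`. -/
def endAlg {𝕜 A M : Type*} [Field 𝕜] [Ring A] [Algebra 𝕜 A] [AddCommGroup M] [Module 𝕜 M]
    (ρ : A →ₐ[𝕜] Module.End 𝕜 M) : Subalgebra 𝕜 (Module.End 𝕜 M) :=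
  Subalgebra.centralizer 𝕜 (Set.range ρ)

/-- The `A`-module `M` given by a representation `ρ` is simple. -/
def IsSimpleRep {𝕜 A M : Type*} [Field 𝕜] [Ring A] [Algebra 𝕜 A] [AddCommGroup M] [Module 𝕜 M]
    (ρ : A →ₐ[𝕜] Module.End 𝕜 M) : Prop :=
  letI : Module A M := Module.compHom M ρ.toRingHom
  IsSimpleModule A M

/-- The `A ⊗ B`-module `M ⊗ N`, for an `A`-module `M` and a `B`-module `N`. -/
def outerRep {𝕜 A B M N : Type*} [Field 𝕜] [Ring A] [Algebra 𝕜 A] [Ring B] [Algebra 𝕜 B]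
    [AddCommGroup M] [Module 𝕜 M] [AddCommGroup N] [Module 𝕜 N]
    (ρ : A →ₐ[𝕜] Module.End 𝕜 M) (σ : B →ₐ[𝕜] Module.End 𝕜 N) :
    A ⊗[𝕜] B →ₐ[𝕜] Module.End 𝕜 (M ⊗[𝕜] N) :=
  (Module.endTensorEndAlgHom (R := 𝕜) (S := 𝕜) (A := 𝕜)).comp (Algebra.TensorProduct.map ρ σ)

end SchurWeyl

end

open SchurWeyl

open SchurWeyl

/-! ## Families satisfying the Temperley–Lieb relations, and Jones–Wenzl idempotents -/

namespace SchurWeyl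

/-! Since `v` is not a root of unity, every `[j]` with `j ≠ 0` is invertible and the powers `v ^ j`
are pairwise distinct. Write `δ = ε (v + v⁻¹)` with `ε * ε = 1`. In coordinates `δ u` is `ε` times a
contraction `V ⊗ V → 𝕜` (the cap) followed by the insertion of `v⁻¹ x₀ ⊗ x₁ - x₁ ⊗ x₀` (the cup).
Cap and cup are both maps of `U`-modules, so the two actions commute (`capCup_commute`); the
Temperley–Lieb relations are the value of a loop and the straightening of zigzags.

Tensor space is semisimple over `U`: `E` and `F` are nilpotent and the quantum integers invertible,
so every weight vector is a combination of vectors `F ^ p w` with `w` of highest weight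
(`mem_hwSpan`), and each such `w` of weight `k` generates an image of the simple module `V(k)`
(`hwAct_intertwines`, `isSemisimpleRep_UCoord`).

That `TL_n` is the full commutant, acting faithfully, is proved in `tlRep_bijective` by induction on
`n`, without counting dimensions. Let `J` be the ideal generated by the `e i` and `p` the
Jones–Wenzl idempotent, which lies in `1 + J` and satisfies `p J = J p = 0`. An endomorphism `φ`
splits as `p φ + (1 - p) φ`. For the first summand, `p φ` takes values in the tensors killed by all
caps; their weight spaces are at most one-dimensional and reached by `F` from `x₀ ⊗ ⋯ ⊗ x₀`, so `p
φ` is a multiple of `p`. For the second summand it is enough to treat `e φ` with `e` the last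
generator. Bending one strand turns the last cap composed with `φ` into an endomorphism of a shorter
tensor power, to which induction applies. Faithfulness uses the same split, together with the fact
that multiplying the last generator on the right by `TL_n` gives nothing more than multiplying it by
`TL_{n-1}` (`IsTLFamily.exists_last_mul`).

A half-diagram with `k` defects gives a tensor: a cup for each link, `x₀` for each defect, with
suitable signs. These tensors are linearly independent highest weight vectors of weight `k`, and the
`e i` act on them by the diagram rule; hence `H(k)` embeds in tensor space and inherits the
relations from there. By semisimplicity `End_U` moves any nonzero highest weight vector to any other
of the same weight, and `End_U` is the image of `TL_n`. So `H(k)` is simple and at the same time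
equal to the whole highest weight space (`exists_cellRep_apply_eq`). The bimodule decomposition
follows, and the density theorem gives the surjectivity of `U` onto the commutant of `TL_n`. -/

/-- The elements `e 0, …, e (N - 1)` satisfy the Temperley–Lieb relations with parameter `δ`. -/
structure IsTLFamily {𝕜 A : Type*} [Field 𝕜] [Ring A] [Algebra 𝕜 A] (δ : 𝕜) (N : ℕ)
    (e : ℕ → A) : Prop where
  sq : ∀ i < N, e i * e i = δ • e i
  up : ∀ i, i + 1 < N → e i * e (i + 1) * e i = e i
  down : ∀ i, i + 1 < N → e (i + 1) * e i * e (i + 1) = e (i + 1)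
  comm : ∀ i j, i + 1 < j → j < N → Commute (e i) (e j)

section Family

variable {𝕜 A : Type*} [Field 𝕜] [Ring A] [Algebra 𝕜 A] {δ : 𝕜} {N : ℕ} {e : ℕ → A}

variable (𝕜) in
/-- The subalgebra generated by `e 0, …, e (m - 1)`. -/
def initialAlg (e : ℕ → A) (m : ℕ) : Subalgebra 𝕜 A := Algebra.adjoin 𝕜 (e '' Set.Iio m)

theorem mem_initialAlg {m i : ℕ} (h : i < m) : e i ∈ initialAlg 𝕜 e m :=
  Algebra.subset_adjoin ⟨i, h, rfl⟩

theorem initialAlg_mono {m m' : ℕ} (h : m ≤ m') : initialAlg 𝕜 e m ≤ initialAlg 𝕜 e m' :=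
  Algebra.adjoin_mono (Set.image_mono (Set.Iio_subset_Iio h))

theorem initialAlg_induction {m : ℕ} {p : A → Prop} (h1 : ∀ c : 𝕜, p (algebraMap 𝕜 A c))
    (hadd : ∀ x y, p x → p y → p (x + y)) (hmul : ∀ x y, p x → p y → p (x * y))
    (hgen : ∀ i < m, p (e i)) {x : A} (hx : x ∈ initialAlg 𝕜 e m) : p x := by
  induction hx using Algebra.adjoin_induction with
  | mem x hx => obtain ⟨i, hi, rfl⟩ := hx; exact hgen i hi
  | algebraMap c => exact h1 c
  | add x y _ _ hx hy => exact hadd x y hx hy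
  | mul x y _ _ hx hy => exact hmul x y hx hy

/-- The generators of `initialAlg 𝕜 e m` have index below `m`, hence at distance at least two from
`j`. For `m = 0` there are only scalars; this case is needed to start inductions at `e 0`. -/
theorem IsTLFamily.commute_initialAlg (h : IsTLFamily δ N e) {m j : ℕ} (hm : m < j ∨ m = 0)
    (hj : j < N) {b : A} (hb : b ∈ initialAlg 𝕜 e m) : Commute b (e j) := by
  refine initialAlg_induction (p := fun b => Commute b (e j)) (fun c => Algebra.commutes c _)
    (fun x y => Commute.add_left) (fun x y => Commute.mul_left) (fun i hi => ?_) hb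
  exact h.comm i j (by omega) hj

/-- The span of the elements `a` and `a * e m * b` with `a, b` in `initialAlg 𝕜 e m`. -/
theorem mem_span_of_conj {m : ℕ}
    (hc : ∀ b ∈ initialAlg 𝕜 e m, ∃ b' ∈ initialAlg 𝕜 e (m - 1), e m * b * e m = b' * e m)
    {x : A} (hx : x ∈ initialAlg 𝕜 e (m + 1)) :
    x ∈ Submodule.span 𝕜 ((initialAlg 𝕜 e m : Set A) ∪
      {y | ∃ a ∈ initialAlg 𝕜 e m, ∃ b ∈ initialAlg 𝕜 e m, y = a * e m * b}) := by
  set D := Submodule.span 𝕜 ((initialAlg 𝕜 e m : Set A) ∪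
      {y | ∃ a ∈ initialAlg 𝕜 e m, ∃ b ∈ initialAlg 𝕜 e m, y = a * e m * b}) with hD
  suffices H : ∀ d ∈ D, d * x ∈ D by
    simpa using H 1 (Submodule.subset_span (Or.inl (one_mem _)))
  refine initialAlg_induction (p := fun x => ∀ d ∈ D, d * x ∈ D) ?_ ?_ ?_ ?_ hx
  · intro c d hd
    rw [← Algebra.commutes, ← Algebra.smul_def]
    exact D.smul_mem c hd
  · intro x y hx hy d hd
    rw [mul_add]
    exact D.add_mem (hx d hd) (hy d hd)
  · intro x y hx hy d hd
    rw [← mul_assoc]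
    exact hy _ (hx d hd)
  · intro i hi d hd
    induction hd using Submodule.span_induction with
    | zero => simp
    | add x y _ _ hx hy => rw [add_mul]; exact D.add_mem hx hy
    | smul c x _ hx => rw [smul_mul_assoc]; exact D.smul_mem c hx
    | mem d hd =>
      rcases hd with hd | ⟨a, ha, b, hb, rfl⟩
      · rcases Nat.lt_succ_iff_lt_or_eq.1 hi with hi | rfl
        · exact Submodule.subset_span (Or.inl (mul_mem hd (mem_initialAlg hi)))
        · exact Submodule.subset_span (Or.inr ⟨d, hd, 1, one_mem _, by simp⟩)
      · rcases Nat.lt_succ_iff_lt_or_eq.1 hi with hi | rfl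
        · exact Submodule.subset_span
            (Or.inr ⟨a, ha, b * e i, mul_mem hb (mem_initialAlg hi), by simp only [mul_assoc]⟩)
        · obtain ⟨b', hb', hbe⟩ := hc b hb
          refine Submodule.subset_span (Or.inr ⟨a * b',
            mul_mem ha (initialAlg_mono (Nat.sub_le _ _) hb'), 1, one_mem _, ?_⟩)
          rw [mul_one, mul_assoc a b', ← hbe]
          simp only [mul_assoc]

/-- An element of the next algebra needs at most one factor `e m`, by `mem_span_of_conj` and
induction. Then `e (m + 1)` commutes past everything except that factor, and `e (m + 1) * e m * e (m
+ 1) = e (m + 1)` or `e (m + 1) ^ 2 = δ e (m + 1)` finishes. Diagrammatically, the last strand is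
closed up. -/
theorem IsTLFamily.conj_mem (h : IsTLFamily δ N e) (m : ℕ) (hm : m < N) :
    ∀ b ∈ initialAlg 𝕜 e m, ∃ b' ∈ initialAlg 𝕜 e (m - 1), e m * b * e m = b' * e m := by
  induction m with
  | zero =>
    intro b hb
    refine ⟨δ • b, Subalgebra.smul_mem _ hb _, ?_⟩
    rw [← (h.commute_initialAlg (Or.inr rfl) hm hb).eq, mul_assoc, h.sq 0 hm, mul_smul_comm,
      smul_mul_assoc]
  | succ m ih =>
    intro b hb
    have hs := mem_span_of_conj (ih (by omega)) hb
    clear hb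
    simp only [Nat.add_sub_cancel]
    induction hs using Submodule.span_induction with
    | zero => exact ⟨0, zero_mem _, by simp⟩
    | add x y _ _ hx hy =>
      obtain ⟨x', hx', hx⟩ := hx
      obtain ⟨y', hy', hy⟩ := hy
      exact ⟨x' + y', add_mem hx' hy', by rw [mul_add, add_mul, hx, hy, add_mul]⟩
    | smul c x _ hx =>
      obtain ⟨x', hx', hx⟩ := hx
      exact ⟨c • x', Subalgebra.smul_mem _ hx' _, by simp [hx]⟩
    | mem d hd =>
      rcases hd with hd | ⟨a, ha, b, hb, rfl⟩
      · refine ⟨δ • d, Subalgebra.smul_mem _ hd _, ?_⟩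
        rw [← (h.commute_initialAlg (Or.inl (Nat.lt_succ_self m)) hm hd).eq, mul_assoc,
          h.sq _ hm, mul_smul_comm, smul_mul_assoc]
      · refine ⟨a * b, mul_mem ha hb, ?_⟩
        have ca := (h.commute_initialAlg (Or.inl (Nat.lt_succ_self m)) hm ha).eq
        have cb := (h.commute_initialAlg (Or.inl (Nat.lt_succ_self m)) hm hb).eq
        calc e (m + 1) * (a * e m * b) * e (m + 1)
            = (e (m + 1) * a) * e m * (b * e (m + 1)) := by simp only [mul_assoc]
          _ = a * (e (m + 1) * e m * e (m + 1)) * b := by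
              rw [← ca, cb]; simp only [mul_assoc]
          _ = a * b * e (m + 1) := by rw [h.down m hm, mul_assoc, ← cb, mul_assoc]

/-- Any further occurrence of `e m` is absorbed: `e m * b * e m = b' * e m = e m * b'` by
`conj_mem`. This is what lets the faithfulness argument descend from `n` strands to `n - 1`. -/
theorem IsTLFamily.exists_last_mul (h : IsTLFamily δ N e) {m : ℕ} (hm : m < N) {x : A}
    (hx : x ∈ initialAlg 𝕜 e (m + 1)) : ∃ b ∈ initialAlg 𝕜 e m, e m * x = e m * b := by
  suffices H : ∀ b ∈ initialAlg 𝕜 e m, ∃ b' ∈ initialAlg 𝕜 e m, e m * b * x = e m * b' by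
    simpa using H 1 (one_mem _)
  refine initialAlg_induction (p := fun x => ∀ b ∈ initialAlg 𝕜 e m,
    ∃ b' ∈ initialAlg 𝕜 e m, e m * b * x = e m * b') ?_ ?_ ?_ ?_ hx
  · exact fun c b hb => ⟨b * algebraMap 𝕜 A c, mul_mem hb (Subalgebra.algebraMap_mem _ c),
      mul_assoc _ _ _⟩
  · intro x y hx hy b hb
    obtain ⟨x', hx', hx⟩ := hx b hb
    obtain ⟨y', hy', hy⟩ := hy b hb
    exact ⟨x' + y', add_mem hx' hy', by rw [mul_add, hx, hy, mul_add]⟩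
  · intro x y hx hy b hb
    obtain ⟨x', hx', hx⟩ := hx b hb
    obtain ⟨y', hy', hy⟩ := hy x' hx'
    exact ⟨y', hy', by rw [← mul_assoc, hx, hy]⟩
  · intro i hi b hb
    rcases Nat.lt_succ_iff_lt_or_eq.1 hi with hi | rfl
    · exact ⟨b * e i, mul_mem hb (mem_initialAlg hi), mul_assoc _ _ _⟩
    · obtain ⟨b', hb', hbe⟩ := h.conj_mem i hm b hb
      refine ⟨b', initialAlg_mono (Nat.sub_le _ _) hb', ?_⟩
      rw [hbe]
      exact h.commute_initialAlg (by omega) hm hb'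

variable (𝕜) in
/-- The two-sided ideal generated by `e 0, …, e (N - 1)`, as a linear subspace. -/
def capIdeal (N : ℕ) (e : ℕ → A) : Submodule 𝕜 A :=
  Submodule.span 𝕜 {y | ∃ i < N, ∃ a b, y = a * e i * b}

theorem mul_mem_capIdeal {a x : A} (hx : x ∈ capIdeal 𝕜 N e) : a * x ∈ capIdeal 𝕜 N e := by
  induction hx using Submodule.span_induction with
  | zero => simp
  | add x y _ _ hx hy => rw [mul_add]; exact add_mem hx hy
  | smul c x _ hx => rw [mul_smul_comm]; exact Submodule.smul_mem _ c hx
  | mem d hd =>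
    obtain ⟨i, hi, a', b, rfl⟩ := hd
    exact Submodule.subset_span ⟨i, hi, a * a', b, by simp only [mul_assoc]⟩

theorem capIdeal_mul_mem {a x : A} (hx : x ∈ capIdeal 𝕜 N e) : x * a ∈ capIdeal 𝕜 N e := by
  induction hx using Submodule.span_induction with
  | zero => simp
  | add x y _ _ hx hy => rw [add_mul]; exact add_mem hx hy
  | smul c x _ hx => rw [smul_mul_assoc]; exact Submodule.smul_mem _ c hx
  | mem d hd =>
    obtain ⟨i, hi, a', b, rfl⟩ := hd
    exact Submodule.subset_span ⟨i, hi, a', b * a, by simp only [mul_assoc]⟩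

/-- The sequence of Jones–Wenzl elements with coefficients `c`. -/
def jonesWenzl (c : ℕ → 𝕜) (e : ℕ → A) : ℕ → A
  | 0 => 1
  | m + 1 => jonesWenzl c e m - c m • (jonesWenzl c e m * e m * jonesWenzl c e m)

theorem jonesWenzl_mem (c : ℕ → 𝕜) (e : ℕ → A) (m : ℕ) :
    jonesWenzl c e m ∈ initialAlg 𝕜 e m := by
  induction m with
  | zero => exact one_mem _
  | succ m ih =>
    have ih := initialAlg_mono (Nat.le_succ m) ih
    exact sub_mem ih (Subalgebra.smul_mem _
      (mul_mem (mul_mem ih (mem_initialAlg (Nat.lt_succ_self m))) ih) _)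

theorem jonesWenzl_sub_one_mem (c : ℕ → 𝕜) (e : ℕ → A) {m : ℕ} (hm : m ≤ N) :
    jonesWenzl c e m - 1 ∈ capIdeal 𝕜 N e := by
  induction m with
  | zero => simp [jonesWenzl]
  | succ m ih =>
    rw [jonesWenzl, sub_right_comm]
    exact sub_mem (ih (by omega))
      (Submodule.smul_mem _ _ (Submodule.subset_span ⟨m, hm, _, _, rfl⟩))

/-- The last clause carries the induction: it is the partial trace formula, with `q` the previous
idempotent. Since `c m * d = 1`, the correction term in the recursion is exactly what makes `e m`
annihilate the next element. -/
theorem IsTLFamily.jonesWenzl_spec (h : IsTLFamily δ N e) {c : ℕ → 𝕜} (c0 : c 0 * δ = 1)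
    (cs : ∀ m, c (m + 1) * (δ - c m) = 1) (m : ℕ) (hm : m ≤ N) :
    jonesWenzl c e m * jonesWenzl c e m = jonesWenzl c e m ∧
    (∀ i < m, e i * jonesWenzl c e m = 0 ∧ jonesWenzl c e m * e i = 0) ∧
    (m < N → ∃ q, ∃ d : 𝕜, Commute q (e m) ∧ q * jonesWenzl c e m = jonesWenzl c e m ∧
      jonesWenzl c e m * q = jonesWenzl c e m ∧
      e m * jonesWenzl c e m * e m = d • (q * e m) ∧ c m * d = 1) := by
  induction m with
  | zero =>
    refine ⟨by simp [jonesWenzl], by simp, fun hN => ⟨1, δ, Commute.one_left _, by simp,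
      by simp, by simp [jonesWenzl, h.sq 0 hN], c0⟩⟩
  | succ m ih =>
    obtain ⟨hpp, he, hq⟩ := ih (by omega)
    obtain ⟨q, d, hqc, hqp, hpq, hepe, hcd⟩ := hq (by omega)
    set p := jonesWenzl c e m with hp
    have hp' : jonesWenzl c e (m + 1) = p - c m • (p * e m * p) := rfl
    rw [hp']
    have l1 : p * (p - c m • (p * e m * p)) = p - c m • (p * e m * p) := by
      rw [mul_sub, mul_smul_comm, ← mul_assoc, ← mul_assoc, hpp]
    have l2 : (p - c m • (p * e m * p)) * p = p - c m • (p * e m * p) := by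
      rw [sub_mul, smul_mul_assoc, mul_assoc _ p p, hpp]
    have r1 : e m * (p - c m • (p * e m * p)) = 0 := by
      rw [mul_sub, mul_smul_comm, ← mul_assoc, ← mul_assoc, hepe, smul_mul_assoc, smul_smul, hcd,
        one_smul, hqc.eq, mul_assoc, hqp, sub_self]
    have r2 : (p - c m • (p * e m * p)) * e m = 0 := by
      rw [sub_mul, smul_mul_assoc, mul_assoc p (e m) p, mul_assoc p (e m * p), hepe,
        mul_smul_comm, smul_smul, hcd, one_smul, ← mul_assoc, hpq, sub_self]
    refine ⟨?_, ?_, ?_⟩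
    · conv_lhs => rw [mul_sub, l2, mul_smul_comm, ← mul_assoc, ← mul_assoc, l2, r2]
      simp
    · intro i hi
      rcases Nat.lt_succ_iff_lt_or_eq.1 hi with hi | rfl
      · constructor
        · rw [mul_sub, mul_smul_comm, ← mul_assoc, ← mul_assoc, (he i hi).1]; simp
        · rw [sub_mul, smul_mul_assoc, mul_assoc _ p, (he i hi).2]; simp
      · exact ⟨r1, r2⟩
    · intro hN
      have hc : Commute p (e (m + 1)) :=
        h.commute_initialAlg (Or.inl (Nat.lt_succ_self m)) hN (jonesWenzl_mem c e m)
      -- The two summands of the new element contribute `δ` (from `e (m + 1) ^ 2`) and `c m` (from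
      -- the zigzag).
      refine ⟨p, δ - c m, hc, l1, l2, ?_, cs m⟩
      have h1 : e (m + 1) * p * e (m + 1) = δ • (p * e (m + 1)) := by
        rw [← hc.eq, mul_assoc, h.sq _ hN, mul_smul_comm]
      have h2 : e (m + 1) * (p * e m * p) * e (m + 1) = p * e (m + 1) := by
        calc _ = (e (m + 1) * p) * e m * (p * e (m + 1)) := by simp only [mul_assoc]
          _ = (p * e (m + 1)) * e m * (e (m + 1) * p) :=
              congrArg₂ (fun x y => x * e m * y) hc.eq.symm hc.eq
          _ = p * (e (m + 1) * e m * e (m + 1)) * p := by simp only [mul_assoc]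
          _ = _ := by rw [h.down m hN, mul_assoc, ← hc.eq, ← mul_assoc, hpp]
      rw [mul_sub, sub_mul, mul_smul_comm, smul_mul_assoc, h1, h2, sub_smul]

end Family

end SchurWeyl

/-! ## Tensor space in coordinates -/

namespace SchurWeyl

/-- Tensor space in coordinates: functions on the index set of the standard basis. -/
abbrev Coord (𝕜 : Type*) (n : ℕ) : Type _ := (Fin n → Fin 2) → 𝕜

/-! ### Cup-cap operators and their Temperley–Lieb relations. -/

section Cap

variable {𝕜 : Type*} [Field 𝕜] (v : 𝕜ˣ) (ε : 𝕜) {n : ℕ}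

/-- The coordinates of the invariant vector `v⁻¹ x₀ ⊗ x₁ - x₁ ⊗ x₀`. -/
def cupCoeff (i : Fin 2) : 𝕜 := if i = 0 then (v : 𝕜)⁻¹ else -1

/-- Replace the entries in positions `a` and `b`. -/
def setPair (s : Fin n → Fin 2) (a b : Fin n) (x y : Fin 2) : Fin n → Fin 2 :=
  Function.update (Function.update s a x) b y

/-- The contraction of the positions `a, b`, with values independent of `s a`, `s b`. -/
def capAt (f : Coord 𝕜 n) (a b : Fin n) (s : Fin n → Fin 2) : 𝕜 :=
  f (setPair s a b 0 1) - v * f (setPair s a b 1 0)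

/-- The operator `± (v + v⁻¹) u` acting in the tensor positions `a, b`. -/
def capCup (a b : Fin n) : Module.End 𝕜 (Coord 𝕜 n) where
  toFun f s := if s a = s b then 0 else ε * cupCoeff v (s a) * capAt v f a b s
  map_add' f g := by
    ext s; simp only [capAt, Pi.add_apply]; split_ifs <;> ring
  map_smul' c f := by
    ext s; simp only [capAt, Pi.smul_apply, RingHom.id_apply, smul_eq_mul]; split_ifs <;> ring

theorem capCup_apply (a b : Fin n) (f : Coord 𝕜 n) (s : Fin n → Fin 2) :
    capCup v ε a b f s = if s a = s b then 0 else ε * cupCoeff v (s a) * capAt v f a b s := rfl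

theorem fin_two_cases (x : Fin 2) : x = 0 ∨ x = 1 := by
  fin_cases x <;> simp

theorem setPair_left {a b : Fin n} (hab : a ≠ b) (s : Fin n → Fin 2) (x y : Fin 2) :
    setPair s a b x y a = x := by
  simp [setPair, hab]

theorem setPair_right {a b : Fin n} (s : Fin n → Fin 2) (x y : Fin 2) :
    setPair s a b x y b = y := by
  simp [setPair]

theorem setPair_of_ne {a b c : Fin n} (ha : c ≠ a) (hb : c ≠ b) (s : Fin n → Fin 2)
    (x y : Fin 2) : setPair s a b x y c = s c := by
  simp [setPair, ha, hb]

theorem setPair_setPair (s : Fin n → Fin 2) (a b : Fin n) (x y x' y' : Fin 2) :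
    setPair (setPair s a b x y) a b x' y' = setPair s a b x' y' := by
  ext c
  by_cases hb : c = b
  · subst hb; simp [setPair]
  · by_cases ha : c = a
    · subst ha; simp [setPair, hb]
    · simp [setPair, ha, hb]

theorem setPair_eq_self {a b : Fin n} {s : Fin n → Fin 2} {x y : Fin 2} (hx : s a = x)
    (hy : s b = y) : setPair s a b x y = s := by
  subst hx hy; simp [setPair]

theorem setPair_setPair_comm {a b c d : Fin n} (hac : a ≠ c) (had : a ≠ d) (hbc : b ≠ c)
    (hbd : b ≠ d) (s : Fin n → Fin 2) (x y x' y' : Fin 2) :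
    setPair (setPair s a b x y) c d x' y' = setPair (setPair s c d x' y') a b x y := by
  simp only [setPair]
  rw [Function.update_comm hbc, Function.update_comm hbd, Function.update_comm hac,
    Function.update_comm had]

theorem capAt_setPair (f : Coord 𝕜 n) (a b : Fin n) (s : Fin n → Fin 2) (x y : Fin 2) :
    capAt v f a b (setPair s a b x y) = capAt v f a b s := by
  simp only [capAt, setPair_setPair]

variable {ε}

/-- The value of a loop: contracting the invariant vector gives `v⁻¹ - v * (-1)`. -/
theorem capAt_capCup {a b : Fin n} (hab : a ≠ b) (f : Coord 𝕜 n) (s : Fin n → Fin 2) :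
    capAt v (capCup v ε a b f) a b s = ε * ((v : 𝕜) + (v : 𝕜)⁻¹) * capAt v f a b s := by
  rw [capAt, capCup_apply, capCup_apply, setPair_left hab, setPair_left hab, setPair_right,
    setPair_right, capAt_setPair, capAt_setPair]
  simp [cupCoeff]
  ring

theorem capCup_sq {a b : Fin n} (hab : a ≠ b) :
    capCup v ε a b * capCup v ε a b = (ε * ((v : 𝕜) + (v : 𝕜)⁻¹)) • capCup v ε a b := by
  refine LinearMap.ext fun f => funext fun s => ?_
  rw [Module.End.mul_apply, capCup_apply, capAt_capCup v hab, LinearMap.smul_apply, Pi.smul_apply,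
    capCup_apply]
  split_ifs
  · simp
  · rw [smul_eq_mul]; ring

theorem capCup_comm {a b c d : Fin n} (hac : a ≠ c) (had : a ≠ d) (hbc : b ≠ c)
    (hbd : b ≠ d) : Commute (capCup v ε a b) (capCup v ε c d) := by
  refine LinearMap.ext fun f => funext fun s => ?_
  simp only [Module.End.mul_apply, capCup_apply, capAt, setPair_of_ne hac.symm hbc.symm,
    setPair_of_ne had.symm hbd.symm, setPair_of_ne hac had, setPair_of_ne hbc hbd,
    setPair_setPair_comm hac had hbc hbd]
  split_ifs <;> ring

theorem capAt_congr (f : Coord 𝕜 n) {a b : Fin n} {s t : Fin n → Fin 2}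
    (h : ∀ d, d ≠ a → d ≠ b → s d = t d) : capAt v f a b s = capAt v f a b t := by
  have key : ∀ x y, setPair s a b x y = setPair t a b x y := by
    intro x y
    ext d
    by_cases hb : d = b
    · subst hb; simp [setPair]
    · by_cases ha : d = a
      · subst ha; simp [setPair, hb]
      · simp [setPair, ha, hb, h d ha hb]
  simp only [capAt, key]

/-- Two zigzags are straightened. Each costs a factor `-1` with this choice of cup and cap, so the
signs cancel and only `ε * ε` and `v * v⁻¹` remain. -/
theorem capCup_zigzag_right (hε : ε * ε = 1) {a b c : Fin n} (hab : a ≠ b) (hcb : c ≠ b)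
    (hac : a ≠ c) : capCup v ε a b * capCup v ε b c * capCup v ε a b = capCup v ε a b := by
  refine LinearMap.ext fun f => funext fun s => ?_
  have hv : (v : 𝕜) ≠ 0 := v.ne_zero
  have key : ∀ x y y' z, z = s c →
      capAt v f a b (setPair (setPair s a b x y) b c y' z) = capAt v f a b s := by
    intro x y y' z hz
    refine capAt_congr v f fun d hda hdb => ?_
    by_cases hdc : d = c
    · subst hdc; rw [setPair_right, hz]
    · rw [setPair_of_ne hdb hdc, setPair_of_ne hda hdb]
  simp only [Module.End.mul_apply]
  rw [capCup_apply, capCup_apply v ε a b f]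
  split_ifs with hs
  · rfl
  suffices H : capAt v (capCup v ε b c (capCup v ε a b f)) a b s = capAt v f a b s by rw [H]
  rw [capAt, capCup_apply, capCup_apply, capAt, capAt]
  simp only [capCup_apply, setPair_left hcb.symm, setPair_right,
    setPair_of_ne hab hac, setPair_left hab, setPair_of_ne hac.symm hcb, cupCoeff]
  rcases fin_two_cases (s c) with h | h
  · rw [key _ _ _ _ h.symm]
    simp only [h]
    simp
    linear_combination (v : 𝕜) * (v : 𝕜)⁻¹ * capAt v f a b s * hε +
      capAt v f a b s * mul_inv_cancel₀ hv
  · rw [key 1 0 0 1 h.symm]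
    simp only [h]
    simp
    linear_combination (v : 𝕜) * (v : 𝕜)⁻¹ * capAt v f a b s * hε +
      capAt v f a b s * mul_inv_cancel₀ hv

theorem capCup_zigzag_left (hε : ε * ε = 1) {a b c : Fin n} (hab : a ≠ b) (hcb : c ≠ b)
    (hac : a ≠ c) : capCup v ε b c * capCup v ε a b * capCup v ε b c = capCup v ε b c := by
  refine LinearMap.ext fun f => funext fun s => ?_
  have hv : (v : 𝕜) ≠ 0 := v.ne_zero
  have key : ∀ x y y' z, z = s a →
      capAt v f b c (setPair (setPair s b c x y) a b z y') = capAt v f b c s := by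
    intro x y y' z hz
    refine capAt_congr v f fun d hdb hdc => ?_
    by_cases hda : d = a
    · subst hda; rw [setPair_left hab, hz]
    · rw [setPair_of_ne hda hdb, setPair_of_ne hdb hdc]
  simp only [Module.End.mul_apply]
  rw [capCup_apply, capCup_apply v ε b c f]
  split_ifs with hs
  · rfl
  suffices H : capAt v (capCup v ε a b (capCup v ε b c f)) b c s = capAt v f b c s by rw [H]
  rw [capAt, capCup_apply, capCup_apply, capAt, capAt]
  simp only [capCup_apply, setPair_left hcb.symm, setPair_right, setPair_of_ne hac.symm hcb,
    setPair_of_ne hab hac, cupCoeff]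
  rcases fin_two_cases (s a) with h | h
  · rw [key 1 0 1 _ h.symm]
    simp only [h]
    simp
    linear_combination (v : 𝕜) * (v : 𝕜)⁻¹ * capAt v f b c s * hε +
      capAt v f b c s * mul_inv_cancel₀ hv
  · rw [key _ _ 0 1 h.symm]
    simp only [h]
    simp
    linear_combination (v : 𝕜) * (v : 𝕜)⁻¹ * capAt v f b c s * hε +
      capAt v f b c s * mul_inv_cancel₀ hv

end Cap

/-! ### Splitting off the last tensor factor. -/

section Slices

variable {𝕜 : Type*} [Field 𝕜] {n : ℕ}

variable (𝕜) in
/-- The coordinates of a tensor, with the last index fixed to be `b`. -/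
def slice (n : ℕ) (b : Fin 2) : Coord 𝕜 (n + 1) →ₗ[𝕜] Coord 𝕜 n where
  toFun f s := f (Fin.snoc (α := fun _ => Fin 2) s b)
  map_add' _ _ := rfl
  map_smul' _ _ := rfl

theorem slice_apply (b : Fin 2) (f : Coord 𝕜 (n + 1)) (s : Fin n → Fin 2) :
    slice 𝕜 n b f s = f (Fin.snoc (α := fun _ => Fin 2) s b) := rfl

theorem slice_ext {f g : Coord 𝕜 (n + 1)} (h : ∀ b, slice 𝕜 n b f = slice 𝕜 n b g) : f = g := by
  ext s
  have := congrFun (h (s (Fin.last n))) (Fin.init s)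
  simpa only [slice_apply, Fin.snoc_init_self] using this

variable (𝕜) in
/-- The map `t ↦ t ⊗ x_b`. -/
def addLast (n : ℕ) (b : Fin 2) : Coord 𝕜 n →ₗ[𝕜] Coord 𝕜 (n + 1) where
  toFun f s := if s (Fin.last n) = b then f (Fin.init s) else 0
  map_add' f g := by ext s; simp only [Pi.add_apply]; split_ifs <;> simp
  map_smul' c f := by ext s; simp

theorem slice_addLast (b c : Fin 2) (f : Coord 𝕜 n) :
    slice 𝕜 n b (addLast 𝕜 n c f) = if b = c then f else 0 := by
  ext s
  rw [slice_apply]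
  by_cases h : b = c <;> simp [addLast, h]

theorem eq_addLast (f : Coord 𝕜 (n + 1)) :
    f = addLast 𝕜 n 0 (slice 𝕜 n 0 f) + addLast 𝕜 n 1 (slice 𝕜 n 1 f) := by
  refine slice_ext fun b => ?_
  rw [map_add, slice_addLast, slice_addLast]
  rcases fin_two_cases b with rfl | rfl <;> simp

variable (v : 𝕜ˣ) (ε : 𝕜)

theorem setPair_snoc (s : Fin n → Fin 2) (a b : Fin n) (x y c : Fin 2) :
    setPair (Fin.snoc (α := fun _ => Fin 2) s c) a.castSucc b.castSucc x y =
      Fin.snoc (α := fun _ => Fin 2) (setPair s a b x y) c := by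
  simp only [setPair, Fin.snoc_update]

theorem slice_capCup (a b : Fin n) (c : Fin 2) (f : Coord 𝕜 (n + 1)) :
    slice 𝕜 n c (capCup v ε a.castSucc b.castSucc f) = capCup v ε a b (slice 𝕜 n c f) := by
  ext s
  rw [slice_apply, capCup_apply, capCup_apply]
  simp only [capAt, setPair_snoc, slice_apply, Fin.snoc_castSucc]

variable (𝕜) in
/-- The contraction of the last two tensor factors. -/
def lastCap (n : ℕ) (v : 𝕜ˣ) : Coord 𝕜 (n + 2) →ₗ[𝕜] Coord 𝕜 n :=
  slice 𝕜 n 0 ∘ₗ slice 𝕜 (n + 1) 1 - (v : 𝕜) • (slice 𝕜 n 1 ∘ₗ slice 𝕜 (n + 1) 0)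

theorem setPair_last (s : Fin n → Fin 2) (x y b c : Fin 2) :
    setPair (Fin.snoc (α := fun _ => Fin 2) (Fin.snoc (α := fun _ => Fin 2) s b) c)
      (Fin.last n).castSucc (Fin.last (n + 1)) x y =
    Fin.snoc (α := fun _ => Fin 2) (Fin.snoc (α := fun _ => Fin 2) s x) y := by
  have h (s : Fin (n + 1) → Fin 2) : Function.update (Fin.snoc (α := fun _ => Fin 2) s c)
    (Fin.last n).castSucc x =
      Fin.snoc (α := fun _ => Fin 2) (Function.update s (Fin.last n) x) c :=
    (Fin.snoc_update _ _ _ _).symm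
  rw [setPair, h, Fin.update_snoc_last, Fin.update_snoc_last]

/-- The operator on the last two positions factors as the cup after `lastCap`; this is how
contraction arguments are read off from it. -/
theorem slice_capCup_last (b c : Fin 2) (f : Coord 𝕜 (n + 2)) :
    slice 𝕜 n b (slice 𝕜 (n + 1) c (capCup v ε (Fin.last n).castSucc (Fin.last (n + 1)) f)) =
      if b = c then 0 else (ε * cupCoeff v b) • lastCap 𝕜 n v f := by
  ext s
  rw [slice_apply, slice_apply, capCup_apply]
  have : (Fin.snoc (α := fun _ => Fin 2) (Fin.snoc (α := fun _ => Fin 2) s b) c : Fin (n + 2) → Fin 2) (Fin.last n).castSucc = b := by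
    rw [Fin.snoc_castSucc, Fin.snoc_last]
  rw [this, Fin.snoc_last, capAt, setPair_last, setPair_last]
  split_ifs
  · rfl
  · simp [lastCap, slice_apply]

end Slices

end SchurWeyl

/-! ## Transport of the actions to coordinates -/

namespace SchurWeyl

section Transport

variable {𝕜 : Type*} [Field 𝕜]

variable (𝕜) in
/-- The coordinates on tensor space with respect to the standard basis. -/
noncomputable def coordEquiv (n : ℕ) : TSpace 𝕜 n ≃ₗ[𝕜] Coord 𝕜 n :=
  (Basis.piTensorProduct fun _ : Fin n => Pi.basisFun 𝕜 (Fin 2)).equivFun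

theorem coordEquiv_tprod (n : ℕ) (x : Fin n → VMod 𝕜 1) (s : Fin n → Fin 2) :
    coordEquiv 𝕜 n (PiTensorProduct.tprod 𝕜 x) s = ∏ i, x i (s i) := by
  rw [coordEquiv, Module.Basis.equivFun_apply, Basis.piTensorProduct_repr_tprod_apply]
  simp

theorem coordEquiv_mulEquiv {m n : ℕ} (t : TSpace 𝕜 m) (t' : TSpace 𝕜 n)
    (s : Fin (m + n) → Fin 2) :
    coordEquiv 𝕜 (m + n) (TensorPower.mulEquiv (t ⊗ₜ[𝕜] t')) s =
      coordEquiv 𝕜 m t (fun i => s (Fin.castAdd n i)) *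
        coordEquiv 𝕜 n t' (fun i => s (Fin.natAdd m i)) := by
  induction t using PiTensorProduct.induction_on with
  | add x y hx hy =>
    rw [TensorProduct.add_tmul, map_add, map_add, Pi.add_apply, hx, hy, map_add, Pi.add_apply,
      add_mul]
  | smul_tprod r a =>
    induction t' using PiTensorProduct.induction_on with
    | add x y hx hy =>
      rw [TensorProduct.tmul_add, map_add, map_add, Pi.add_apply, hx, hy, map_add, Pi.add_apply,
        mul_add]
    | smul_tprod r' b =>
      have := TensorPower.tprod_mul_tprod 𝕜 a b
      rw [TensorPower.gMul_def] at this
      simp only [TensorProduct.tmul_smul, ← TensorProduct.smul_tmul', map_smul, this, Pi.smul_apply, coordEquiv_tprod, smul_eq_mul]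
      rw [Fin.prod_univ_add]
      simp only [Fin.append_left, Fin.append_right]
      ring

theorem coordEquiv_oneEquiv (y : VMod 𝕜 1) (s : Fin 1 → Fin 2) :
    coordEquiv 𝕜 1 (oneEquiv 𝕜 y) s = y (s 0) := by
  have : oneEquiv 𝕜 y = PiTensorProduct.tprod 𝕜 (fun _ => y) := by
    rw [oneEquiv, LinearEquiv.symm_apply_eq]
    exact (PiTensorProduct.subsingletonEquiv_apply_tprod (R := 𝕜)
      (s := fun _ : Fin 1 => VMod 𝕜 1) 0 (fun _ => y)).symm
  rw [this, coordEquiv_tprod]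
  simp

theorem coordEquiv_cast {m n : ℕ} (h : m = n) (t : TSpace 𝕜 m) (s : Fin n → Fin 2) :
    coordEquiv 𝕜 n (TensorPower.cast 𝕜 (VMod 𝕜 1) h t) s =
      coordEquiv 𝕜 m t (fun i => s (Fin.cast h i)) := by
  subst h
  simp

theorem coordEquiv_succEquiv {n : ℕ} (t : TSpace 𝕜 n) (y : VMod 𝕜 1) (b : Fin 2) :
    slice 𝕜 n b (coordEquiv 𝕜 (n + 1) (succEquiv 𝕜 n (t ⊗ₜ[𝕜] y))) =
      y b • coordEquiv 𝕜 n t := by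
  ext s
  have h : succEquiv 𝕜 n (t ⊗ₜ[𝕜] y) = TensorPower.mulEquiv (t ⊗ₜ[𝕜] oneEquiv 𝕜 y) := rfl
  rw [slice_apply, h, coordEquiv_mulEquiv, coordEquiv_oneEquiv, Pi.smul_apply, smul_eq_mul,
    mul_comm]
  have h1 : Fin.snoc (α := fun _ => Fin 2) s b (Fin.natAdd n 0) = b :=
    Fin.snoc_last (α := fun _ => Fin 2) b s
  have h2 : (fun i => Fin.snoc (α := fun _ => Fin 2) s b (Fin.castAdd 1 i)) = s :=
    funext fun i => Fin.snoc_castSucc (α := fun _ => Fin 2) b s i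
  rw [h1, h2]

theorem coordEquiv_pair (w : VMod 𝕜 1 ⊗[𝕜] VMod 𝕜 1) (s : Fin (1 + 1) → Fin 2) :
    coordEquiv 𝕜 (1 + 1) (TensorPower.mulEquiv
      (TensorProduct.map (oneEquiv 𝕜).toLinearMap (oneEquiv 𝕜).toLinearMap w)) s =
      (pairBasis 𝕜).repr w (finProdFinEquiv (m := 2) (n := 2) (s 0, s 1)) := by
  induction w using TensorProduct.induction_on with
  | zero =>
    rw [LinearMap.map_zero, LinearEquiv.map_zero, LinearEquiv.map_zero, LinearEquiv.map_zero]; rfl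
  | add x y hx hy =>
    rw [map_add, map_add, map_add, map_add, Pi.add_apply, Finsupp.add_apply, hx, hy]
  | tmul x y =>
    rw [TensorProduct.map_tmul, coordEquiv_mulEquiv]
    erw [coordEquiv_oneEquiv, coordEquiv_oneEquiv]
    simp only [pairBasis, Module.Basis.repr_reindex_apply, Equiv.symm_apply_apply,
      Module.Basis.tensorProduct_repr_tmul_apply, Pi.basisFun_repr, smul_eq_mul]
    rw [mul_comm]
    rfl

theorem add_two_add_lt {n : ℕ} (i : Fin (n - 1)) (j : Fin (n - 2 - i)) :
    (i : ℕ) + 2 + j < n := by omega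

theorem coordEquiv_splitEquiv {n : ℕ} (i : Fin (n - 1)) (t : TSpace 𝕜 i)
    (w : VMod 𝕜 1 ⊗[𝕜] VMod 𝕜 1) (t' : TSpace 𝕜 (n - 2 - i)) (s : Fin n → Fin 2) :
    coordEquiv 𝕜 n (splitEquiv 𝕜 n i ((t ⊗ₜ[𝕜] w) ⊗ₜ[𝕜] t')) s =
      coordEquiv 𝕜 i t (fun j => s ⟨j, by omega⟩) *
      (pairBasis 𝕜).repr w (finProdFinEquiv (m := 2) (n := 2) (s (lo i), s (hi i))) *
      coordEquiv 𝕜 (n - 2 - i) t' (fun j => s ⟨i + 2 + j, add_two_add_lt i j⟩) := by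
  have hs : splitEquiv 𝕜 n i ((t ⊗ₜ[𝕜] w) ⊗ₜ[𝕜] t') =
      TensorPower.cast 𝕜 (VMod 𝕜 1)
        (show (i : ℕ) + (1 + 1) + (n - 2 - i) = n by have := i.2; omega)
        (TensorPower.mulEquiv (TensorPower.mulEquiv (t ⊗ₜ[𝕜] TensorPower.mulEquiv
          (TensorProduct.map (oneEquiv 𝕜).toLinearMap (oneEquiv 𝕜).toLinearMap w)) ⊗ₜ[𝕜] t')) := rfl
  rw [hs, coordEquiv_cast, coordEquiv_mulEquiv, coordEquiv_mulEquiv, coordEquiv_pair]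
  rfl

variable (v : 𝕜ˣ)

theorem pairBasis_repr_uMap (w : VMod 𝕜 1 ⊗[𝕜] VMod 𝕜 1) (x y : Fin 2) :
    (pairBasis 𝕜).repr (uMap v w) (finProdFinEquiv (m := 2) (n := 2) (x, y)) =
      if x = y then 0 else ((v : 𝕜) + (v : 𝕜)⁻¹)⁻¹ * cupCoeff v x *
        ((pairBasis 𝕜).repr w (finProdFinEquiv (m := 2) (n := 2) (0, 1)) -
          v * (pairBasis 𝕜).repr w (finProdFinEquiv (m := 2) (n := 2) (1, 0))) := by
  have h01 : finProdFinEquiv (m := 2) (n := 2) (0, 1) = (1 : Fin 4) := by decide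
  have h10 : finProdFinEquiv (m := 2) (n := 2) (1, 0) = (2 : Fin 4) := by decide
  have h00 : finProdFinEquiv (m := 2) (n := 2) (0, 0) = (0 : Fin 4) := by decide
  have h11 : finProdFinEquiv (m := 2) (n := 2) (1, 1) = (3 : Fin 4) := by decide
  have hv : (v : 𝕜) ≠ 0 := v.ne_zero
  rw [h01, h10, uMap, ← LinearMap.toMatrix_mulVec_repr (pairBasis 𝕜) (pairBasis 𝕜),
    LinearMap.toMatrix_toLin]
  rcases fin_two_cases x with rfl | rfl <;> rcases fin_two_cases y with rfl | rfl <;>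
    simp only [h00, h01, h10, h11] <;>
    simp [Matrix.mulVec, dotProduct, Fin.sum_univ_four, cupCoeff]
  · field_simp; ring
  · field_simp; ring

theorem coordEquiv_uAt {n : ℕ} (ε : 𝕜) (h2 : (v : 𝕜) + (v : 𝕜)⁻¹ ≠ 0) (i : Fin (n - 1))
    (t : TSpace 𝕜 n) :
    coordEquiv 𝕜 n ((ε * ((v : 𝕜) + (v : 𝕜)⁻¹)) • uAt v n i t) =
      capCup v ε (lo i) (hi i) (coordEquiv 𝕜 n t) := by
  obtain ⟨t, rfl⟩ := (splitEquiv 𝕜 n i).surjective t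
  have hu (z) : uAt v n i (splitEquiv 𝕜 n i z) = splitEquiv 𝕜 n i
      (TensorProduct.map (TensorProduct.map LinearMap.id (uMap v)) LinearMap.id z) := by
    simp [uAt, LinearEquiv.conj_apply]
  rw [hu]
  induction t using TensorProduct.induction_on with
  | zero => simp only [LinearMap.map_zero, LinearEquiv.map_zero, smul_zero]
  | add x y hx hy => simp only [LinearMap.map_add, LinearEquiv.map_add, smul_add, hx, hy]
  | tmul z t' =>
    induction z using TensorProduct.induction_on with
    | zero =>
      simp only [TensorProduct.zero_tmul, LinearMap.map_zero, LinearEquiv.map_zero, smul_zero]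
    | add x y hx hy => simp only [LinearMap.map_add, LinearEquiv.map_add, smul_add,
      hx, hy, TensorProduct.add_tmul]
    | tmul t w =>
      ext s
      have hne : lo i ≠ hi i := by simp [lo, hi, Fin.ext_iff]
      have q1 (x y) (j : Fin (i : ℕ)) : setPair s (lo i) (hi i) x y ⟨j, by omega⟩ = s ⟨j, by omega⟩ :=
        setPair_of_ne (fun h => by have := congrArg Fin.val h; simp only [lo] at this; omega)
          (fun h => by have := congrArg Fin.val h; simp only [hi] at this; omega) _ _ _
      have q2 (x y : Fin 2) (j : Fin (n - 2 - i)) :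
          setPair s (lo i) (hi i) x y ⟨i + 2 + j, add_two_add_lt i j⟩ =
          s ⟨i + 2 + j, add_two_add_lt i j⟩ := by
        refine setPair_of_ne ?_ ?_ _ _ _
        · refine Fin.ne_of_val_ne ?_
          change (i : ℕ) + 2 + j ≠ i
          lia
        · refine Fin.ne_of_val_ne ?_
          change (i : ℕ) + 2 + j ≠ i + 1
          lia
      rw [TensorProduct.map_tmul, TensorProduct.map_tmul, LinearEquiv.map_smul, Pi.smul_apply,
        coordEquiv_splitEquiv, capCup_apply, capAt, coordEquiv_splitEquiv, coordEquiv_splitEquiv,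
        pairBasis_repr_uMap]
      simp only [q1, q2, setPair_left hne, setPair_right, LinearMap.id_apply, smul_eq_mul]
      split_ifs
      · simp
      · generalize cupCoeff v (s (lo i)) = z
        have hz := mul_inv_cancel₀ h2
        generalize (coordEquiv 𝕜 i t fun j => s ⟨j, by omega⟩) = A
        generalize (coordEquiv 𝕜 (n - 2 - i) t' fun j => s ⟨i + 2 + j, add_two_add_lt i j⟩) = B
        generalize (pairBasis 𝕜).repr w _ = C
        generalize (pairBasis 𝕜).repr w _ = D
        generalize (v : 𝕜) + (v : 𝕜)⁻¹ = q at *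
        linear_combination (ε * A * z * (C - v * D) * B) * hz

end Transport

/-! ### The action of `U` in coordinates, one tensor factor at a time. -/

section UCoord

variable {𝕜 : Type*} [Field 𝕜] (v : 𝕜ˣ) (hv : ¬ IsOfFinOrder v)

/-- The action of `U` on tensor space in coordinates. -/
noncomputable def UCoord (n : ℕ) : Uq v →ₐ[𝕜] Module.End 𝕜 (Coord 𝕜 n) :=
  ((coordEquiv 𝕜 n).conjAlgEquiv 𝕜).toAlgHom.comp (UTensor v hv n)

theorem UCoord_coordEquiv (n : ℕ) (x : Uq v) (t : TSpace 𝕜 n) :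
    UCoord v hv n x (coordEquiv 𝕜 n t) = coordEquiv 𝕜 n (UTensor v hv n x t) := by
  simp [UCoord]

/-- The coproduct on generators, as operators on a tensor product of representations. -/
theorem tensorRep_gen {M N : Type*} [AddCommGroup M] [Module 𝕜 M] [AddCommGroup N] [Module 𝕜 N]
    (ρ : Uq v →ₐ[𝕜] Module.End 𝕜 M) (σ : Uq v →ₐ[𝕜] Module.End 𝕜 N) (m : M) (y : N) :
    tensorRep v ρ σ (Uq.gen v .E) (m ⊗ₜ y) =
      ρ (Uq.gen v .E) m ⊗ₜ y + ρ (Uq.gen v .K) m ⊗ₜ σ (Uq.gen v .E) y ∧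
    tensorRep v ρ σ (Uq.gen v .F) (m ⊗ₜ y) =
      ρ (Uq.gen v .F) m ⊗ₜ σ (Uq.gen v .Kinv) y + m ⊗ₜ σ (Uq.gen v .F) y ∧
    tensorRep v ρ σ (Uq.gen v .K) (m ⊗ₜ y) = ρ (Uq.gen v .K) m ⊗ₜ σ (Uq.gen v .K) y ∧
    tensorRep v ρ σ (Uq.gen v .Kinv) (m ⊗ₜ y) =
      ρ (Uq.gen v .Kinv) m ⊗ₜ σ (Uq.gen v .Kinv) y := by
  refine ⟨?_, ?_, ?_, ?_⟩ <;>
  (simp [tensorRep, comul, Uq.lift_gen, comulGen]; rfl)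

theorem xvec_apply (m : ℕ) (p : ℤ) (j : Fin (m + 1)) :
    xvec 𝕜 m p j = if (j : ℤ) = p then 1 else 0 := rfl

theorem vec_two (y : VMod 𝕜 1) : y = y 0 • xvec 𝕜 1 0 + y 1 • xvec 𝕜 1 1 := by
  ext j
  rcases fin_two_cases j with rfl | rfl <;> simp [xvec_apply]

theorem qint_one (hv : ¬ IsOfFinOrder v) : qint v 1 = 1 := by
  have := sub_inv_ne_zero v hv
  simp [qint, this]

theorem VRep_one (y : VMod 𝕜 1) :
    VRep v hv 1 (Uq.gen v .E) y = ![y 1, 0] ∧ VRep v hv 1 (Uq.gen v .F) y = ![0, y 0] ∧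
    VRep v hv 1 (Uq.gen v .K) y = ![v * y 0, (v : 𝕜)⁻¹ * y 1] ∧
    VRep v hv 1 (Uq.gen v .Kinv) y = ![(v : 𝕜)⁻¹ * y 0, v * y 1] := by
  have h2 : xvec 𝕜 1 2 = 0 := xvec_eq_zero 1 2 (by norm_num)
  have h1 : xvec 𝕜 1 (-1) = 0 := xvec_eq_zero 1 (-1) (by norm_num)
  simp only [VRep, Uq.lift_gen]
  refine ⟨?_, ?_, ?_, ?_⟩ <;> conv_lhs => rw [vec_two y]
  · rw [map_add, map_smul, map_smul, VGen_E, VGen_E]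
    ext j; rcases fin_two_cases j with rfl | rfl <;> simp [xvec_apply, qint_one v hv]
  · rw [map_add, map_smul, map_smul, VGen_F, VGen_F]
    ext j; rcases fin_two_cases j with rfl | rfl <;> simp [xvec_apply, qint_one v hv]
  · rw [map_add, map_smul, map_smul, VGen_K, VGen_K]
    ext j; rcases fin_two_cases j with rfl | rfl <;> simp [xvec_apply, mul_comm]
  · rw [map_add, map_smul, map_smul, VGen_Kinv, VGen_Kinv]
    ext j; rcases fin_two_cases j with rfl | rfl <;> simp [xvec_apply, mul_comm]

theorem UCoord_zero (f : Coord 𝕜 0) :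
    UCoord v hv 0 (Uq.gen v .E) f = 0 ∧ UCoord v hv 0 (Uq.gen v .F) f = 0 ∧
    UCoord v hv 0 (Uq.gen v .K) f = f ∧ UCoord v hv 0 (Uq.gen v .Kinv) f = f := by
  obtain ⟨t, rfl⟩ := (coordEquiv 𝕜 0).surjective f
  simp [UCoord_coordEquiv, UTensor, counit, Uq.lift_gen, Algebra.ofId_apply]

/-- The coproduct read on the last factor. The only terms mixing the slices come from `K ⊗ E` and `1
⊗ F`. -/
theorem UCoord_succ {n : ℕ} (f : Coord 𝕜 (n + 1)) (b : Fin 2) :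
    slice 𝕜 n b (UCoord v hv (n + 1) (Uq.gen v .E) f) =
      UCoord v hv n (Uq.gen v .E) (slice 𝕜 n b f) +
        (if b = 0 then UCoord v hv n (Uq.gen v .K) (slice 𝕜 n 1 f) else 0) ∧
    slice 𝕜 n b (UCoord v hv (n + 1) (Uq.gen v .F) f) =
      (if b = 0 then (v : 𝕜)⁻¹ else v) • UCoord v hv n (Uq.gen v .F) (slice 𝕜 n b f) +
        (if b = 0 then 0 else slice 𝕜 n 0 f) ∧
    slice 𝕜 n b (UCoord v hv (n + 1) (Uq.gen v .K) f) =
      (if b = 0 then (v : 𝕜) else (v : 𝕜)⁻¹) • UCoord v hv n (Uq.gen v .K) (slice 𝕜 n b f) ∧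
    slice 𝕜 n b (UCoord v hv (n + 1) (Uq.gen v .Kinv) f) =
      (if b = 0 then (v : 𝕜)⁻¹ else v) • UCoord v hv n (Uq.gen v .Kinv) (slice 𝕜 n b f) := by
  obtain ⟨t, rfl⟩ := (coordEquiv 𝕜 (n + 1)).surjective f
  obtain ⟨t, rfl⟩ := (succEquiv 𝕜 n).surjective t
  have hu (x z) : UTensor v hv (n + 1) x (succEquiv 𝕜 n z) = succEquiv 𝕜 n
      (tensorRep v (UTensor v hv n) (VRep v hv 1) x z) := by
    simp [UTensor]
  simp only [UCoord_coordEquiv, hu]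
  induction t using TensorProduct.induction_on with
  | zero =>
    simp only [LinearMap.map_zero, LinearEquiv.map_zero, smul_zero, ite_self, add_zero, and_self]
  | add x y hx hy =>
    obtain ⟨hx1, hx2, hx3, hx4⟩ := hx
    obtain ⟨hy1, hy2, hy3, hy4⟩ := hy
    simp only [LinearMap.map_add, LinearEquiv.map_add, hx1, hx2, hx3, hx4, hy1, hy2, hy3, hy4, smul_add]
    refine ⟨?_, ?_, trivial, trivial⟩ <;> split_ifs <;> abel
  | tmul t y =>
    obtain ⟨h1, h2, h3, h4⟩ := tensorRep_gen v (UTensor v hv n) (VRep v hv 1) t y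
    obtain ⟨g1, g2, g3, g4⟩ := VRep_one v hv y
    simp only [h1, h2, h3, h4, g1, g2, g3, g4, LinearMap.map_add, LinearEquiv.map_add, coordEquiv_succEquiv, LinearMap.map_smul,
      UCoord_coordEquiv]
    rcases fin_two_cases b with rfl | rfl <;> simp [smul_smul]

end UCoord

end SchurWeyl

/-! ## Highest weight theory for representations of `U` -/

namespace SchurWeyl

/-! ### Quantum integers and factorials. -/

section QuantumInteger

variable {𝕜 : Type*} [Field 𝕜] (v : 𝕜ˣ) (hv : ¬ IsOfFinOrder v)

theorem zpow_val_injective (hv : ¬ IsOfFinOrder v) {i j : ℤ} (h : (v : 𝕜) ^ i = (v : 𝕜) ^ j) :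
    i = j := by
  have h' : v ^ i = v ^ j := by ext; simpa using h
  exact (injective_zpow_iff_not_isOfFinOrder.2 hv) h'

theorem qint_ne_zero (hv : ¬ IsOfFinOrder v) {j : ℤ} (hj : j ≠ 0) : qint v j ≠ 0 := by
  refine div_ne_zero (sub_ne_zero.2 fun h => hj ?_) (sub_inv_ne_zero v hv)
  have := zpow_val_injective v hv h
  omega

/-- The identity that adds up the coefficients when `E` is moved past one more `F` in
`E_F_pow_apply`. -/
theorem qint_step (hv : ¬ IsOfFinOrder v) (m j : ℤ) :
    qint v (m + 1) * qint v (j - m) + qint v (j - 2 * (m + 1)) =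
      qint v (m + 1 + 1) * qint v (j - (m + 1)) := by
  have hv0 : (v : 𝕜) ≠ 0 := v.ne_zero
  have h1 := sub_inv_ne_zero v hv
  simp only [qint, neg_sub, neg_add_rev, two_mul, mul_add, mul_one]
  simp only [zpow_add₀ hv0, zpow_sub₀ hv0, zpow_neg, zpow_one]
  have hj : (v : 𝕜) ^ j ≠ 0 := zpow_ne_zero _ hv0
  have hm : (v : 𝕜) ^ m ≠ 0 := zpow_ne_zero _ hv0
  generalize (v : 𝕜) ^ j = J at *
  generalize (v : 𝕜) ^ m = M at *
  generalize (v : 𝕜) = w at *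
  have h2 : w ^ 2 - 1 ≠ 0 := by
    intro h
    apply h1
    field_simp
    simpa using h
  field_simp
  ring

/-- The quantum factorial. -/
def qfact (p : ℕ) : 𝕜 := ∏ i ∈ Finset.range p, qint v (i + 1)

theorem qfact_succ (p : ℕ) : qfact v (p + 1) = qfact v p * qint v (p + 1) :=
  Finset.prod_range_succ _ _

theorem qfact_ne_zero (hv : ¬ IsOfFinOrder v) (p : ℕ) : qfact v p ≠ 0 :=
  Finset.prod_ne_zero_iff.2 fun i _ => qint_ne_zero v hv (by omega)

end QuantumInteger

/-! ### Weight vectors and the strings generated by highest weight vectors. -/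

section Weights

variable {𝕜 : Type*} [Field 𝕜] {v : 𝕜ˣ} {M N : Type*} [AddCommGroup M] [Module 𝕜 M]
  [AddCommGroup N] [Module 𝕜 N] (ρ : Uq v →ₐ[𝕜] Module.End 𝕜 M)
  (σ : Uq v →ₐ[𝕜] Module.End 𝕜 N)

theorem Uq_induction {p : Uq v → Prop} (h1 : ∀ c : 𝕜, p (algebraMap 𝕜 _ c))
    (hadd : ∀ x y, p x → p y → p (x + y)) (hmul : ∀ x y, p x → p y → p (x * y))
    (hgen : ∀ g, p (Uq.gen v g)) (x : Uq v) : p x := by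
  obtain ⟨x, rfl⟩ := RingQuot.mkAlgHom_surjective 𝕜 (URel v) x
  induction x with
  | grade0 c => simpa using h1 c
  | grade1 g => exact hgen g
  | mul x y hx hy => rw [map_mul]; exact hmul _ _ hx hy
  | add x y hx hy => rw [map_add]; exact hadd _ _ hx hy

theorem K_apply_Kinv (t : M) : ρ (Uq.gen v .K) (ρ (Uq.gen v .Kinv) t) = t := by
  rw [← Module.End.mul_apply, ← map_mul, Uq.K_Kinv, map_one, Module.End.one_apply]

theorem Kinv_apply_K (t : M) : ρ (Uq.gen v .Kinv) (ρ (Uq.gen v .K) t) = t := by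
  rw [← Module.End.mul_apply, ← map_mul, Uq.Kinv_K, map_one, Module.End.one_apply]

/-- A linear map that commutes with `E`, `F` and `K` is a morphism of `U`-modules. -/
theorem Uq_intertwines (L : M →ₗ[𝕜] N)
    (hE : ∀ t, L (ρ (Uq.gen v .E) t) = σ (Uq.gen v .E) (L t))
    (hF : ∀ t, L (ρ (Uq.gen v .F) t) = σ (Uq.gen v .F) (L t))
    (hK : ∀ t, L (ρ (Uq.gen v .K) t) = σ (Uq.gen v .K) (L t)) (x : Uq v) (t : M) :
    L (ρ x t) = σ x (L t) := by
  revert t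
  refine Uq_induction (p := fun x => ∀ t, L (ρ x t) = σ x (L t)) ?_ ?_ ?_ ?_ x
  · intro c t; simp [Algebra.algebraMap_eq_smul_one]
  · intro x y hx hy t; simp [hx, hy]
  · intro x y hx hy t; simp [hx, hy]
  · rintro (_ | _ | _ | _) t
    · exact hE t
    · exact hF t
    · exact hK t
    · conv_rhs => rw [← K_apply_Kinv ρ t]
      rw [hK, Kinv_apply_K]

variable {ρ} {j : ℤ} {t : M}

theorem K_E_apply (h : ρ (Uq.gen v .K) t = (v : 𝕜) ^ j • t) :
    ρ (Uq.gen v .K) (ρ (Uq.gen v .E) t) = (v : 𝕜) ^ (j + 2) • ρ (Uq.gen v .E) t := by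
  rw [← Module.End.mul_apply, ← map_mul, Uq.K_mul_E, map_smul, map_mul, LinearMap.smul_apply,
    Module.End.mul_apply, h, map_smul, smul_smul, zpow_add₀ v.ne_zero, mul_comm]
  norm_cast

theorem K_F_apply (h : ρ (Uq.gen v .K) t = (v : 𝕜) ^ j • t) :
    ρ (Uq.gen v .K) (ρ (Uq.gen v .F) t) = (v : 𝕜) ^ (j - 2) • ρ (Uq.gen v .F) t := by
  rw [← Module.End.mul_apply, ← map_mul, Uq.K_mul_F, map_smul, map_mul, LinearMap.smul_apply,
    Module.End.mul_apply, h, map_smul, smul_smul, zpow_sub₀ v.ne_zero, mul_comm, div_eq_mul_inv]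
  norm_cast

theorem K_F_pow_apply (h : ρ (Uq.gen v .K) t = (v : 𝕜) ^ j • t) (p : ℕ) :
    ρ (Uq.gen v .K) ((ρ (Uq.gen v .F) ^ p) t) = (v : 𝕜) ^ (j - 2 * p) • (ρ (Uq.gen v .F) ^ p) t := by
  induction p with
  | zero => simpa using h
  | succ p ih =>
    rw [pow_succ', Module.End.mul_apply, K_F_apply ih]
    congr 2
    push_cast; ring

theorem Kinv_apply (h : ρ (Uq.gen v .K) t = (v : 𝕜) ^ j • t) :
    ρ (Uq.gen v .Kinv) t = (v : 𝕜) ^ (-j) • t := by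
  have := congrArg (ρ (Uq.gen v .Kinv)) h
  rw [Kinv_apply_K, map_smul] at this
  rw [this, smul_smul, zpow_neg, inv_mul_cancel₀ (zpow_ne_zero _ v.ne_zero), one_smul, ← this]

theorem E_F_apply (h : ρ (Uq.gen v .K) t = (v : 𝕜) ^ j • t) :
    ρ (Uq.gen v .E) (ρ (Uq.gen v .F) t) = ρ (Uq.gen v .F) (ρ (Uq.gen v .E) t) + qint v j • t := by
  have h1 := congrArg (fun x => ρ x t) (Uq.E_F v)
  simp only [map_sub, map_mul, map_smul, LinearMap.sub_apply, Module.End.mul_apply,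
    LinearMap.smul_apply, h, Kinv_apply h] at h1
  rw [sub_eq_iff_eq_add'] at h1
  rw [h1, ← sub_smul, smul_smul, qint, div_eq_inv_mul]

theorem E_F_pow_apply (hv : ¬ IsOfFinOrder v) (h : ρ (Uq.gen v .K) t = (v : 𝕜) ^ j • t) (m : ℕ) :
    ρ (Uq.gen v .E) ((ρ (Uq.gen v .F) ^ (m + 1)) t) =
      (ρ (Uq.gen v .F) ^ (m + 1)) (ρ (Uq.gen v .E) t) +
        (qint v (m + 1) * qint v (j - m)) • (ρ (Uq.gen v .F) ^ m) t := by
  induction m with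
  | zero => simp [E_F_apply h, qint_one v hv]
  | succ m ih =>
    rw [pow_succ', Module.End.mul_apply, E_F_apply (K_F_pow_apply h (m + 1)), ih, map_add, map_smul,
      ← Module.End.mul_apply, ← pow_succ', ← Module.End.mul_apply (ρ (Uq.gen v .F)) (_ ^ m),
      ← pow_succ', add_assoc, ← add_smul]
    push_cast
    rw [qint_step v hv]

variable (ρ) in
/-- The vectors of weight `j` that are annihilated by `E`. -/
def highestWeight (j : ℤ) : Submodule 𝕜 M :=
  LinearMap.ker (ρ (Uq.gen v .E)) ⊓ Module.End.eigenspace (ρ (Uq.gen v .K)) ((v : 𝕜) ^ j)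

theorem mem_highestWeight : t ∈ highestWeight ρ j ↔
    ρ (Uq.gen v .E) t = 0 ∧ ρ (Uq.gen v .K) t = (v : 𝕜) ^ j • t := by
  rw [highestWeight, Submodule.mem_inf, LinearMap.mem_ker, Module.End.mem_eigenspace_iff]

theorem E_F_pow_highestWeight (hv : ¬ IsOfFinOrder v) (h : t ∈ highestWeight ρ j) (m : ℕ) :
    ρ (Uq.gen v .E) ((ρ (Uq.gen v .F) ^ (m + 1)) t) =
        (qint v (m + 1) * qint v (j - m)) • (ρ (Uq.gen v .F) ^ m) t := by
  rw [mem_highestWeight] at h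
  rw [E_F_pow_apply hv h.2, h.1, map_zero, zero_add]

/-- For `j < 0` no factor `[m + 1] [j - m]` vanishes, so `E` recovers a multiple of `F ^ m t` from
`F ^ (m + 1) t`, and the vanishing descends to `t`. -/
theorem highestWeight_eq_zero (hv : ¬ IsOfFinOrder v) (h : t ∈ highestWeight ρ j) (hj : j < 0)
    {m : ℕ} (hF : (ρ (Uq.gen v .F) ^ m) t = 0) : t = 0 := by
  induction m with
  | zero => simpa using hF
  | succ m ih =>
    have := E_F_pow_highestWeight hv h m
    rw [hF, map_zero, eq_comm, smul_eq_zero] at this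
    exact ih (this.resolve_left
      (mul_ne_zero (qint_ne_zero v hv (by omega)) (qint_ne_zero v hv (by omega))))

/-- The coefficient `[k - k]` vanishes, so `F ^ (k + 1) t` is again killed by `E`. Its weight `-k -
2` is negative, and `highestWeight_eq_zero` applies. -/
theorem F_pow_highestWeight_eq_zero (hv : ¬ IsOfFinOrder v) {k : ℕ} (h : t ∈ highestWeight ρ k)
    {m : ℕ} (hF : (ρ (Uq.gen v .F) ^ m) = 0) : (ρ (Uq.gen v .F) ^ (k + 1)) t = 0 := by
  refine highestWeight_eq_zero hv (j := (k : ℤ) - 2 * (k + 1 : ℕ)) (ρ := ρ) (m := m) ?_ ?_ ?_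
  · rw [mem_highestWeight, E_F_pow_highestWeight hv h]
    refine ⟨by simp [qint_zero], K_F_pow_apply (mem_highestWeight.1 h).2 _⟩
  · push_cast; omega
  · rw [hF]; rfl

variable (ρ) in
/-- The span of the vectors of weight `j` of the form `F ^ p w`, with `w` of highest weight. -/
def hwSpan (j : ℤ) : Submodule 𝕜 M :=
  Submodule.span 𝕜 {y | ∃ p : ℕ, ∃ w ∈ highestWeight ρ (j + 2 * p), y = (ρ (Uq.gen v .F) ^ p) w}

theorem weight_of_mem_hwSpan (h : t ∈ hwSpan ρ j) : ρ (Uq.gen v .K) t = (v : 𝕜) ^ j • t := by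
  rw [← Module.End.mem_eigenspace_iff]
  suffices H : hwSpan ρ j ≤ Module.End.eigenspace (ρ (Uq.gen v .K)) ((v : 𝕜) ^ j) from H h
  refine Submodule.span_le.2 ?_
  rintro _ ⟨p, w, hw, rfl⟩
  rw [SetLike.mem_coe, Module.End.mem_eigenspace_iff, K_F_pow_apply (mem_highestWeight.1 hw).2]
  congr 2; ring

theorem F_mem_hwSpan (h : t ∈ hwSpan ρ j) : ρ (Uq.gen v .F) t ∈ hwSpan ρ (j - 2) := by
  suffices H : hwSpan ρ j ≤ (hwSpan ρ (j - 2)).comap (ρ (Uq.gen v .F)) from H h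
  refine Submodule.span_le.2 ?_
  rintro _ ⟨p, w, hw, rfl⟩
  refine Submodule.subset_span ⟨p + 1, w, ?_, ?_⟩
  · convert hw using 2; push_cast; ring
  · rw [pow_succ', Module.End.mul_apply]

theorem F_pow_mem_hwSpan (h : t ∈ hwSpan ρ j) (m : ℕ) :
    (ρ (Uq.gen v .F) ^ m) t ∈ hwSpan ρ (j - 2 * m) := by
  induction m with
  | zero => simpa using h
  | succ m ih =>
    rw [pow_succ', Module.End.mul_apply]
    convert F_mem_hwSpan ih using 2
    push_cast; ring

theorem E_mem_hwSpan (hv : ¬ IsOfFinOrder v) (h : t ∈ hwSpan ρ j) :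
    ρ (Uq.gen v .E) t ∈ hwSpan ρ (j + 2) := by
  suffices H : hwSpan ρ j ≤ (hwSpan ρ (j + 2)).comap (ρ (Uq.gen v .E)) from H h
  refine Submodule.span_le.2 ?_
  rintro _ ⟨p, w, hw, rfl⟩
  rw [SetLike.mem_coe, Submodule.mem_comap]
  rcases p with _ | p
  · rw [pow_zero, Module.End.one_apply, (mem_highestWeight.1 hw).1]
    exact zero_mem _
  · rw [E_F_pow_highestWeight hv hw]
    refine Submodule.smul_mem _ _ (Submodule.subset_span ⟨p, w, ?_, rfl⟩)
    convert hw using 2; push_cast; ring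

/-- `E` sends `F ^ (p + 1) w` to a multiple of `F ^ p w` with coefficient `[p + 1] [j + 2 + p]`,
invertible because `0 ≤ j`. -/
theorem exists_E_eq (hv : ¬ IsOfFinOrder v) (hj : 0 ≤ j) (h : t ∈ hwSpan ρ (j + 2)) :
    ∃ y ∈ hwSpan ρ j, ρ (Uq.gen v .E) y = t := by
  suffices H : hwSpan ρ (j + 2) ≤ (hwSpan ρ j).map (ρ (Uq.gen v .E)) from H h
  refine Submodule.span_le.2 ?_
  rintro _ ⟨p, w, hw, rfl⟩
  have hc : qint v (p + 1) * qint v (j + 2 + 2 * p - p) ≠ 0 :=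
    mul_ne_zero (qint_ne_zero v hv (by omega)) (qint_ne_zero v hv (by omega))
  refine ⟨(qint v (p + 1) * qint v (j + 2 + 2 * p - p))⁻¹ • (ρ (Uq.gen v .F) ^ (p + 1)) w,
    Submodule.smul_mem _ _ (Submodule.subset_span ⟨p + 1, w, ?_, rfl⟩), ?_⟩
  · convert hw using 2; push_cast; ring
  · rw [map_smul, E_F_pow_highestWeight hv hw, smul_smul, inv_mul_cancel₀ hc, one_smul]

/-- Every weight vector is a combination of vectors `F ^ p w` with `w` of highest weight. -/
theorem mem_hwSpan (hv : ¬ IsOfFinOrder v) {m : ℕ} (hF : ρ (Uq.gen v .F) ^ m = 0) (r : ℕ) :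
    ∀ (j : ℤ) (t : M), ρ (Uq.gen v .K) t = (v : 𝕜) ^ j • t → (ρ (Uq.gen v .E) ^ r) t = 0 →
      t ∈ hwSpan ρ j := by
  induction r with
  | zero => intro j t _ h; simp only [pow_zero, Module.End.one_apply] at h; rw [h]; exact zero_mem _
  | succ r ih =>
    intro j t hK hE
    rw [pow_succ, Module.End.mul_apply] at hE
    have hEt := ih _ _ (K_E_apply hK) hE
    rcases lt_or_ge j 0 with hj | hj
    -- Negative weight: applying `E` to `F ^ (m + 1) t` gives `F ^ (m + 1) E t`, already in the
    -- span, plus a nonzero multiple of `F ^ m t`. So membership descends from the vanishing power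
    -- of `F` to `t` itself.
    · have key : ∀ m : ℕ, (ρ (Uq.gen v .F) ^ m) t ∈ hwSpan ρ (j - 2 * m) → t ∈ hwSpan ρ j := by
        intro m
        induction m with
        | zero => intro h; simpa using h
        | succ m ihm =>
          intro h
          refine ihm ?_
          have h1 := E_mem_hwSpan hv h
          have h2 := F_pow_mem_hwSpan hEt (m + 1)
          have e1 : j - 2 * ((m + 1 : ℕ) : ℤ) + 2 = j - 2 * m := by push_cast; ring
          have e2 : j + 2 - 2 * ((m + 1 : ℕ) : ℤ) = j - 2 * m := by push_cast; ring
          rw [e1, E_F_pow_apply hv hK] at h1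
          rw [e2] at h2
          have h3 := (Submodule.add_mem_iff_right _ h2).1 h1
          exact (Submodule.smul_mem_iff _
            (mul_ne_zero (qint_ne_zero v hv (by omega)) (qint_ne_zero v hv (by omega)))).1 h3
      refine key m ?_
      rw [hF]
      exact zero_mem _
    -- Nonnegative weight: `E t` is lifted to some `y` in the span, and `t - y` is a highest weight
    -- vector.
    · obtain ⟨y, hy, hEy⟩ := exists_E_eq hv hj hEt
      have : t - y ∈ hwSpan ρ j := by
        refine Submodule.subset_span ⟨0, t - y, ?_, by simp⟩
        rw [mem_highestWeight]
        simp [hEy, hK, weight_of_mem_hwSpan hy, smul_sub]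
      simpa using add_mem this hy

end Weights

end SchurWeyl

/-! ## Simplicity and semisimplicity -/

namespace SchurWeyl

/-! ### Simple and semisimple representations, extension and density. -/

section Rep

variable {𝕜 A M V : Type*} [Field 𝕜] [Ring A] [Algebra 𝕜 A] [AddCommGroup M] [Module 𝕜 M]
  [AddCommGroup V] [Module 𝕜 V] (ρ : A →ₐ[𝕜] Module.End 𝕜 M) (σ : A →ₐ[𝕜] Module.End 𝕜 V)

theorem isSimpleRep_of_eq_top [Nontrivial M]
    (h : ∀ N : Submodule 𝕜 M, N ≠ ⊥ → (∀ a, ∀ m ∈ N, ρ a m ∈ N) → N = ⊤) : IsSimpleRep ρ := by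
  let _ : Module A M := Module.compHom M ρ.toRingHom
  have hs (a : A) (m : M) : a • m = ρ a m := rfl
  refine (isSimpleModule_iff A M).2 ⟨fun N => ?_⟩
  let N' : Submodule 𝕜 M :=
    { N.toAddSubmonoid with
      smul_mem' := fun c x hx => by
        have := N.smul_mem (algebraMap 𝕜 A c) hx
        rwa [hs, AlgHom.commutes, Module.algebraMap_end_apply] at this }
  have hN (x : M) : x ∈ N' ↔ x ∈ N := Iff.rfl
  by_cases hb : N' = ⊥
  · left
    refine (Submodule.eq_bot_iff _).2 fun x hx => ?_
    rw [← hN, hb] at hx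
    simpa using hx
  · right
    have := h N' hb fun a m hm => N.smul_mem a hm
    refine Submodule.eq_top_iff'.2 fun x => ?_
    rw [← hN, this]
    trivial

/-- The module given by a representation is semisimple. -/
def IsSemisimpleRep : Prop :=
  letI : Module A M := Module.compHom M ρ.toRingHom
  IsSemisimpleModule A M

variable {ρ σ}

theorem IsSemisimpleRep.exists_extension (h : IsSemisimpleRep ρ) {L L' : V →ₗ[𝕜] M}
    (hL : ∀ a y, L (σ a y) = ρ a (L y)) (hL' : ∀ a y, L' (σ a y) = ρ a (L' y))
    (hinj : Function.Injective L) : ∃ φ ∈ endAlg ρ, ∀ y, φ (L y) = L' y := by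
  let _ : Module A M := Module.compHom M ρ.toRingHom
  let _ : Module A V := Module.compHom V σ.toRingHom
  have _ : IsSemisimpleModule A M := h
  have hs (a : A) (m : M) : a • m = ρ a m := rfl
  let f : V →ₗ[A] M := { L with map_smul' := hL }
  let g : V →ₗ[A] M := { L' with map_smul' := hL' }
  obtain ⟨φ, hφ⟩ := IsSemisimpleModule.extension_property f hinj g
  refine ⟨{ φ with map_smul' := fun c x => ?_ }, ?_, fun y => congrArg (fun q => q y) hφ⟩
  -- Linearity over `𝕜` is a special case of linearity over `A`, because scalars act through
  -- `algebraMap`.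
  · have := φ.map_smul (algebraMap 𝕜 A c) x
    rwa [hs, hs, AlgHom.commutes, Module.algebraMap_end_apply, Module.algebraMap_end_apply] at this
  · rw [endAlg, Subalgebra.mem_centralizer_iff]
    rintro _ ⟨a, rfl⟩
    refine LinearMap.ext fun m => ?_
    exact (φ.map_smul a m).symm

/-- The double centralizer property of a finite-dimensional semisimple representation. -/
theorem IsSemisimpleRep.exists_eq (h : IsSemisimpleRep ρ) [FiniteDimensional 𝕜 M]
    {f : Module.End 𝕜 M} (hf : ∀ φ ∈ endAlg ρ, φ * f = f * φ) : ∃ a, ρ a = f := by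
  let _ : Module A M := Module.compHom M ρ.toRingHom
  have _ : IsSemisimpleModule A M := h
  have hs (a : A) (m : M) : a • m = ρ a m := rfl
  let F : Module.End (Module.End A M) M :=
    { f with
      map_smul' := fun φ x => by
        let φ' : Module.End 𝕜 M :=
          { φ with
            map_smul' := fun c x => by
              have := φ.map_smul (algebraMap 𝕜 A c) x
              rwa [hs, hs, AlgHom.commutes, Module.algebraMap_end_apply,
                Module.algebraMap_end_apply] at this }
        have hφ : φ' ∈ endAlg ρ := by
          rw [endAlg, Subalgebra.mem_centralizer_iff]
          rintro _ ⟨a, rfl⟩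
          exact LinearMap.ext fun m => (φ.map_smul a m).symm
        exact (congrArg (fun q : Module.End 𝕜 M => q x) (hf _ hφ)).symm }
  classical
  -- Density yields an element of `A` that agrees with `f` on finitely many vectors; a basis is
  -- enough.
  obtain ⟨a, ha⟩ := jacobson_density (R := A) F
    (Finset.univ.image (Module.finBasis 𝕜 M))
  refine ⟨a, (Module.finBasis 𝕜 M).ext fun i => ?_⟩
  exact (ha _ (Finset.mem_image_of_mem _ (Finset.mem_univ i))).symm

theorem isSemisimpleRep_of_iSup {ι : Type*} {V : ι → Type*} [∀ i, AddCommGroup (V i)]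
    [∀ i, Module 𝕜 (V i)] {σ : ∀ i, A →ₐ[𝕜] Module.End 𝕜 (V i)} (hσ : ∀ i, IsSimpleRep (σ i))
    (L : ∀ i, V i →ₗ[𝕜] M) (hL : ∀ i a y, L i (σ i a y) = ρ a (L i y))
    (htop : ⨆ i, LinearMap.range (L i) = ⊤) : IsSemisimpleRep ρ := by
  let _ : Module A M := Module.compHom M ρ.toRingHom
  let _ : ∀ i, Module A (V i) := fun i => Module.compHom (V i) (σ i).toRingHom
  have _ : ∀ i, IsSimpleModule A (V i) := hσ
  have hs (a : A) (m : M) : a • m = ρ a m := rfl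
  let f (i) : V i →ₗ[A] M := { L i with map_smul' := hL i }
  refine isSemisimpleModule_of_isSemisimpleModule_submodule' (p := fun i => LinearMap.range (f i))
    (fun i => IsSemisimpleModule.range (f i)) ?_
  refine Submodule.eq_top_iff'.2 fun x => ?_
  have hx : x ∈ ⨆ i, LinearMap.range (L i) := by rw [htop]; trivial
  induction hx using Submodule.iSup_induction' with
  | mem i x hx =>
    obtain ⟨y, rfl⟩ := hx
    exact Submodule.mem_iSup_of_mem i ⟨y, rfl⟩
  | zero => exact zero_mem _
  | add x y _ _ hx hy => exact add_mem hx hy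

end Rep

/-! ### The modules `V(k)` and the maps out of them. -/

section VRep

variable {𝕜 : Type*} [Field 𝕜] {v : 𝕜ˣ} (hv : ¬ IsOfFinOrder v) (k : ℕ)
  {M : Type*} [AddCommGroup M] [Module 𝕜 M] (ρ : Uq v →ₐ[𝕜] Module.End 𝕜 M)

/-- The linear map `x_p ↦ F ^ p / [p]!`. -/
noncomputable def hwAct : VMod 𝕜 k →ₗ[𝕜] Module.End 𝕜 M :=
  (Pi.basisFun 𝕜 (Fin (k + 1))).constr 𝕜
    fun p => (qfact v (p : ℕ))⁻¹ • ρ (Uq.gen v .F) ^ (p : ℕ)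

theorem hwAct_xvec {p : ℕ} (hp : p ≤ k) :
    hwAct k ρ (xvec 𝕜 k p) = (qfact v p)⁻¹ • ρ (Uq.gen v .F) ^ p := by
  have : xvec 𝕜 k p = Pi.basisFun 𝕜 (Fin (k + 1)) ⟨p, by omega⟩ :=
    xvec_coe k ⟨p, by omega⟩
  rw [this, hwAct, Module.Basis.constr_basis]

include hv in
-- The universal property of `V(k)`. With `x_p` sent to `F ^ p w / [p]!`, the formula for `E` is
-- `E_F_pow_highestWeight`, and the vanishing of `F ^ (k + 1) w` is needed only to match `F x_k =
-- 0`.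
theorem hwAct_intertwines {w : M} (hw : w ∈ highestWeight ρ k)
    (hF : (ρ (Uq.gen v .F) ^ (k + 1)) w = 0) (x : Uq v) (y : VMod 𝕜 k) :
    hwAct k ρ (VRep v hv k x y) w = ρ x (hwAct k ρ y w) := by
  have hgen : ∀ g : UGen, (∀ p : ℕ, p ≤ k →
      hwAct k ρ (VGen v k g (xvec 𝕜 k p)) w = ρ (Uq.gen v g) (hwAct k ρ (xvec 𝕜 k p) w)) →
      ∀ y, hwAct k ρ (VRep v hv k (Uq.gen v g) y) w = ρ (Uq.gen v g) (hwAct k ρ y w) := by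
    intro g hg y
    rw [VRep, Uq.lift_gen]
    have : (LinearMap.applyₗ w ∘ₗ hwAct k ρ) ∘ₗ VGen v k g =
        ρ (Uq.gen v g) ∘ₗ (LinearMap.applyₗ w ∘ₗ hwAct k ρ) := by
      refine (Pi.basisFun 𝕜 (Fin (k + 1))).ext fun p => ?_
      rw [← xvec_coe]
      exact hg p (by omega)
    exact congrArg (fun q => q y) this
  refine Uq_intertwines (VRep v hv k) ρ (LinearMap.applyₗ w ∘ₗ hwAct k ρ)
    (hgen .E fun p hp => ?_) (hgen .F fun p hp => ?_) (hgen .K fun p hp => ?_) x y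
  · rw [VGen_E, map_smul]
    rcases p with _ | p
    · rw [xvec_eq_zero k _ (by simp), hwAct_xvec k ρ hp]
      simp [(mem_highestWeight.1 hw).1]
    · have e : ((p + 1 : ℕ) : ℤ) - 1 = (p : ℕ) := by push_cast; ring
      have e' : (k : ℤ) - ((p + 1 : ℕ) : ℤ) + 1 = k - p := by push_cast; ring
      rw [e, e', hwAct_xvec k ρ hp, hwAct_xvec k ρ (by omega)]
      simp only [LinearMap.smul_apply, map_smul, E_F_pow_highestWeight hv hw, smul_smul]
      congr 1
      have := qfact_ne_zero v hv p
      have := qint_ne_zero v hv (j := p + 1) (by omega)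
      rw [qfact_succ]
      field_simp
  · rw [VGen_F, map_smul, hwAct_xvec k ρ hp]
    rcases hp.lt_or_eq with hp' | rfl
    · have e : ((p : ℕ) : ℤ) + 1 = ((p + 1 : ℕ) : ℤ) := by push_cast; ring
      have := qfact_ne_zero v hv p
      have := qint_ne_zero v hv (j := p + 1) (by omega)
      have e2 : qint v ((p : ℤ) + 1) * (qfact v (p + 1))⁻¹ = (qfact v p)⁻¹ := by
        rw [qfact_succ]
        field_simp
      rw [← e2]
      rw [e, hwAct_xvec k ρ hp']
      simp only [LinearMap.smul_apply, map_smul, smul_smul, pow_succ', Module.End.mul_apply]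
    · rw [xvec_eq_zero p _ (by omega)]
      simp only [LinearMap.smul_apply, map_smul]
      rw [← Module.End.mul_apply, ← pow_succ', hF]
      simp
  · rw [VGen_K, map_smul, hwAct_xvec k ρ hp]
    simp only [LinearMap.smul_apply, map_smul, K_F_pow_apply (mem_highestWeight.1 hw).2,
      smul_smul, mul_comm]

theorem VRep_E_apply (y : VMod 𝕜 k) (p : Fin k) :
    VRep v hv k (Uq.gen v .E) y p.castSucc = qint v (k - p) * y p.succ := by
  rw [VRep, Uq.lift_gen]
  have : (LinearMap.proj p.castSucc ∘ₗ VGen v k .E : VMod 𝕜 k →ₗ[𝕜] 𝕜) =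
      qint v (k - p) • LinearMap.proj p.succ := by
    refine (Pi.basisFun 𝕜 (Fin (k + 1))).ext fun q => ?_
    rw [← xvec_coe, LinearMap.comp_apply, VGen_E, LinearMap.smul_apply]
    simp only [LinearMap.proj_apply, Pi.smul_apply, xvec_apply, smul_eq_mul]
    by_cases h : (q : ℤ) = p + 1
    · rw [if_pos (by simp [h]), if_pos (by simp [h]), h]
      congr 2; ring
    · rw [if_neg (by simp; omega), if_neg (by simp; omega)]; simp
  exact congrArg (fun q => q y) this

/-- A nonzero subspace of `V(k) ⊗ W` that is stable under `E` contains some `x₀ ⊗ h ≠ 0`. -/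
theorem exists_xvec_tmul_mem {W : Type*} [AddCommGroup W] [Module 𝕜 W]
    {N : Submodule 𝕜 (VMod 𝕜 k ⊗[𝕜] W)} (hN : N ≠ ⊥)
    (hE : ∀ z ∈ N, (VRep v hv k (Uq.gen v .E)).rTensor W z ∈ N) :
    ∃ h : W, h ≠ 0 ∧ xvec 𝕜 k 0 ⊗ₜ[𝕜] h ∈ N := by
  let C (p : Fin (k + 1)) : VMod 𝕜 k ⊗[𝕜] W →ₗ[𝕜] W :=
    TensorProduct.lid 𝕜 W ∘ₗ (LinearMap.proj p : VMod 𝕜 k →ₗ[𝕜] 𝕜).rTensor W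
  have hC (z) : z = ∑ p : Fin (k + 1), xvec 𝕜 k p ⊗ₜ[𝕜] C p z := by
    induction z using TensorProduct.induction_on with
    | zero => simp
    | add x y hx hy => simp only [map_add, TensorProduct.tmul_add, Finset.sum_add_distrib, ← hx, ← hy]
    | tmul y w =>
      have : y = ∑ p : Fin (k + 1), y p • xvec 𝕜 k p := by
        simp only [xvec_coe]
        exact ((Pi.basisFun 𝕜 (Fin (k + 1))).sum_repr y).symm
      conv_lhs => rw [this]
      simp [C, TensorProduct.sum_tmul, TensorProduct.smul_tmul]
  have hCE (z) (p : Fin k) : C p.castSucc ((VRep v hv k (Uq.gen v .E)).rTensor W z) =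
      qint v (k - p) • C p.succ z := by
    induction z using TensorProduct.induction_on with
    | zero => simp
    | add x y hx hy => simp only [map_add, hx, hy, smul_add]
    | tmul y w => simp [C, VRep_E_apply, smul_smul]
  set E := (VRep v hv k (Uq.gen v .E)).rTensor W with hEdef
  -- The kernel of `E` is `x₀ ⊗ W`, because `E` multiplies the component at `p + 1` by `[k - p] ≠
  -- 0`.
  have key (z) (hz : E z = 0) : z = xvec 𝕜 k 0 ⊗ₜ[𝕜] C 0 z := by
    have h0 (p : Fin k) : C p.succ z = 0 := by
      have := hCE z p
      rw [hz, map_zero, eq_comm, smul_eq_zero] at this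
      exact this.resolve_left (qint_ne_zero v hv (by omega))
    conv_lhs => rw [hC z]
    rw [Fin.sum_univ_succ]
    simp [h0]
  have hlast (z) : C (Fin.last k) (E z) = 0 := by
    induction z using TensorProduct.induction_on with
    | zero => simp
    | add x y hx hy => simp only [map_add, hx, hy, add_zero]
    | tmul y w =>
      have : VRep v hv k (Uq.gen v .E) y (Fin.last k) = 0 := by
        rw [VRep, Uq.lift_gen]
        have : (LinearMap.proj (Fin.last k) ∘ₗ VGen v k .E : VMod 𝕜 k →ₗ[𝕜] 𝕜) = 0 := by
          refine (Pi.basisFun 𝕜 (Fin (k + 1))).ext fun q => ?_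
          rw [← xvec_coe, LinearMap.comp_apply, VGen_E]
          simp only [LinearMap.proj_apply, Pi.smul_apply, xvec_apply, smul_eq_mul]
          rw [if_neg (by simp; omega)]; simp
        exact congrArg (fun q => q y) this
      simp [C, E, this]
  -- After `r` applications of `E` only the components of index at most `k - r` survive, so `E` is
  -- nilpotent.
  have hnil (r : ℕ) : ∀ z, ∀ p : Fin (k + 1), k < p + r → C p ((E ^ r) z) = 0 := by
    induction r with
    | zero => intro z p hp; omega
    | succ r ih =>
      intro z p hp
      rw [pow_succ', Module.End.mul_apply]
      induction p using Fin.lastCases with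
      | last => exact hlast _
      | cast p => rw [hCE, ih _ p.succ (by simp at hp ⊢; omega), smul_zero]
  obtain ⟨z, hz, hz0⟩ := (Submodule.ne_bot_iff _).1 hN
  have hex : ∃ r, (E ^ r) z = 0 := by
    refine ⟨k + 1, ?_⟩
    rw [hC ((E ^ (k + 1)) z)]
    exact Finset.sum_eq_zero fun p _ => by rw [hnil _ _ _ (by omega)]; simp
  classical
  -- The last nonzero vector among the `E ^ r z` lies in the kernel of `E`, hence has the form `x₀ ⊗
  -- h`.
  obtain ⟨r, hr⟩ : ∃ r, Nat.find hex = r + 1 := by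
    refine Nat.exists_eq_succ_of_ne_zero fun h => hz0 ?_
    have := Nat.find_spec hex
    rwa [h, pow_zero] at this
  have h1 : (E ^ r) z ≠ 0 := Nat.find_min hex (by omega)
  have h2 : E ((E ^ r) z) = 0 := by
    have := Nat.find_spec hex
    rwa [hr, pow_succ', Module.End.mul_apply] at this
  have h3 : ∀ r : ℕ, (E ^ r) z ∈ N := by
    intro r
    induction r with
    | zero => simpa using hz
    | succ r ih => rw [pow_succ', Module.End.mul_apply]; exact hE _ ih
  refine ⟨C 0 ((E ^ r) z), fun h => h1 ?_, ?_⟩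
  · rw [key _ h2, h, TensorProduct.tmul_zero]
  · rw [← key _ h2]; exact h3 r

theorem tmul_mem_of_xvec_tmul_mem {W : Type*} [AddCommGroup W] [Module 𝕜 W]
    {N : Submodule 𝕜 (VMod 𝕜 k ⊗[𝕜] W)}
    (hF : ∀ z ∈ N, (VRep v hv k (Uq.gen v .F)).rTensor W z ∈ N) {h : W}
    (hx : xvec 𝕜 k 0 ⊗ₜ[𝕜] h ∈ N) (y : VMod 𝕜 k) : y ⊗ₜ[𝕜] h ∈ N := by
  have hp (p : ℕ) : xvec 𝕜 k p ⊗ₜ[𝕜] h ∈ N := by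
    induction p with
    | zero => exact hx
    | succ p ih =>
      have := hF _ ih
      rw [LinearMap.rTensor_tmul, VRep, Uq.lift_gen, VGen_F, ← TensorProduct.smul_tmul'] at this
      exact_mod_cast (Submodule.smul_mem_iff _ (qint_ne_zero v hv (by omega))).1 this
  have : y = ∑ p : Fin (k + 1), y p • xvec 𝕜 k p := by
    simp only [xvec_coe]
    exact ((Pi.basisFun 𝕜 (Fin (k + 1))).sum_repr y).symm
  rw [this, TensorProduct.sum_tmul]
  refine sum_mem fun p _ => ?_
  rw [← TensorProduct.smul_tmul']
  exact Submodule.smul_mem _ _ (hp p)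

theorem outerRep_tmul {A B M N : Type*} [Ring A] [Algebra 𝕜 A] [Ring B] [Algebra 𝕜 B]
    [AddCommGroup M] [Module 𝕜 M] [AddCommGroup N] [Module 𝕜 N]
    (ρ : A →ₐ[𝕜] Module.End 𝕜 M) (σ : B →ₐ[𝕜] Module.End 𝕜 N) (a : A) (b : B) :
    outerRep ρ σ (a ⊗ₜ b) = TensorProduct.map (ρ a) (σ b) := by
  simp [outerRep]
  rfl

/-- `V(k) ⊗ H` is simple if every nonzero vector of `H` generates `H`. -/
theorem isSimpleRep_outerRep {B H : Type*} [Ring B] [Algebra 𝕜 B] [AddCommGroup H] [Module 𝕜 H]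
    [Nontrivial H] (η : B →ₐ[𝕜] Module.End 𝕜 H)
    (hη : ∀ h h' : H, h ≠ 0 → ∃ b, η b h = h') : IsSimpleRep (outerRep (VRep v hv k) η) := by
  have _ : Nontrivial (VMod 𝕜 k ⊗[𝕜] H) := by
    obtain ⟨h, hh⟩ := exists_ne (0 : H)
    refine ⟨xvec 𝕜 k 0 ⊗ₜ h, 0, fun h0 => hh ?_⟩
    have := congrArg ((TensorProduct.lid 𝕜 H).toLinearMap ∘ₗ
      (LinearMap.proj 0 : VMod 𝕜 k →ₗ[𝕜] 𝕜).rTensor H) h0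
    simpa [xvec_apply] using this
  refine isSimpleRep_of_eq_top _ fun N hN hstab => ?_
  have hU (x : Uq v) : ∀ z ∈ N, (VRep v hv k x).rTensor H z ∈ N := by
    intro z hz
    have := hstab (x ⊗ₜ 1) z hz
    rwa [outerRep_tmul, map_one] at this
  obtain ⟨h, hh, hx⟩ := exists_xvec_tmul_mem hv k hN (hU _)
  refine Submodule.eq_top_iff'.2 fun z => ?_
  induction z using TensorProduct.induction_on with
  | zero => exact zero_mem _
  | add x y hx hy => exact add_mem hx hy
  | tmul y h' =>
    obtain ⟨b, rfl⟩ := hη h h' hh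
    refine tmul_mem_of_xvec_tmul_mem hv k (hU _) ?_ y
    have := hstab (1 ⊗ₜ b) _ hx
    rwa [outerRep_tmul, map_one, TensorProduct.map_tmul] at this

/-- The case `W = 𝕜` of the two preceding arguments, through `V(k) ⊗ 𝕜 ≅ V(k)`. -/
theorem isSimpleRep_VRep : IsSimpleRep (VRep v hv k) := by
  refine isSimpleRep_of_eq_top _ fun N hN hstab => ?_
  let r := (TensorProduct.rid 𝕜 (VMod 𝕜 k)).toLinearMap
  have hU (x : Uq v) : ∀ z ∈ N.comap r, (VRep v hv k x).rTensor 𝕜 z ∈ N.comap r := by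
    intro z hz
    have : r ((VRep v hv k x).rTensor 𝕜 z) = VRep v hv k x (r z) := by
      have h : r ∘ₗ (VRep v hv k x).rTensor 𝕜 = VRep v hv k x ∘ₗ r :=
        TensorProduct.ext' fun y c => by simp [r]
      exact congrArg (fun q => q z) h
    rw [Submodule.mem_comap, this]
    exact hstab _ _ hz
  have hN' : N.comap r ≠ ⊥ := by
    obtain ⟨z, hz, hz0⟩ := (Submodule.ne_bot_iff _).1 hN
    exact (Submodule.ne_bot_iff _).2 ⟨z ⊗ₜ 1, by simpa [r] using hz, fun h => hz0 (by
      simpa [r] using congrArg r h)⟩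
  obtain ⟨h, hh, hx⟩ := exists_xvec_tmul_mem hv k hN' (hU _)
  refine Submodule.eq_top_iff'.2 fun z => ?_
  have := tmul_mem_of_xvec_tmul_mem hv k (hU _) hx z
  have h2 : h • z ∈ N := by simpa [r] using this
  exact (Submodule.smul_mem_iff _ hh).1 h2

end VRep

end SchurWeyl

/-! ## Weights of tensor space -/

namespace SchurWeyl

section Generic

variable {𝕜 : Type*} [Field 𝕜] {v : 𝕜ˣ} {M : Type*} [AddCommGroup M] [Module 𝕜 M]
  {ρ : Uq v →ₐ[𝕜] Module.End 𝕜 M}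

theorem K_E_pow_apply {j : ℤ} {t : M} (h : ρ (Uq.gen v .K) t = (v : 𝕜) ^ j • t) (p : ℕ) :
    ρ (Uq.gen v .K) ((ρ (Uq.gen v .E) ^ p) t) =
      (v : 𝕜) ^ (j + 2 * p) • (ρ (Uq.gen v .E) ^ p) t := by
  induction p with
  | zero => simpa using h
  | succ p ih =>
    rw [pow_succ', Module.End.mul_apply, K_E_apply ih]
    congr 2
    push_cast; ring

/-- A generator `F ^ p w` with `w` of negative weight is zero, as is one with `p` larger than the
weight `k` of `w`. The others are images of `[p]! x_p` under the map attached to `w`. -/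
theorem hwSpan_le (hv : ¬ IsOfFinOrder v) {m : ℕ} (hF : ρ (Uq.gen v .F) ^ m = 0) {j : ℤ}
    {S : Submodule 𝕜 M} (hS : ∀ (k : ℕ), ∀ w ∈ highestWeight ρ k, ∀ y, hwAct k ρ y w ∈ S) :
    hwSpan ρ j ≤ S := by
  refine Submodule.span_le.2 ?_
  rintro _ ⟨p, w, hw, rfl⟩
  have hFw : (ρ (Uq.gen v .F) ^ m) w = 0 := by rw [hF]; rfl
  rcases lt_or_ge (j + 2 * p) 0 with hj | hj
  · rw [highestWeight_eq_zero hv hw hj hFw, map_zero]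
    exact zero_mem _
  obtain ⟨k, hk⟩ := Int.eq_ofNat_of_zero_le hj
  rw [hk] at hw
  rcases le_or_gt p k with hp | hp
  · have := hS k w hw (qfact v p • xvec 𝕜 k p)
    rwa [map_smul, hwAct_xvec k ρ hp, smul_smul, mul_inv_cancel₀ (qfact_ne_zero v hv p),
      one_smul] at this
  · obtain ⟨q, rfl⟩ := Nat.exists_eq_add_of_lt hp
    rw [show k + q + 1 = q + (k + 1) by ring, pow_add, Module.End.mul_apply,
      F_pow_highestWeight_eq_zero hv hw hF, map_zero]
    exact zero_mem _

end Generic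

/-! ### Weight grading of tensor space and its semisimplicity. -/

section Weights

variable {𝕜 : Type*} [Field 𝕜] (v : 𝕜ˣ) (hv : ¬ IsOfFinOrder v) {n : ℕ}

/-- The weight of a basis vector of tensor space. -/
def wt (s : Fin n → Fin 2) : ℤ := ∑ i, if s i = 0 then 1 else -1

theorem wt_snoc (s : Fin n → Fin 2) (b : Fin 2) :
    wt (Fin.snoc (α := fun _ => Fin 2) s b) = wt s + if b = 0 then 1 else -1 := by
  simp [wt, Fin.sum_univ_castSucc]

theorem wt_le (s : Fin n → Fin 2) : wt s ≤ n ∧ -n ≤ wt s := by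
  constructor
  · refine (Finset.sum_le_card_nsmul _ _ 1 fun i _ => ?_).trans (by simp)
    split_ifs <;> norm_num
  · refine le_trans (by simp) (Finset.card_nsmul_le_sum Finset.univ _ (-1) fun i _ => ?_)
    split_ifs <;> norm_num

theorem K_UCoord_apply (f : Coord 𝕜 n) (s : Fin n → Fin 2) :
    UCoord v hv n (Uq.gen v .K) f s = (v : 𝕜) ^ wt s * f s := by
  induction n with
  | zero => rw [(UCoord_zero v hv f).2.2.1]; simp [wt]
  | succ n ih =>
    have h := congrFun (UCoord_succ v hv f (s (Fin.last n))).2.2.1 (Fin.init s)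
    rw [slice_apply, Fin.snoc_init_self, Pi.smul_apply, ih, slice_apply, Fin.snoc_init_self] at h
    have hw := wt_snoc (Fin.init s) (s (Fin.last n))
    rw [Fin.snoc_init_self] at hw
    rw [h, hw, zpow_add₀ v.ne_zero]
    split_ifs
    · simp; ring
    · simp; ring

variable {v hv}

theorem wt_eq_of_ne_zero {f : Coord 𝕜 n} {j : ℤ}
    (h : UCoord v hv n (Uq.gen v .K) f = (v : 𝕜) ^ j • f) {s : Fin n → Fin 2} (hs : f s ≠ 0) :
    wt s = j := by
  have := congrFun h s
  rw [K_UCoord_apply, Pi.smul_apply, smul_eq_mul] at this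
  exact zpow_val_injective v hv (mul_right_cancel₀ hs this)

theorem K_single (s : Fin n → Fin 2) (c : 𝕜) :
    UCoord v hv n (Uq.gen v .K) (Pi.single s c) = (v : 𝕜) ^ wt s • Pi.single s c := by
  ext t
  rw [K_UCoord_apply, Pi.smul_apply, smul_eq_mul]
  by_cases h : t = s
  · rw [h]
  · simp [h]

/-- A weight vector of weight outside of `[-n, n]` vanishes. -/
theorem eq_zero_of_weight {f : Coord 𝕜 n} {j : ℤ}
    (h : UCoord v hv n (Uq.gen v .K) f = (v : 𝕜) ^ j • f) (hj : (n : ℤ) < j ∨ j < -n) : f = 0 := by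
  by_contra hf
  obtain ⟨s, hs⟩ := Function.ne_iff.1 hf
  have := wt_eq_of_ne_zero h hs
  have := wt_le s
  omega

variable (v hv n)

/-- All weights lie in `[-n, n]`, and `n + 1` steps of size two leave this interval. -/
theorem E_pow_UCoord : UCoord v hv n (Uq.gen v .E) ^ (n + 1) = 0 := by
  refine (Pi.basisFun 𝕜 _).ext fun s => ?_
  rw [Pi.basisFun_apply, LinearMap.zero_apply]
  refine eq_zero_of_weight (K_E_pow_apply (K_single s 1) _) (Or.inl ?_)
  have := wt_le s
  push_cast; omega

theorem F_pow_UCoord : UCoord v hv n (Uq.gen v .F) ^ (n + 1) = 0 := by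
  refine (Pi.basisFun 𝕜 _).ext fun s => ?_
  rw [Pi.basisFun_apply, LinearMap.zero_apply]
  refine eq_zero_of_weight (K_F_pow_apply (K_single s 1) _) (Or.inr ?_)
  have := wt_le s
  push_cast; omega

theorem F_pow_hw_UCoord {k : ℕ} {w : Coord 𝕜 n} (hw : w ∈ highestWeight (UCoord v hv n) k) :
    (UCoord v hv n (Uq.gen v .F) ^ (k + 1)) w = 0 :=
  F_pow_highestWeight_eq_zero hv hw (F_pow_UCoord v hv n)

variable {n} in
/-- A subspace containing all images of the `V(k)` is everything. -/
theorem eq_top_of_hwAct_mem {S : Submodule 𝕜 (Coord 𝕜 n)}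
    (hS : ∀ (k : ℕ), ∀ w ∈ highestWeight (UCoord v hv n) k, ∀ y,
      hwAct k (UCoord v hv n) y w ∈ S) : S = ⊤ := by
  rw [eq_top_iff, ← (Pi.basisFun 𝕜 (Fin n → Fin 2)).span_eq, Submodule.span_le]
  rintro _ ⟨s, rfl⟩
  rw [Pi.basisFun_apply]
  refine hwSpan_le hv (F_pow_UCoord v hv n) hS
    (mem_hwSpan hv (F_pow_UCoord v hv n) (n + 1) (wt s) _ (K_single s 1) ?_)
  rw [E_pow_UCoord]; rfl

/-- Tensor space is the sum, not claimed to be direct, of the images of the simple modules `V(k)`,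
one for each highest weight vector of weight `k`. -/
theorem isSemisimpleRep_UCoord : IsSemisimpleRep (UCoord v hv n) := by
  refine isSemisimpleRep_of_iSup
    (ι := Σ k : ℕ, highestWeight (UCoord v hv n) (k : ℤ)) (V := fun i => VMod 𝕜 i.1)
    (σ := fun i => VRep v hv i.1) (fun i => isSimpleRep_VRep hv i.1)
    (fun i => LinearMap.applyₗ (i.2 : Coord 𝕜 n) ∘ₗ hwAct i.1 (UCoord v hv n))
    (fun i a y => hwAct_intertwines hv i.1 _ i.2.2 (F_pow_hw_UCoord v hv n i.2.2) a y)
    (eq_top_of_hwAct_mem v hv fun k w hw y => ?_)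
  exact Submodule.mem_iSup_of_mem (⟨k, w, hw⟩ : Σ k : ℕ, highestWeight (UCoord v hv n) (k : ℤ))
    ⟨y, rfl⟩

end Weights

/-! ### Commutation of the two actions. -/

section Commutation

variable {𝕜 : Type*} [Field 𝕜] (v : 𝕜ˣ) (hv : ¬ IsOfFinOrder v) (ε : 𝕜)

theorem slice_E {n : ℕ} (f : Coord 𝕜 (n + 1)) (b : Fin 2) :
    slice 𝕜 n b (UCoord v hv (n + 1) (Uq.gen v .E) f) =
      UCoord v hv n (Uq.gen v .E) (slice 𝕜 n b f) +
        (if b = 0 then UCoord v hv n (Uq.gen v .K) (slice 𝕜 n 1 f) else 0) :=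
  (UCoord_succ v hv f b).1

theorem slice_F {n : ℕ} (f : Coord 𝕜 (n + 1)) (b : Fin 2) :
    slice 𝕜 n b (UCoord v hv (n + 1) (Uq.gen v .F) f) =
      (if b = 0 then (v : 𝕜)⁻¹ else v) • UCoord v hv n (Uq.gen v .F) (slice 𝕜 n b f) +
        (if b = 0 then 0 else slice 𝕜 n 0 f) :=
  (UCoord_succ v hv f b).2.1

theorem slice_K {n : ℕ} (f : Coord 𝕜 (n + 1)) (b : Fin 2) :
    slice 𝕜 n b (UCoord v hv (n + 1) (Uq.gen v .K) f) =
      (if b = 0 then (v : 𝕜) else (v : 𝕜)⁻¹) • UCoord v hv n (Uq.gen v .K) (slice 𝕜 n b f) :=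
  (UCoord_succ v hv f b).2.2.1

theorem lastCap_UCoord {n : ℕ} (x : Uq v) (f : Coord 𝕜 (n + 2)) :
    lastCap 𝕜 n v (UCoord v hv (n + 2) x f) = UCoord v hv n x (lastCap 𝕜 n v f) := by
  have hv0 : (v : 𝕜) ≠ 0 := v.ne_zero
  refine Uq_intertwines (UCoord v hv (n + 2)) (UCoord v hv n) (lastCap 𝕜 n v) ?_ ?_ ?_ x f <;>
    intro f <;>
    simp only [lastCap, LinearMap.sub_apply, LinearMap.smul_apply, LinearMap.comp_apply, slice_E, slice_F, slice_K,
      map_add, map_sub, map_smul, one_ne_zero, if_true, if_false, add_zero] <;>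
    simp only [smul_smul, smul_add, mul_inv_cancel₀ hv0, inv_mul_cancel₀ hv0,
      one_smul, sub_add_eq_sub_sub]
  · abel
  · match_scalars <;> field_simp <;> ring

/-- Besides the equivariance of `lastCap`, this uses that the inserted cup is invariant under `U`.
-/
theorem capCup_last_commute {n : ℕ} (x : Uq v) (f : Coord 𝕜 (n + 2)) :
    capCup v ε (Fin.last n).castSucc (Fin.last (n + 1)) (UCoord v hv (n + 2) x f) =
      UCoord v hv (n + 2) x (capCup v ε (Fin.last n).castSucc (Fin.last (n + 1)) f) := by
  have hv0 : (v : 𝕜) ≠ 0 := v.ne_zero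
  refine Uq_intertwines (UCoord v hv (n + 2)) (UCoord v hv (n + 2))
    (capCup v ε (Fin.last n).castSucc (Fin.last (n + 1))) ?_ ?_ ?_ x f <;>
    (intro f; refine slice_ext fun c => slice_ext fun b => ?_) <;>
    rw [slice_capCup_last, lastCap_UCoord] <;>
    rcases fin_two_cases b with rfl | rfl <;> rcases fin_two_cases c with rfl | rfl <;>
    simp only [slice_E, slice_F, slice_K, map_add, map_smul, slice_capCup_last, one_ne_zero, zero_ne_one, if_true,
      if_false, cupCoeff, smul_zero, map_zero, add_zero, zero_add] <;>
    try (match_scalars <;> field_simp <;> ring)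

/-- If the last factor is not involved, the operator acts slice by slice, and the slices of `E f`,
`F f`, `K f` are expressed through the action of the generators on the slices of `f`; the mixing
with `K` is why the induction runs over all `x`. -/
theorem capCup_commute {n : ℕ} {a b : Fin n} (hab : (a : ℕ) + 1 = b) (x : Uq v)
    (f : Coord 𝕜 n) :
    capCup v ε a b (UCoord v hv n x f) = UCoord v hv n x (capCup v ε a b f) := by
  induction n generalizing x with
  | zero => exact a.elim0
  | succ n ih =>
    induction b using Fin.lastCases with
    | last =>
      obtain ⟨n, rfl⟩ : ∃ m, n = m + 1 := ⟨a, by simpa using hab.symm⟩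
      obtain rfl : a = (Fin.last n).castSucc := Fin.ext (by simpa using hab)
      exact capCup_last_commute v hv ε x f
    | cast b =>
      obtain ⟨a, rfl⟩ : ∃ a' : Fin n, a = a'.castSucc :=
        ⟨⟨a, by have := b.2; simp at hab; omega⟩, rfl⟩
      have ih := fun x f => ih (a := a) (b := b) (f := f) (by simpa using hab) x
      refine Uq_intertwines (UCoord v hv (n + 1)) (UCoord v hv (n + 1))
        (capCup v ε a.castSucc b.castSucc) ?_ ?_ ?_ x f <;>
        (intro f; refine slice_ext fun c => ?_) <;>
        simp only [slice_capCup, slice_E, slice_F, slice_K, map_add, map_smul, ih] <;>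
        split_ifs <;> simp [ih]

end Commutation

end SchurWeyl

/-! ## The Temperley–Lieb algebra is the commutant of `U` -/

namespace SchurWeyl

/-! ### Maps out of `TL_n(δ)` and induction on its elements. -/

section TLBasics

variable {𝕜 A : Type*} [Field 𝕜] [Ring A] [Algebra 𝕜 A] {δ : 𝕜} {N n : ℕ} {e : ℕ → A}

theorem IsTLFamily.mono (h : IsTLFamily δ N e) {N' : ℕ} (hN : N' ≤ N) : IsTLFamily δ N' e where
  sq i hi := h.sq i (by omega)
  up i hi := h.up i (by omega)
  down i hi := h.down i (by omega)
  comm i j hij hj := h.comm i j hij (by omega)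

/-- The generators of `TL_n(δ)`, extended by zero. -/
noncomputable def TL.genNat (n : ℕ) (δ : 𝕜) (i : ℕ) : TL n δ :=
  if h : i < n - 1 then TL.gen n δ ⟨i, h⟩ else 0

theorem TL.gen_rel {n : ℕ} {δ : 𝕜} {x y : FreeAlgebra 𝕜 (Fin (n - 1))} (h : TLRel n δ x y) :
    RingQuot.mkAlgHom 𝕜 (TLRel n δ) x = RingQuot.mkAlgHom 𝕜 (TLRel n δ) y :=
  RingQuot.mkAlgHom_rel 𝕜 h

theorem TL.isTLFamily (n : ℕ) (δ : 𝕜) : IsTLFamily δ (n - 1) (TL.genNat n δ) where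
  sq i hi := by
    simpa [genNat, hi, gen] using TL.gen_rel (TLRel.sq (n := n) (δ := δ) ⟨i, hi⟩)
  up i hi := by
    have hi' : i < n - 1 := by omega
    simpa [genNat, hi, hi', gen] using
      TL.gen_rel (TLRel.adj (n := n) (δ := δ) ⟨i, hi'⟩ ⟨i + 1, hi⟩ (Or.inl rfl))
  down i hi := by
    have hi' : i < n - 1 := by omega
    simpa [genNat, hi, hi', gen] using
      TL.gen_rel (TLRel.adj (n := n) (δ := δ) ⟨i + 1, hi⟩ ⟨i, hi'⟩ (Or.inr rfl))
  comm i j hij hj := by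
    have hi : i < n - 1 := by omega
    simpa [genNat, hi, hj, gen, Commute, SemiconjBy] using
      TL.gen_rel (TLRel.comm (n := n) (δ := δ) ⟨i, hi⟩ ⟨j, hj⟩ (Or.inl hij))

/-- The morphism out of `TL_n(δ)` given by elements that satisfy the relations. -/
noncomputable def TL.lift (h : IsTLFamily δ (n - 1) e) : TL n δ →ₐ[𝕜] A :=
  RingQuot.liftAlgHom 𝕜 ⟨FreeAlgebra.lift 𝕜 fun i : Fin (n - 1) => e i, by
    intro a b hab
    cases hab with
    | sq i => simpa using h.sq i i.2
    | adj i j hij =>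
      rcases hij with hij | hij
      · simpa [← hij] using h.up i (by omega)
      · simpa [← hij] using h.down j (by omega)
    | comm i j hij =>
      rcases hij with hij | hij
      · simpa using (h.comm i j hij j.2).eq
      · simpa using (h.comm j i hij i.2).eq.symm⟩

theorem TL.lift_gen (h : IsTLFamily δ (n - 1) e) (i : Fin (n - 1)) :
    TL.lift h (TL.gen n δ i) = e i := by
  simp [TL.lift, TL.gen]

theorem TL.lift_genNat (h : IsTLFamily δ (n - 1) e) {i : ℕ} (hi : i < n - 1) :
    TL.lift h (TL.genNat n δ i) = e i := by
  rw [TL.genNat, dif_pos hi, TL.lift_gen]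

theorem TL.mem_initialAlg (x : TL n δ) : x ∈ initialAlg 𝕜 (TL.genNat n δ) (n - 1) := by
  obtain ⟨x, rfl⟩ := RingQuot.mkAlgHom_surjective 𝕜 (TLRel n δ) x
  induction x with
  | grade0 c => rw [AlgHom.commutes]; exact Subalgebra.algebraMap_mem _ c
  | grade1 g =>
    have := SchurWeyl.mem_initialAlg (𝕜 := 𝕜) (e := TL.genNat n δ) g.2
    rwa [TL.genNat, dif_pos g.2] at this
  | mul x y hx hy => rw [map_mul]; exact mul_mem hx hy
  | add x y hx hy => rw [map_add]; exact add_mem hx hy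

theorem TL.induction {p : TL n δ → Prop} (h1 : ∀ c : 𝕜, p (algebraMap 𝕜 _ c))
    (hadd : ∀ x y, p x → p y → p (x + y)) (hmul : ∀ x y, p x → p y → p (x * y))
    (hgen : ∀ i, p (TL.gen n δ i)) (x : TL n δ) : p x := by
  refine initialAlg_induction (p := p) h1 hadd hmul (fun i hi => ?_) (TL.mem_initialAlg x)
  rw [TL.genNat, dif_pos hi]
  exact hgen _

/-- The standard morphism `TL_n(δ) → TL_{n+1}(δ)`. -/
noncomputable def TL.incl (n : ℕ) (δ : 𝕜) : TL n δ →ₐ[𝕜] TL (n + 1) δ :=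
  TL.lift ((TL.isTLFamily (n + 1) δ).mono (by omega))

theorem TL.exists_incl_eq (n : ℕ) (δ : 𝕜) {x : TL (n + 1) δ}
    (hx : x ∈ initialAlg 𝕜 (TL.genNat (n + 1) δ) (n - 1)) : ∃ y, TL.incl n δ y = x := by
  refine initialAlg_induction (p := fun x => x ∈ (TL.incl n δ).range)
    (fun c => Subalgebra.algebraMap_mem _ c) (fun _ _ => add_mem) (fun _ _ => mul_mem) ?_ hx
  intro i hi
  exact ⟨TL.genNat n δ i, TL.lift_genNat _ hi⟩

end TLBasics

/-! ### The Temperley–Lieb action in coordinates. -/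

section Rep

variable {𝕜 : Type*} [Field 𝕜] (v : 𝕜ˣ) {ε : 𝕜}

/-- The operators by which the generators of `TL_n(δ)` act on tensor space. -/
noncomputable def capFamily (ε : 𝕜) (n i : ℕ) : Module.End 𝕜 (Coord 𝕜 n) :=
  if h : i < n - 1 then capCup v ε (lo ⟨i, h⟩) (hi ⟨i, h⟩) else 0

theorem isTLFamily_capFamily (hε : ε * ε = 1) (n : ℕ) :
    IsTLFamily (ε * ((v : 𝕜) + (v : 𝕜)⁻¹)) (n - 1) (capFamily v ε n) where
  sq i hi := by
    simp only [capFamily, dif_pos hi]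
    exact capCup_sq v (Fin.ne_of_val_ne (by simp only [lo, SchurWeyl.hi]; omega))
  up i hi := by
    have hi' : i < n - 1 := by omega
    simp only [capFamily, dif_pos hi, dif_pos hi']
    exact capCup_zigzag_right v hε (Fin.ne_of_val_ne (by simp only [lo, SchurWeyl.hi]; omega))
      (Fin.ne_of_val_ne (by simp only [SchurWeyl.hi]; omega))
      (Fin.ne_of_val_ne (by simp only [lo, SchurWeyl.hi]; omega))
  down i hi := by
    have hi' : i < n - 1 := by omega
    simp only [capFamily, dif_pos hi, dif_pos hi']
    exact capCup_zigzag_left v hε (Fin.ne_of_val_ne (by simp only [lo]; omega))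
      (Fin.ne_of_val_ne (by simp only [lo, SchurWeyl.hi]; omega))
      (Fin.ne_of_val_ne (by simp only [lo, SchurWeyl.hi]; omega))
  comm i j hij hj := by
    have hi' : i < n - 1 := by omega
    simp only [capFamily, dif_pos hj, dif_pos hi']
    refine capCup_comm v ?_ ?_ ?_ ?_ <;>
      exact Fin.ne_of_val_ne (by simp only [lo, SchurWeyl.hi]; omega)

variable {δ : 𝕜} (hε : ε * ε = 1) (hδ : δ = ε * ((v : 𝕜) + (v : 𝕜)⁻¹)) (n : ℕ)

/-- The action of the Temperley–Lieb algebra on tensor space in coordinates. -/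
noncomputable def tlRep : TL n δ →ₐ[𝕜] Module.End 𝕜 (Coord 𝕜 n) :=
  TL.lift (hδ ▸ isTLFamily_capFamily v hε n)

theorem tlRep_gen (i : Fin (n - 1)) :
    tlRep v hε hδ n (TL.gen n _ i) = capCup v ε (lo i) (hi i) := by
  rw [tlRep, TL.lift_gen, capFamily, dif_pos i.2]

theorem tlRep_genNat {i : ℕ} (h : i < n - 1) :
    tlRep v hε hδ n (TL.genNat n _ i) = capCup v ε (lo ⟨i, h⟩) (hi ⟨i, h⟩) := by
  rw [tlRep, TL.lift_genNat _ h, capFamily, dif_pos h]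

theorem tlRep_last (m : ℕ) :
    tlRep v hε hδ (m + 2) (TL.genNat (m + 2) _ m) =
      capCup v ε (Fin.last m).castSucc (Fin.last (m + 1)) := by
  rw [tlRep_genNat v hε hδ (m + 2) (i := m) (by omega)]
  rfl

/-- An element of the smaller algebra acts as itself tensored with the identity of the last factor.
-/
theorem slice_tlRep_incl (x : TL n δ) (b : Fin 2)
    (f : Coord 𝕜 (n + 1)) :
    slice 𝕜 n b (tlRep v hε hδ (n + 1) (TL.incl n _ x) f) = tlRep v hε hδ n x (slice 𝕜 n b f) := by
  revert f
  refine TL.induction (p := fun x => ∀ f, slice 𝕜 n b (tlRep v hε hδ (n + 1) (TL.incl n _ x) f) =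
    tlRep v hε hδ n x (slice 𝕜 n b f)) ?_ ?_ ?_ ?_ x
  · intro c f; simp [Algebra.algebraMap_eq_smul_one]
  · intro x y hx hy f; simp [hx, hy]
  · intro x y hx hy f; simp [hx, hy]
  · intro i f
    have : TL.incl n δ (TL.gen n _ i) =
        TL.genNat (n + 1) _ i := TL.lift_gen _ i
    rw [this, tlRep_genNat v hε hδ (n + 1) (i := i) (by have := i.2; omega), tlRep_gen]
    exact slice_capCup v ε (lo i) (hi i) b f

theorem tlRep_commute (hv : ¬ IsOfFinOrder v) (a : TL n δ) (x : Uq v) :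
    Commute (UCoord v hv n x) (tlRep v hε hδ n a) := by
  refine TL.induction (p := fun a => Commute (UCoord v hv n x) (tlRep v hε hδ n a)) ?_ ?_ ?_ ?_ a
  · intro c; rw [AlgHom.commutes]; exact (Algebra.commutes c _).symm
  · intro x y hx hy; rw [map_add]; exact hx.add_right hy
  · intro x y hx hy; rw [map_mul]; exact hx.mul_right hy
  · intro i
    rw [tlRep_gen]
    exact LinearMap.ext fun f => (capCup_commute v hv ε (a := lo i) (b := hi i) rfl x f).symm

variable {n} in
theorem mem_endAlg_iff {A M : Type*} [Ring A] [Algebra 𝕜 A] [AddCommGroup M] [Module 𝕜 M]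
    {ρ : A →ₐ[𝕜] Module.End 𝕜 M} {φ : Module.End 𝕜 M} :
    φ ∈ endAlg ρ ↔ ∀ a m, φ (ρ a m) = ρ a (φ m) := by
  rw [endAlg, Subalgebra.mem_centralizer_iff]
  constructor
  · intro h a m
    exact (congrArg (fun q : Module.End 𝕜 M => q m) (h _ ⟨a, rfl⟩)).symm
  · rintro h _ ⟨a, rfl⟩
    exact LinearMap.ext fun m => (h a m).symm

theorem tlRep_mem_endAlg (hv : ¬ IsOfFinOrder v) (a : TL n δ) :
    tlRep v hε hδ n a ∈ endAlg (UCoord v hv n) :=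
  mem_endAlg_iff.2 fun x m =>
    (congrArg (fun q : Module.End 𝕜 (Coord 𝕜 n) => q m) (tlRep_commute v hε hδ n hv a x).eq).symm

end Rep

/-! ### Monotone index sequences and their weights. -/

section Monotone

variable {n : ℕ}

theorem wt_lt_of_le {s t : Fin n → Fin 2} (h : ∀ i, s i ≤ t i) (hne : s ≠ t) : wt t < wt s := by
  obtain ⟨i, hi⟩ := Function.ne_iff.1 hne
  have key : ∀ x y : Fin 2, x ≤ y →
      (if y = 0 then (1 : ℤ) else -1) ≤ if x = 0 then 1 else -1 := by decide
  have key' : ∀ x y : Fin 2, x ≤ y → x ≠ y →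
      (if y = 0 then (1 : ℤ) else -1) < if x = 0 then 1 else -1 := by decide
  exact Finset.sum_lt_sum (fun j _ => key _ _ (h j)) ⟨i, Finset.mem_univ i, key' _ _ (h i) hi⟩

/-- A monotone sequence is a block of `0`s followed by a block of `1`s. Two such are comparable
pointwise, and the weight is strictly decreasing. -/
theorem eq_of_monotone_of_wt_eq {s t : Fin n → Fin 2} (hs : Monotone s) (ht : Monotone t)
    (h : wt s = wt t) : s = t := by
  by_contra hne
  obtain ⟨i, hi⟩ := Function.ne_iff.1 hne
  wlog hlt : s i < t i generalizing s t
  · exact this ht hs h.symm (Ne.symm hne) hi.symm (lt_of_le_of_ne (not_lt.1 hlt) hi.symm)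
  refine (wt_lt_of_le (fun j => ?_) hne).ne h.symm
  have h0 : s i = 0 := by
    rcases fin_two_cases (s i) with h1 | h1
    · exact h1
    · rw [h1] at hlt; exact absurd hlt (by have := (t i).2; simp [Fin.lt_def]; omega)
  have h1 : t i = 1 := by
    rcases fin_two_cases (t i) with h1 | h1
    · rw [h1] at hlt; exact absurd hlt (by simp)
    · exact h1
  rcases le_total j i with hj | hj
  · have := hs hj
    rw [h0] at this
    exact this.trans (Fin.zero_le _)
  · have := ht hj
    rw [h1] at this
    exact le_trans (by have := (s j).2; simp [Fin.le_def]; omega) this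

theorem wt_eq (s : Fin n → Fin 2) : ∃ r : ℕ, r ≤ n ∧ wt s = n - 2 * r := by
  refine ⟨(Finset.univ.filter fun i => s i ≠ 0).card, (Finset.card_filter_le _ _).trans (by simp), ?_⟩
  have h : ∀ i, (if s i = 0 then (1 : ℤ) else -1) = 1 - 2 * if s i ≠ 0 then 1 else 0 := by
    intro i; split_ifs <;> simp_all
  rw [wt, Finset.sum_congr rfl fun i _ => h i, Finset.sum_sub_distrib, ← Finset.mul_sum,
    Finset.sum_boole]
  simp

theorem eq_zero_of_wt_eq {s : Fin n → Fin 2} (h : wt s = n) : s = 0 := by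
  by_contra hne
  have := wt_lt_of_le (s := 0) (t := s) (fun i => Fin.zero_le _) (Ne.symm hne)
  rw [h] at this
  exact absurd (wt_le (0 : Fin n → Fin 2)).1 (by omega)

theorem wt_zero : wt (0 : Fin n → Fin 2) = n := by simp [wt]

end Monotone

/-! ### Tensors killed by every cap. -/

section Sym

variable {𝕜 : Type*} [Field 𝕜] {v : 𝕜ˣ} {ε : 𝕜} {n : ℕ}

/-- The tensors that are annihilated by all generators of the Temperley–Lieb algebra. -/
def capKer (v : 𝕜ˣ) (ε : 𝕜) (n : ℕ) : Submodule 𝕜 (Coord 𝕜 n) :=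
  ⨅ i : Fin (n - 1), LinearMap.ker (capCup v ε (lo i) (hi i))

theorem mem_capKer {f : Coord 𝕜 n} :
    f ∈ capKer v ε n ↔ ∀ i : Fin (n - 1), capCup v ε (lo i) (hi i) f = 0 := by
  simp [capKer]

theorem cupCoeff_ne_zero (v : 𝕜ˣ) (i : Fin 2) : cupCoeff v i ≠ 0 := by
  unfold cupCoeff; split_ifs <;> simp

theorem apply_setPair_of_mem_capKer (hε : ε * ε = 1) {f : Coord 𝕜 n} (h : f ∈ capKer v ε n)
    (i : Fin (n - 1)) (s : Fin n → Fin 2) :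
    f (setPair s (lo i) (hi i) 0 1) = v * f (setPair s (lo i) (hi i) 1 0) := by
  have hε0 : ε ≠ 0 := left_ne_zero_of_mul_eq_one hε
  have h1 := congrFun (mem_capKer.1 h i) (setPair s (lo i) (hi i) 0 1)
  have hne : lo i ≠ hi i := by simp [lo, hi, Fin.ext_iff]
  rw [capCup_apply, setPair_left hne, setPair_right, if_neg (by simp), capAt_setPair] at h1
  have := (mul_eq_zero.1 h1).resolve_left (mul_ne_zero hε0 (cupCoeff_ne_zero v _))
  exact sub_eq_zero.1 this

/-- Being killed by a cap means that exchanging neighbouring entries `1, 0` changes the coordinate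
by a nonzero factor only, so all coordinates are controlled by those with sorted index. -/
theorem eq_zero_of_mem_capKer (hε : ε * ε = 1) {f : Coord 𝕜 n} (h : f ∈ capKer v ε n)
    (hf : ∀ s, Monotone s → f s = 0) : f = 0 := by
  -- The induction is on the sum of the positions of the `0`s, which drops by one with each sorting
  -- exchange.
  have key : ∀ (q : ℕ) (s : Fin n → Fin 2),
      (∑ i : Fin n, if s i = 0 then (i : ℕ) else 0) = q → f s = 0 := by
    intro q
    induction q using Nat.strong_induction_on with
    | _ q ih =>
      intro s hq
      by_cases hs : Monotone s
      · exact hf s hs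
      obtain ⟨i, h1, h0⟩ : ∃ i : Fin (n - 1), s (lo i) = 1 ∧ s (hi i) = 0 := by
        by_contra hno
        push Not at hno
        refine hs ?_
        rcases n with _ | n
        · exact fun a => a.elim0
        refine Fin.monotone_iff_le_succ.2 fun i => ?_
        rcases fin_two_cases (s i.castSucc) with h | h
        · rw [h]; exact Fin.zero_le _
        · have := hno i h
          rw [h]
          have h' : s i.succ ≠ 0 := this
          rw [(fin_two_cases (s i.succ)).resolve_left h']
      have hne : lo i ≠ hi i := by simp [lo, hi, Fin.ext_iff]
      have hs' : setPair s (lo i) (hi i) 1 0 = s := setPair_eq_self h1 h0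
      have := apply_setPair_of_mem_capKer hε h i s
      rw [hs'] at this
      refine (mul_eq_zero.1 (this.symm.trans (ih _ ?_ _ rfl))).resolve_left v.ne_zero
      rw [← hq, ← Finset.add_sum_erase _ _ (Finset.mem_univ (lo i)),
        ← Finset.add_sum_erase _ _ (Finset.mem_erase.2 ⟨hne.symm, Finset.mem_univ (hi i)⟩)]
      rw [← Finset.add_sum_erase _ _ (Finset.mem_univ (lo i)),
        ← Finset.add_sum_erase _ (fun i => if s i = 0 then (i : ℕ) else 0)
          (Finset.mem_erase.2 ⟨hne.symm, Finset.mem_univ (hi i)⟩)]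
      have hrest : ∑ x ∈ (Finset.univ.erase (lo i)).erase (hi i),
          (if setPair s (lo i) (hi i) 0 1 x = 0 then (x : ℕ) else 0) =
          ∑ x ∈ (Finset.univ.erase (lo i)).erase (hi i), if s x = 0 then (x : ℕ) else 0 := by
        refine Finset.sum_congr rfl fun x hx => ?_
        simp only [Finset.mem_erase] at hx
        rw [setPair_of_ne hx.2.1 hx.1]
      rw [hrest, setPair_left hne, setPair_right, h1, h0]
      simp [lo, hi]
  exact funext fun s => key _ s rfl

/-- There is at most one sorted index of each weight, so within a weight space such a tensor is
determined by a single coordinate. -/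
theorem smul_eq_of_mem_capKer (hv : ¬ IsOfFinOrder v) (hε : ε * ε = 1) {f g : Coord 𝕜 n} {j : ℤ}
    (hf : f ∈ capKer v ε n) (hg : g ∈ capKer v ε n) (hf0 : f ≠ 0)
    (hfj : UCoord v hv n (Uq.gen v .K) f = (v : 𝕜) ^ j • f)
    (hgj : UCoord v hv n (Uq.gen v .K) g = (v : 𝕜) ^ j • g) : ∃ c : 𝕜, g = c • f := by
  obtain ⟨s, hs, hfs⟩ : ∃ s, Monotone s ∧ f s ≠ 0 := by
    by_contra hno
    push Not at hno
    exact hf0 (eq_zero_of_mem_capKer hε hf hno)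
  refine ⟨g s / f s, sub_eq_zero.1 (eq_zero_of_mem_capKer hε
    (sub_mem hg (Submodule.smul_mem _ _ hf)) fun t ht => ?_)⟩
  rw [Pi.sub_apply, Pi.smul_apply, smul_eq_mul]
  by_cases hft : f t = 0
  · by_cases hgt : g t = 0
    · rw [hft, hgt]; simp
    · have := eq_of_monotone_of_wt_eq hs ht
        ((wt_eq_of_ne_zero hfj hfs).trans (wt_eq_of_ne_zero hgj hgt).symm)
      exact absurd hft (this ▸ hfs)
  · have := eq_of_monotone_of_wt_eq hs ht
      ((wt_eq_of_ne_zero hfj hfs).trans (wt_eq_of_ne_zero hfj hft).symm)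
    rw [← this, div_mul_cancel₀ _ hfs, sub_self]

variable (𝕜 n) in
/-- The tensor `x₀ ⊗ ⋯ ⊗ x₀`. -/
def topVec : Coord 𝕜 n := Pi.single 0 1

theorem topVec_ne_zero : topVec 𝕜 n ≠ 0 := by
  intro h
  have := congrFun h 0
  simp [topVec] at this

variable (hv : ¬ IsOfFinOrder v)

theorem topVec_mem : topVec 𝕜 n ∈ highestWeight (UCoord v hv n) n := by
  have hK : UCoord v hv n (Uq.gen v .K) (topVec 𝕜 n) = (v : 𝕜) ^ (n : ℤ) • topVec 𝕜 n := by
    have := K_single (v := v) (hv := hv) (0 : Fin n → Fin 2) 1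
    rwa [wt_zero] at this
  exact mem_highestWeight.2 ⟨eq_zero_of_weight (K_E_apply hK) (Or.inl (by omega)), hK⟩

theorem eq_smul_topVec {f : Coord 𝕜 n}
    (hf : UCoord v hv n (Uq.gen v .K) f = (v : 𝕜) ^ (n : ℤ) • f) : f = f 0 • topVec 𝕜 n := by
  ext s
  by_cases hs : s = 0
  · simp [hs, topVec]
  · rw [Pi.smul_apply, topVec, Pi.single_eq_of_ne hs, smul_zero]
    by_contra h
    exact hs (eq_zero_of_wt_eq (wt_eq_of_ne_zero hf h))

theorem capCup_topVec {a b : Fin n} (hab : a ≠ b) : capCup v ε a b (topVec 𝕜 n) = 0 := by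
  ext s
  have h1 : setPair s a b 0 1 ≠ 0 := fun h => by
    have := congrFun h b
    rw [setPair_right] at this
    simp at this
  have h2 : setPair s a b 1 0 ≠ 0 := fun h => by
    have := congrFun h a
    rw [setPair_left hab] at this
    simp at this
  rw [capCup_apply, capAt, topVec, Pi.single_eq_of_ne h1, Pi.single_eq_of_ne h2]
  simp

theorem E_pow_F_pow {M : Type*} [AddCommGroup M] [Module 𝕜 M] {ρ : Uq v →ₐ[𝕜] Module.End 𝕜 M}
    {k : ℕ} {w : M} (hv : ¬ IsOfFinOrder v) (hw : w ∈ highestWeight ρ k) (r : ℕ) (hr : r ≤ k) :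
    ∃ c : 𝕜, c ≠ 0 ∧ (ρ (Uq.gen v .E) ^ r) ((ρ (Uq.gen v .F) ^ r) w) = c • w := by
  induction r with
  | zero => exact ⟨1, one_ne_zero, by simp⟩
  | succ r ih =>
    obtain ⟨c, hc, h⟩ := ih (by omega)
    refine ⟨qint v (r + 1) * qint v (k - r) * c, mul_ne_zero (mul_ne_zero
      (qint_ne_zero v hv (by omega)) (qint_ne_zero v hv (by omega))) hc, ?_⟩
    rw [pow_succ (ρ (Uq.gen v .E)), Module.End.mul_apply, E_F_pow_highestWeight hv hw, map_smul, h,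
      smul_smul]

theorem intertwines_pow {A M N : Type*} [Ring A] [Algebra 𝕜 A] [AddCommGroup M] [Module 𝕜 M]
    [AddCommGroup N] [Module 𝕜 N] {ρ : A →ₐ[𝕜] Module.End 𝕜 M} {σ : A →ₐ[𝕜] Module.End 𝕜 N}
    {φ : M →ₗ[𝕜] N} (hφ : ∀ a m, φ (ρ a m) = σ a (φ m)) (a : A) (r : ℕ) (m : M) :
    φ ((ρ a ^ r) m) = (σ a ^ r) (φ m) := by
  rw [← map_pow, hφ, map_pow]

/-- An endomorphism with values in `capKer` that kills the top vector is zero. -/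
theorem eq_zero_of_range_le_capKer (hε : ε * ε = 1) {g : Module.End 𝕜 (Coord 𝕜 n)}
    (hg : g ∈ endAlg (UCoord v hv n)) (hker : ∀ f, g f ∈ capKer v ε n)
    (htop : g (topVec 𝕜 n) = 0) : g = 0 := by
  rw [mem_endAlg_iff] at hg
  refine (Pi.basisFun 𝕜 _).ext fun s => ?_
  rw [Pi.basisFun_apply, LinearMap.zero_apply]
  obtain ⟨r, hr, hwt⟩ := wt_eq s
  have hKs := K_single (v := v) (hv := hv) s 1
  set t : Coord 𝕜 n := Pi.single s 1
  rw [hwt] at hKs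
  have hKg : UCoord v hv n (Uq.gen v .K) (g t) = (v : 𝕜) ^ ((n : ℤ) - 2 * r) • g t := by
    rw [← hg, hKs, map_smul]
  have htm := topVec_mem (n := n) hv
  obtain ⟨c, hc, hEF⟩ := E_pow_F_pow hv htm r hr
  -- `F ^ r` applied to the top vector spans the part of `capKer` of weight `n - 2 r`, so `g t` is a
  -- multiple of it.
  have hF : (UCoord v hv n (Uq.gen v .F) ^ r) (topVec 𝕜 n) ∈ capKer v ε n := by
    refine mem_capKer.2 fun i => ?_
    have hne : lo i ≠ hi i := by simp [lo, hi, Fin.ext_iff]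
    rw [intertwines_pow (capCup_commute v hv ε (a := lo i) (b := hi i) rfl), capCup_topVec hne,
      map_zero]
  have hF0 : (UCoord v hv n (Uq.gen v .F) ^ r) (topVec 𝕜 n) ≠ 0 := fun h => by
    rw [h, map_zero] at hEF
    exact smul_ne_zero hc topVec_ne_zero hEF.symm
  obtain ⟨d, hd⟩ := smul_eq_of_mem_capKer hv hε hF (hker t) hF0
    (K_F_pow_apply (mem_highestWeight.1 htm).2 r) hKg
  -- `E ^ r` commutes with `g` and takes `t` to a multiple of the top vector, which `g` kills. On
  -- the other hand `E ^ r F ^ r` acts on the top vector by a nonzero scalar.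
  have hE : (UCoord v hv n (Uq.gen v .E) ^ r) (g t) = 0 := by
    rw [← intertwines_pow hg]
    have h := K_E_pow_apply hKs r
    rw [show (n : ℤ) - 2 * r + 2 * r = n by ring] at h
    rw [eq_smul_topVec hv h, map_smul, htop, smul_zero]
  rw [hd, map_smul, hEF, smul_smul, smul_eq_zero] at hE
  have hd0 : d = 0 := (mul_eq_zero.1 (hE.resolve_right topVec_ne_zero)).resolve_right hc
  rw [hd, hd0, zero_smul]

end Sym

/-! ### Coefficients of the Jones–Wenzl recursion. -/

section JonesWenzl

variable {𝕜 : Type*} [Field 𝕜] (v : 𝕜ˣ) {ε : 𝕜}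

/-- The coefficients `± [m + 1] / [m + 2]` in the recursion for the Jones–Wenzl idempotents. -/
def jwCoeff (ε : 𝕜) (m : ℕ) : 𝕜 := ε * (qint v (m + 1) / qint v (m + 2))

theorem qint_two_mul (hv : ¬ IsOfFinOrder v) (j : ℤ) :
    ((v : 𝕜) + (v : 𝕜)⁻¹) * qint v (j + 1) = qint v (j + 2) + qint v j := by
  have hv0 : (v : 𝕜) ≠ 0 := v.ne_zero
  have h1 := sub_inv_ne_zero v hv
  have e2 : (v : 𝕜) ^ (2 : ℤ) = v * v := by rw [zpow_two]
  simp only [qint, neg_add, zpow_add₀ hv0, zpow_neg, zpow_one, e2]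
  have hj : (v : 𝕜) ^ j ≠ 0 := zpow_ne_zero _ hv0
  rw [← add_div, ← mul_div_assoc]
  congr 1
  field_simp
  ring

theorem jwCoeff_zero (hv : ¬ IsOfFinOrder v) (hε : ε * ε = 1) :
    jwCoeff v ε 0 * (ε * ((v : 𝕜) + (v : 𝕜)⁻¹)) = 1 := by
  have h2 := qint_two_mul v hv 0
  have h0 := qint_ne_zero v hv (j := 2) (by norm_num)
  simp only [zero_add, qint_one v hv, mul_one, qint_zero, add_zero] at h2
  simp only [jwCoeff, Nat.cast_zero, zero_add, qint_one v hv, h2]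
  field_simp
  linear_combination hε

/-- After clearing denominators this is `(v + v⁻¹) [m + 2] = [m + 3] + [m + 1]`. -/
theorem jwCoeff_succ (hv : ¬ IsOfFinOrder v) (hε : ε * ε = 1) (m : ℕ) :
    jwCoeff v ε (m + 1) * (ε * ((v : 𝕜) + (v : 𝕜)⁻¹) - jwCoeff v ε m) = 1 := by
  have h2 := qint_two_mul v hv (m + 1)
  have e1 : (m : ℤ) + 1 + 1 = m + 2 := by ring
  have e2 : (m : ℤ) + 1 + 2 = m + 3 := by ring
  rw [e1, e2] at h2
  have a2 := qint_ne_zero v hv (j := m + 2) (by omega)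
  have a3 := qint_ne_zero v hv (j := m + 3) (by omega)
  simp only [jwCoeff, Nat.cast_add, Nat.cast_one, e1, e2]
  generalize (v : 𝕜) + (v : 𝕜)⁻¹ = q at *
  generalize qint v ((m : ℤ) + 1) = A at *
  generalize qint v ((m : ℤ) + 2) = B at *
  generalize qint v ((m : ℤ) + 3) = C at *
  field_simp
  linear_combination C * hε + ε * ε * h2

end JonesWenzl

/-! ### Faithfulness and fullness of the Temperley–Lieb action. -/

section Bijective

variable {𝕜 : Type*} [Field 𝕜] {v : 𝕜ˣ} (hv : ¬ IsOfFinOrder v) {ε : 𝕜} {δ : 𝕜} (hε : ε * ε = 1)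
  (hδ : δ = ε * ((v : 𝕜) + (v : 𝕜)⁻¹)) {n : ℕ}

theorem TL.exists_sub_algebraMap_mem {𝕜 : Type*} [Field 𝕜] {n : ℕ} {δ : 𝕜} (x : TL n δ) :
    ∃ c : 𝕜, x - algebraMap 𝕜 _ c ∈ capIdeal 𝕜 (n - 1) (TL.genNat n δ) := by
  refine TL.induction (p := fun x => ∃ c : 𝕜, x - algebraMap 𝕜 _ c ∈
    capIdeal 𝕜 (n - 1) (TL.genNat n δ)) ?_ ?_ ?_ ?_ x
  · exact fun c => ⟨c, by simp⟩
  · rintro x y ⟨c, hc⟩ ⟨d, hd⟩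
    refine ⟨c + d, ?_⟩
    rw [map_add, add_sub_add_comm]
    exact add_mem hc hd
  · rintro x y ⟨c, hc⟩ ⟨d, hd⟩
    refine ⟨c * d, ?_⟩
    have : x * y - algebraMap 𝕜 _ (c * d) =
        (x - algebraMap 𝕜 _ c) * y + algebraMap 𝕜 _ c * (y - algebraMap 𝕜 _ d) := by
      rw [map_mul, sub_mul, mul_sub]; abel
    rw [this]
    exact add_mem (capIdeal_mul_mem hc) (mul_mem_capIdeal hd)
  · intro i
    refine ⟨0, Submodule.subset_span ⟨i, i.2, 1, 1, ?_⟩⟩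
    simp [TL.genNat]

theorem tlRep_topVec {x : TL n δ}
    (hx : x ∈ capIdeal 𝕜 (n - 1) (TL.genNat n δ)) :
    tlRep v hε hδ n x (topVec 𝕜 n) = 0 := by
  induction hx using Submodule.span_induction with
  | zero => simp
  | add x y _ _ hx hy => rw [map_add, LinearMap.add_apply, hx, hy, add_zero]
  | smul c x _ hx => rw [map_smul, LinearMap.smul_apply, hx, smul_zero]
  | mem y hy =>
    obtain ⟨i, hi, a, b, rfl⟩ := hy
    obtain ⟨c, hc⟩ : ∃ c : 𝕜, tlRep v hε hδ n b (topVec 𝕜 n) = c • topVec 𝕜 n := by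
      refine TL.induction (p := fun b => ∃ c : 𝕜, tlRep v hε hδ n b (topVec 𝕜 n) = c • topVec 𝕜 n)
        ?_ ?_ ?_ ?_ b
      · exact fun c => ⟨c, by simp [Algebra.algebraMap_eq_smul_one]⟩
      · rintro x y ⟨c, hc⟩ ⟨d, hd⟩
        exact ⟨c + d, by rw [map_add, LinearMap.add_apply, hc, hd, add_smul]⟩
      · rintro x y ⟨c, hc⟩ ⟨d, hd⟩
        exact ⟨d * c, by rw [map_mul, Module.End.mul_apply, hd, map_smul, hc, smul_smul]⟩
      · intro i
        exact ⟨0, by rw [tlRep_gen, capCup_topVec (by simp [lo, SchurWeyl.hi, Fin.ext_iff]), zero_smul]⟩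
    rw [map_mul, map_mul, Module.End.mul_apply, Module.End.mul_apply, hc, map_smul,
      tlRep_genNat v hε hδ n hi, capCup_topVec (by simp [lo, SchurWeyl.hi, Fin.ext_iff])]
    simp

include hv hδ in
-- The hypothesis says that `capIdeal` kills `x` from the left, so `p * x = x` for the Jones–Wenzl
-- idempotent `p`. As `x` acts by zero on the top vector, its scalar part vanishes and `x` lies in
-- `capIdeal`, which `p` kills.
theorem eq_zero_of_gen_mul_eq_zero {x : TL n δ}
    (hx : tlRep v hε hδ n x = 0)
    (h : ∀ i < n - 1, ∀ y, TL.genNat n δ i * (y * x) = 0) : x = 0 := by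
  set p := jonesWenzl (jwCoeff v ε) (TL.genNat n δ) (n - 1) with hp
  obtain ⟨-, hspec, -⟩ := (TL.isTLFamily n δ).jonesWenzl_spec (hδ ▸ jwCoeff_zero v hv hε)
    (hδ ▸ jwCoeff_succ v hv hε) (n - 1) le_rfl
  rw [← hp] at hspec
  have hJ : ∀ z ∈ capIdeal 𝕜 (n - 1) (TL.genNat n δ), z * x = 0 ∧ p * z = 0 := by
    intro z hz
    induction hz using Submodule.span_induction with
    | zero => simp
    | add a b _ _ ha hb => rw [add_mul, mul_add, ha.1, ha.2, hb.1, hb.2]; simp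
    | smul c a _ ha => rw [smul_mul_assoc, mul_smul_comm, ha.1, ha.2]; simp
    | mem z hz =>
      obtain ⟨i, hi, a, b, rfl⟩ := hz
      constructor
      · rw [mul_assoc, mul_assoc, h i hi, mul_zero]
      · obtain ⟨c, hc⟩ : ∃ c : 𝕜, p * a = c • p := by
          refine TL.induction (p := fun a => ∃ c : 𝕜, p * a = c • p) ?_ ?_ ?_ ?_ a
          · exact fun c => ⟨c, by rw [← Algebra.commutes, ← Algebra.smul_def]⟩
          · rintro x y ⟨c, hc⟩ ⟨d, hd⟩
            exact ⟨c + d, by rw [mul_add, hc, hd, add_smul]⟩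
          · rintro x y ⟨c, hc⟩ ⟨d, hd⟩
            exact ⟨c * d, by rw [← mul_assoc, hc, smul_mul_assoc, hd, smul_smul]⟩
          · intro j
            refine ⟨0, ?_⟩
            have := (hspec j j.2).2
            rwa [TL.genNat, dif_pos j.2, ← zero_smul 𝕜 p] at this
        rw [← mul_assoc, ← mul_assoc, hc, smul_mul_assoc, (hspec i hi).2]
        simp
  have hpx : p * x = x := by
    have := (hJ _ (jonesWenzl_sub_one_mem (jwCoeff v ε) (TL.genNat n δ) le_rfl)).1
    rwa [← hp, sub_mul, one_mul, sub_eq_zero] at this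
  obtain ⟨c, hc⟩ := TL.exists_sub_algebraMap_mem x
  have h0 := tlRep_topVec hε hδ hc
  rw [map_sub, hx, AlgHom.commutes, zero_sub, LinearMap.neg_apply, Module.algebraMap_end_apply,
    neg_eq_zero] at h0
  have hc0 := (smul_eq_zero.1 h0).resolve_right topVec_ne_zero
  rw [hc0, map_zero, sub_zero] at hc
  rw [← hpx, (hJ _ hc).2]

include hv in
-- Write `φ = p φ - (p - 1) φ`. The second term is covered by the hypothesis, and `p φ = c p`, where
-- `c` is the scalar by which `φ` acts on the top vector.
theorem exists_tlRep_eq_of_capIdeal_mul {φ : Module.End 𝕜 (Coord 𝕜 n)}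
    (hφ : φ ∈ endAlg (UCoord v hv n))
    (h : ∀ z ∈ capIdeal 𝕜 (n - 1) (TL.genNat n δ),
      ∃ a, tlRep v hε hδ n a = tlRep v hε hδ n z * φ) : ∃ a, tlRep v hε hδ n a = φ := by
  set p := jonesWenzl (jwCoeff v ε) (TL.genNat n δ) (n - 1) with hp
  obtain ⟨-, hspec, -⟩ := (TL.isTLFamily n δ).jonesWenzl_spec (hδ ▸ jwCoeff_zero v hv hε)
    (hδ ▸ jwCoeff_succ v hv hε) (n - 1) le_rfl
  rw [← hp] at hspec
  have hφ' := mem_endAlg_iff.1 hφ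
  obtain ⟨c, hc⟩ : ∃ c : 𝕜, φ (topVec 𝕜 n) = c • topVec 𝕜 n := by
    refine ⟨_, eq_smul_topVec hv ?_⟩
    rw [← hφ', (mem_highestWeight.1 (topVec_mem hv)).2, map_smul]
  -- The difference commutes with `U`, takes values killed by all caps, and vanishes on the top
  -- vector.
  have hg : tlRep v hε hδ n p * φ - c • tlRep v hε hδ n p = 0 := by
    refine eq_zero_of_range_le_capKer hv hε (sub_mem (mul_mem (tlRep_mem_endAlg v hε hδ n hv p) hφ)
      (Subalgebra.smul_mem _ (tlRep_mem_endAlg v hε hδ n hv p) c)) (fun f => ?_) ?_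
    · refine mem_capKer.2 fun i => ?_
      have : ∀ f, capCup v ε (lo i) (hi i) (tlRep v hε hδ n p f) = 0 := by
        intro f
        have := congrArg (fun z => tlRep v hε hδ n z f) (hspec i i.2).1
        simpa [tlRep_genNat v hε hδ n i.2] using this
      simp [this]
    · simp [hc]
  obtain ⟨a, ha⟩ := h _ (jonesWenzl_sub_one_mem (jwCoeff v ε) (TL.genNat n δ) le_rfl)
  refine ⟨c • p - a, ?_⟩
  rw [map_sub, map_smul, ha, ← sub_eq_zero.1 hg, ← hp, map_sub, map_one, sub_mul, one_mul]
  abel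

theorem slice_capCup_last_eq_zero {m : ℕ} {f : Coord 𝕜 (m + 2)} (hε : ε * ε = 1)
    (h : capCup v ε (Fin.last m).castSucc (Fin.last (m + 1)) f = 0) : lastCap 𝕜 m v f = 0 := by
  have hε0 : ε ≠ 0 := left_ne_zero_of_mul_eq_one hε
  have := slice_capCup_last v ε 0 1 f
  rw [h, map_zero, map_zero, if_neg (by simp), eq_comm, smul_eq_zero] at this
  exact this.resolve_left (mul_ne_zero hε0 (cupCoeff_ne_zero v _))

/-- The part of `φ` seen by the last cap, bent into an endomorphism of a shorter tensor power. -/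
noncomputable def bend {m : ℕ} (v : 𝕜ˣ) (φ : Module.End 𝕜 (Coord 𝕜 (m + 2))) :
    Module.End 𝕜 (Coord 𝕜 (m + 1)) :=
  addLast 𝕜 m 0 ∘ₗ lastCap 𝕜 m v ∘ₗ φ ∘ₗ addLast 𝕜 (m + 1) 1 -
    (v : 𝕜)⁻¹ • (addLast 𝕜 m 1 ∘ₗ lastCap 𝕜 m v ∘ₗ φ ∘ₗ addLast 𝕜 (m + 1) 0)

theorem slice_bend {m : ℕ} (v : 𝕜ˣ) (φ : Module.End 𝕜 (Coord 𝕜 (m + 2))) (b : Fin 2)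
    (t : Coord 𝕜 (m + 1)) : slice 𝕜 m b (bend v φ t) =
      if b = 0 then lastCap 𝕜 m v (φ (addLast 𝕜 (m + 1) 1 t))
      else -(v : 𝕜)⁻¹ • lastCap 𝕜 m v (φ (addLast 𝕜 (m + 1) 0 t)) := by
  rcases fin_two_cases b with rfl | rfl <;> simp [bend, slice_addLast]

theorem UCoord_addLast {m : ℕ} (t : Coord 𝕜 m) :
    addLast 𝕜 m 0 (UCoord v hv m (Uq.gen v .E) t) =
      UCoord v hv (m + 1) (Uq.gen v .E) (addLast 𝕜 m 0 t) ∧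
    addLast 𝕜 m 1 (UCoord v hv m (Uq.gen v .E) t) =
      UCoord v hv (m + 1) (Uq.gen v .E) (addLast 𝕜 m 1 t) -
        addLast 𝕜 m 0 (UCoord v hv m (Uq.gen v .K) t) ∧
    addLast 𝕜 m 0 (UCoord v hv m (Uq.gen v .F) t) =
      (v : 𝕜) • (UCoord v hv (m + 1) (Uq.gen v .F) (addLast 𝕜 m 0 t) - addLast 𝕜 m 1 t) ∧
    addLast 𝕜 m 1 (UCoord v hv m (Uq.gen v .F) t) =
      (v : 𝕜)⁻¹ • UCoord v hv (m + 1) (Uq.gen v .F) (addLast 𝕜 m 1 t) ∧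
    addLast 𝕜 m 0 (UCoord v hv m (Uq.gen v .K) t) =
      (v : 𝕜)⁻¹ • UCoord v hv (m + 1) (Uq.gen v .K) (addLast 𝕜 m 0 t) ∧
    addLast 𝕜 m 1 (UCoord v hv m (Uq.gen v .K) t) =
      (v : 𝕜) • UCoord v hv (m + 1) (Uq.gen v .K) (addLast 𝕜 m 1 t) := by
  refine ⟨?_, ?_, ?_, ?_, ?_, ?_⟩ <;> refine slice_ext fun b => ?_ <;>
    rcases fin_two_cases b with rfl | rfl <;>
    simp [slice_addLast, slice_E, slice_F, slice_K, smul_smul]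

/-- Up to sign, `bend v φ` inserts a cup to the right of `t`, applies `φ` to all but the last factor
and contracts the last two of these. Each of these operations is a map of `U`-modules; here this is
checked on slices. -/
theorem bend_mem_endAlg {m : ℕ} {φ : Module.End 𝕜 (Coord 𝕜 (m + 2))}
    (hφ : φ ∈ endAlg (UCoord v hv (m + 2))) : bend v φ ∈ endAlg (UCoord v hv (m + 1)) := by
  rw [mem_endAlg_iff] at hφ ⊢
  refine Uq_intertwines _ _ _ ?_ ?_ ?_ <;> intro t <;>
    obtain ⟨h1, h2, h3, h4, h5, h6⟩ := UCoord_addLast hv t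
  · have h2' := h2
    rw [h5] at h2'
    refine slice_ext fun b => ?_
    rw [slice_E, slice_bend, slice_bend, slice_bend, h1, h2']
    rcases fin_two_cases b with rfl | rfl <;> simp [hφ, lastCap_UCoord, sub_eq_add_neg]
  · refine slice_ext fun b => ?_
    rw [slice_F, slice_bend, slice_bend, slice_bend, h3, h4]
    rcases fin_two_cases b with rfl | rfl
    · simp [hφ, lastCap_UCoord]
    · simp [hφ, lastCap_UCoord, smul_sub, smul_smul]
  · refine slice_ext fun b => ?_
    rw [slice_K, slice_bend, slice_bend, h5, h6]
    rcases fin_two_cases b with rfl | rfl <;> simp [hφ, lastCap_UCoord, smul_smul]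

/-- Bending back straightens the zigzag. The sign chosen in `bend` compensates for the `-1` that
this costs. -/
theorem lastCap_bend {m : ℕ} (φ : Module.End 𝕜 (Coord 𝕜 (m + 2)))
    {ψ : Module.End 𝕜 (Coord 𝕜 (m + 2))}
    (hψ : ∀ b f, slice 𝕜 (m + 1) b (ψ f) = bend v φ (slice 𝕜 (m + 1) b f))
    (f : Coord 𝕜 (m + 2)) : lastCap 𝕜 m v (ψ f) = lastCap 𝕜 m v (φ f) := by
  conv_rhs => rw [eq_addLast f]
  simp only [lastCap, LinearMap.sub_apply, LinearMap.smul_apply, LinearMap.comp_apply, hψ,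
    slice_bend, if_true, one_ne_zero, if_false, map_add]
  simp [smul_smul, smul_sub, smul_add]
  abel

theorem tlRep_bijective (n : ℕ) :
    (∀ x, tlRep v hε hδ n x = 0 → x = 0) ∧
      ∀ φ ∈ endAlg (UCoord v hv n), ∃ a, tlRep v hε hδ n a = φ := by
  have base : ∀ n, n - 1 = 0 → (∀ x, tlRep v hε hδ n x = 0 → x = 0) ∧
      ∀ φ ∈ endAlg (UCoord v hv n), ∃ a, tlRep v hε hδ n a = φ := by
    intro n hn
    refine ⟨fun x hx => eq_zero_of_gen_mul_eq_zero hv hε hδ hx (by omega), fun φ hφ =>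
      exists_tlRep_eq_of_capIdeal_mul hv hε hδ hφ fun z hz => ⟨0, ?_⟩⟩
    have : z = 0 := by
      have hb : capIdeal 𝕜 (n - 1) (TL.genNat n δ) = ⊥ := by
        simp [capIdeal, hn]
      rw [hb] at hz
      simpa using hz
    rw [this]; simp
  rcases n with _ | n
  · exact base 0 rfl
  induction n with
  | zero => exact base 1 rfl
  | succ m ih =>
    obtain ⟨hinj, hsurj⟩ := ih
    have hfam := TL.isTLFamily (m + 2) δ
    -- By `e i = e i * e (i + 1) * e i`, the last generator alone generates the ideal, so only this
    -- generator has to be treated.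
    have hdown : ∀ i < m + 1, ∃ a b : TL (m + 2) δ,
        TL.genNat (m + 2) δ i = a * TL.genNat (m + 2) δ m * b := by
      intro i hi
      induction Nat.le_of_lt_succ hi using Nat.decreasingInduction with
      | self => exact ⟨1, 1, by simp⟩
      | of_succ i hi' ih =>
        obtain ⟨a, b, h⟩ := ih (by omega)
        refine ⟨TL.genNat (m + 2) δ i * a, b * TL.genNat (m + 2) δ i, ?_⟩
        refine (hfam.up i (by omega)).symm.trans ?_
        rw [h]
        simp only [mul_assoc]
    have hlast : ∀ x : TL (m + 2) δ, ∃ y : TL (m + 1) δ,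
        TL.genNat (m + 2) δ m * x = TL.genNat (m + 2) δ m * TL.incl (m + 1) δ y := by
      intro x
      obtain ⟨b, hb, h⟩ := hfam.exists_last_mul (m := m) (by omega) (TL.mem_initialAlg x)
      obtain ⟨y, rfl⟩ := TL.exists_incl_eq (m + 1) δ hb
      exact ⟨y, h⟩
    constructor
    · intro x hx
      have hm : ∀ y, TL.genNat (m + 2) δ m * (y * x) = 0 := by
        intro y
        obtain ⟨z, hz⟩ := hlast (y * x)
        have h0 : ∀ f, lastCap 𝕜 m v (tlRep v hε hδ (m + 2) (TL.incl (m + 1) δ z) f) = 0 := by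
          intro f
          refine slice_capCup_last_eq_zero (ε := ε) hε ?_
          rw [← tlRep_last v hε hδ m, ← Module.End.mul_apply, ← map_mul, ← hz, map_mul, map_mul, hx]
          simp
        -- Capping `t ⊗ x₁` and `t ⊗ x₀` reads off, up to a unit, the two slices of `z t`, so `z`
        -- acts by zero on the shorter tensor power.
        have hz0 : z = 0 := by
          refine hinj z (LinearMap.ext fun t => slice_ext fun b => ?_)
          have h1 := h0 (addLast 𝕜 (m + 1) 1 t)
          have h2 := h0 (addLast 𝕜 (m + 1) 0 t)
          simp only [lastCap, LinearMap.sub_apply, LinearMap.smul_apply, LinearMap.comp_apply,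
            slice_tlRep_incl, slice_addLast] at h1 h2
          rcases fin_two_cases b with rfl | rfl
          · simpa using h1
          · simpa using h2
        rw [hz, hz0, map_zero, mul_zero]
      refine eq_zero_of_gen_mul_eq_zero hv hε hδ hx fun i hi y => ?_
      obtain ⟨a, b, h⟩ := hdown i hi
      rw [h, mul_assoc, ← mul_assoc b, mul_assoc, hm, mul_zero]
    · intro φ hφ
      have hm : ∀ φ ∈ endAlg (UCoord v hv (m + 2)), ∃ a, tlRep v hε hδ (m + 2) a =
          tlRep v hε hδ (m + 2) (TL.genNat (m + 2) δ m) * φ := by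
        intro φ hφ
        -- By induction the bent endomorphism comes from some `y`. Then `y` followed by the last
        -- cup-cap agrees with `φ` followed by it, since only `lastCap` of the argument matters.
        obtain ⟨y, hy⟩ := hsurj _ (bend_mem_endAlg hv hφ)
        refine ⟨TL.genNat (m + 2) δ m * TL.incl (m + 1) δ y, ?_⟩
        refine LinearMap.ext fun f => slice_ext fun c => slice_ext fun b => ?_
        rw [map_mul, Module.End.mul_apply, Module.End.mul_apply, tlRep_last v hε hδ m,
          slice_capCup_last, slice_capCup_last,
          lastCap_bend φ fun b f => by rw [slice_tlRep_incl, hy]]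
      refine exists_tlRep_eq_of_capIdeal_mul hv hε hδ hφ fun z hz => ?_
      induction hz using Submodule.span_induction with
      | zero => exact ⟨0, by simp⟩
      | add x y _ _ hx hy =>
        obtain ⟨a, ha⟩ := hx
        obtain ⟨b, hb⟩ := hy
        exact ⟨a + b, by rw [map_add, ha, hb, map_add, add_mul]⟩
      | smul c x _ hx =>
        obtain ⟨a, ha⟩ := hx
        exact ⟨c • a, by rw [map_smul, ha, map_smul, smul_mul_assoc]⟩
      | mem z hz =>
        obtain ⟨i, hi, a, b, rfl⟩ := hz
        obtain ⟨a', b', h⟩ := hdown i hi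
        obtain ⟨y, hy⟩ := hm (tlRep v hε hδ (m + 2) (b' * b) * φ)
          (mul_mem (tlRep_mem_endAlg v hε hδ _ hv _) hφ)
        refine ⟨a * a' * y, ?_⟩
        rw [h]
        simp only [map_mul, hy, mul_assoc]

end Bijective

end SchurWeyl

/-! ## Half-diagrams as highest weight vectors -/

namespace SchurWeyl

/-! ### Combinatorics of half-diagrams. -/

section Combinatorics

variable {n : ℕ} {σ : Fin n → Fin n}

theorem lo_lt_hi (i : Fin (n - 1)) : lo i < hi i := Fin.lt_def.2 (by simp [lo, hi])

theorem stack_lo (i : Fin (n - 1)) (σ : Fin n → Fin n) : stack i σ (lo i) = hi i := by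
  simp [stack]

theorem stack_hi (i : Fin (n - 1)) (σ : Fin n → Fin n) : stack i σ (hi i) = lo i := by
  simp [stack, (lo_lt_hi i).ne']

set_option maxHeartbeats 1000000 in
theorem IsHalfDiagram.stack {σ : Fin n → Fin n} (h : IsHalfDiagram σ) {i : Fin (n - 1)}
    (hi' : σ (lo i) ≠ hi i) : IsHalfDiagram (stack i σ) := by
  have hlt : (hi i : ℕ) = lo i + 1 := rfl
  obtain ⟨h1, h2⟩ := h
  constructor
  · intro a
    simp only [SchurWeyl.stack]
    grind
  · intro a b hab hb
    have key : ∀ x y, σ x = y ↔ x = σ y := by grind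
    have hinj : ∀ x y, σ x = σ y ↔ x = y := by grind
    have i1 := key a (lo i)
    have i2 := key a (hi i)
    have i3 := key b (lo i)
    have i4 := key b (hi i)
    have i5 := key a b
    have i6 := key (lo i) (hi i)
    have j1 := hinj a (lo i)
    have j2 := hinj a (hi i)
    have j3 := hinj b (lo i)
    have j4 := hinj b (hi i)
    have j5 := hinj a b
    -- Planarity of `σ` is used only for pairs formed from `a`, `b`, the two stacked vertices and
    -- their partners; what remains is a finite case check on the order of these vertices.
    have ha1 := h2 a b
    have ha2 := h2 b a
    have hla := h2 (lo i) a
    have hlb := h2 (lo i) b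
    have hha := h2 (hi i) a
    have hhb := h2 (hi i) b
    have hal := h2 a (lo i)
    have hah := h2 a (hi i)
    have hbl := h2 b (lo i)
    have hbh := h2 b (hi i)
    have hlh := h2 (lo i) (hi i)
    have hhl := h2 (hi i) (lo i)
    have hca := h2 (σ (lo i)) a
    have hcb := h2 (σ (lo i)) b
    have hda := h2 (σ (hi i)) a
    have hdb := h2 (σ (hi i)) b
    have hch := h2 (σ (lo i)) (hi i)
    have hdl := h2 (σ (hi i)) (lo i)
    have hcb2 := h2 (σ (lo i)) (σ b)
    have hrb2 := h2 (hi i) (σ b)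
    simp only [h1] at hca hcb hda hdb hch hdl hcb2 hrb2
    simp only [SchurWeyl.stack] at *
    clear key hinj h1 h2
    generalize σ a = a' at *
    generalize σ b = b' at *
    generalize σ (lo i) = c at *
    generalize σ (hi i) = d at *
    generalize lo i = l at *
    generalize hi i = r at *
    simp only [Fin.lt_def, Fin.ext_iff, ne_eq] at *
    split_ifs at hb ⊢ <;> grind

/-- The vertices strictly under a link are permuted by `σ` without fixed points, so the sum cancels
in pairs. -/
theorem IsHalfDiagram.sum_Ioo {R : Type*} [AddCommMonoid R] (h : IsHalfDiagram σ) (a : Fin n)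
    {f : Fin n → R} (hf : ∀ c ∈ Finset.Ioo a (σ a), f c + f (σ c) = 0) :
    ∑ c ∈ Finset.Ioo a (σ a), f c = 0 := by
  have key : ∀ c ∈ Finset.Ioo a (σ a), a < σ c ∧ σ c < σ a ∧ σ c ≠ c := fun c hc =>
    h.2 a c (Finset.mem_Ioo.1 hc).1 (Finset.mem_Ioo.1 hc).2
  exact Finset.sum_involution (fun c _ => σ c) (fun c hc => hf c hc)
    (fun c hc _ => (key c hc).2.2) (fun c hc => Finset.mem_Ioo.2 ⟨(key c hc).1, (key c hc).2.1⟩)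
    fun c _ => h.1 c

/-- The number of vertices under a link is even: this is `sum_Ioo` for the constant `1` modulo two.
-/
theorem IsHalfDiagram.odd_add (h : IsHalfDiagram σ) {a : Fin n} (ha : a < σ a) :
    Odd ((a : ℕ) + σ a) := by
  have := h.sum_Ioo a (f := fun _ => (1 : ZMod 2)) fun c _ => by decide
  rw [Finset.sum_const, Fin.card_Ioo, nsmul_one, ZMod.natCast_eq_zero_iff_even] at this
  have ha' : (a : ℕ) < σ a := ha
  obtain ⟨r, hr⟩ := this
  exact ⟨a + r, by omega⟩

/-- A half-diagram is determined by the right endpoints of its links. -/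
theorem IsHalfDiagram.ext {τ : Fin n → Fin n} (hσ : IsHalfDiagram σ) (hτ : IsHalfDiagram τ)
    (h : ∀ a, σ a < a ↔ τ a < a) : σ = τ := by
  have key : ∀ b, σ b < b → σ b = τ b := by
    intro b
    induction b using WellFoundedLT.induction with
    | _ b ih =>
      -- If the `σ`-link to `b` starts further left, then `τ b` lies under it, and its `σ`-partner
      -- is a right endpoint before `b`. By induction that partner is also the `τ`-partner of `τ b`,
      -- which is `b`, a contradiction.
      have wlog : ∀ σ τ : Fin n → Fin n, IsHalfDiagram σ → IsHalfDiagram τ →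
          (∀ a, σ a < a ↔ τ a < a) → (∀ c < b, σ c < c → σ c = τ c) → σ b < τ b → τ b < b →
          False := by
        intro σ τ hσ hτ h ih h1 h2
        obtain ⟨h3, h4, h5⟩ := hσ.2 (σ b) (τ b) h1 (by rwa [hσ.1])
        rw [hσ.1] at h4
        have h6 : ¬ σ (τ b) < τ b := by rw [h, hτ.1]; exact h2.not_gt
        have h7 : τ b < σ (τ b) := lt_of_le_of_ne (not_lt.1 h6) h5.symm
        have h8 := ih (σ (τ b)) h4 (by rwa [hσ.1])
        rw [hσ.1] at h8
        have h9 := congrArg τ h8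
        rw [hτ.1, hτ.1] at h9
        exact h4.ne h9.symm
      intro hb
      rcases lt_trichotomy (σ b) (τ b) with h1 | h1 | h1
      · exact (wlog σ τ hσ hτ h ih h1 ((h b).1 hb)).elim
      · exact h1
      · exact (wlog τ σ hτ hσ (fun a => (h a).symm)
          (fun c hc hc' => (ih c hc ((h c).2 hc')).symm) h1 hb).elim
  have key' : ∀ σ τ : Fin n → Fin n, IsHalfDiagram σ → IsHalfDiagram τ →
      (∀ b, σ b < b → σ b = τ b) → ∀ a, a < σ a → σ a = τ a := by
    intro σ τ hσ hτ h a ha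
    have := h (σ a) (by rwa [hσ.1])
    rw [hσ.1] at this
    conv_rhs => rw [this]
    rw [hτ.1]
  funext a
  rcases lt_trichotomy (σ a) a with h1 | h1 | h1
  · exact key a h1
  · rcases lt_trichotomy (τ a) a with h2 | h2 | h2
    · exact key a ((h a).2 h2)
    · rw [h1, h2]
    · exact (key' τ σ hτ hσ (fun b hb => (key b ((h b).2 hb)).symm) a h2).symm
  · exact key' σ τ hσ hτ key a h1

theorem defects_stack_lt (i : Fin (n - 1)) (hl : σ (lo i) = lo i) (hr : σ (hi i) = hi i)
    (hσ : ∀ a, σ (σ a) = a) : defects (stack i σ) < defects σ := by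
  refine Finset.card_lt_card (Finset.ssubset_iff_subset_ne.2 ⟨fun a ha => ?_, fun h => ?_⟩)
  · simp only [Finset.mem_filter, Finset.mem_univ, true_and] at ha ⊢
    have := lo_lt_hi i
    simp only [stack] at ha
    grind
  · have h1 : lo i ∈ Finset.univ.filter fun a => σ a = a := by simpa using hl
    rw [← h] at h1
    simp [stack_lo, (lo_lt_hi i).ne'] at h1

theorem exists_halfDiagram {k : ℕ} (hk : k ∈ Lam n) : Nonempty (HalfDiagram n k) := by
  simp only [Lam, Finset.mem_image, Finset.mem_range] at hk
  obtain ⟨p, hp, rfl⟩ := hk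
  -- The first `2 p` vertices are linked in neighbouring pairs and the others are defects.
  refine ⟨⟨fun a => if h : (a : ℕ) < 2 * p then
    ⟨if (a : ℕ) % 2 = 0 then a + 1 else a - 1, by split_ifs <;> omega⟩ else a, ⟨?_, ?_⟩, ?_⟩⟩
  · intro a
    ext
    grind
  · intro a b hab hb
    simp only [Fin.lt_def] at hab hb
    grind
  · have : ∀ a : Fin n, ((if h : (a : ℕ) < 2 * p then (⟨if (a : ℕ) % 2 = 0 then a + 1 else a - 1,
        by split_ifs <;> omega⟩ : Fin n) else a) = a) ↔ 2 * p ≤ (a : ℕ) := by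
      intro a
      rw [Fin.ext_iff]
      grind
    simp only [defects, this]
    rw [← Fintype.card_subtype]
    have e : {a : Fin n // 2 * p ≤ (a : ℕ)} ≃ Fin (n - 2 * p) :=
      { toFun := fun a => ⟨a.1 - 2 * p, by have := a.1.2; have := a.2; omega⟩
        invFun := fun b => ⟨⟨b + 2 * p, by have := b.2; omega⟩, by simp⟩
        left_inv := fun a => by ext; have := a.2; simp; omega
        right_inv := fun b => by ext; simp }
    rw [Fintype.card_congr e, Fintype.card_fin]

end Combinatorics

/-! ### The tensor of a half-diagram and the diagram rule. -/

section DiagVec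

variable {𝕜 : Type*} [Field 𝕜] (v : 𝕜ˣ) (ε : 𝕜) {n : ℕ}

/-- The factor of a coordinate of `diagVec` contributed by the vertex `a`. -/
def vertexCoeff (σ : Fin n → Fin n) (s : Fin n → Fin 2) (a : Fin n) : 𝕜 :=
  if σ a = a then (if s a = 0 then 1 else 0)
  else if a < σ a then (if s a = s (σ a) then 0 else (-ε) ^ (a : ℕ) * cupCoeff v (s a))
  else 1

/-- The tensor of a half-diagram: up to signs, the product of an invariant vector for each link
and of `x₀` for each defect. -/
def diagVec (σ : Fin n → Fin n) : Coord 𝕜 n := fun s => ∏ a, vertexCoeff v ε σ s a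

theorem diagVec_eq_mul (B : Finset (Fin n)) {σ τ : Fin n → Fin n} {s t : Fin n → Fin 2}
    (h : ∀ a ∉ B, τ a = σ a ∧ t a = s a ∧ t (σ a) = s (σ a)) :
    diagVec v ε τ t = (∏ a ∈ B, vertexCoeff v ε τ t a) * ∏ a ∈ Bᶜ, vertexCoeff v ε σ s a := by
  rw [diagVec, ← Finset.prod_mul_prod_compl B]
  congr 1
  refine Finset.prod_congr rfl fun a ha => ?_
  obtain ⟨h1, h2, h3⟩ := h a (Finset.mem_compl.1 ha)
  simp only [vertexCoeff, h1, h2, h3]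

variable {v ε} (hε : ε * ε = 1)

include hε in
-- The endpoints of a link have opposite parity, so transferring its sign from one endpoint to the
-- other costs `-ε`. This matches the factor `-ε` that appears when a zigzag is straightened.
theorem neg_pow_of_odd {a b : ℕ} (h : Odd (a + b)) : (-ε) ^ a = -ε * (-ε) ^ b := by
  have h2 : ∀ m : ℕ, (-ε) ^ (m + m) = 1 := fun m => by
    rw [pow_add, ← mul_pow, neg_mul_neg, hε, one_pow]
  obtain ⟨m, hm⟩ := h
  have h3 := h2 b
  have h4 := h2 m
  have h5 : (-ε) ^ a * (-ε) ^ b = -ε := by rw [← pow_add, hm, two_mul, pow_succ, h4, one_mul]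
  rw [pow_add] at h3
  calc (-ε) ^ a = (-ε) ^ a * ((-ε) ^ b * (-ε) ^ b) := by rw [h3, mul_one]
    _ = _ := by rw [← mul_assoc, h5]

theorem prod_three {ι R : Type*} [DecidableEq ι] [CommMonoid R] {a b c : ι} (hab : a ≠ b)
    (hac : a ≠ c) (hbc : b ≠ c) (f : ι → R) : ∏ x ∈ {a, b, c}, f x = f a * (f b * f c) := by
  rw [Finset.prod_insert (by simp [hab, hac]), Finset.prod_pair hbc]

theorem prod_four {ι R : Type*} [DecidableEq ι] [CommMonoid R] {a b c d : ι} (hab : a ≠ b)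
    (hac : a ≠ c) (had : a ≠ d) (hbc : b ≠ c) (hbd : b ≠ d) (hcd : c ≠ d) (f : ι → R) :
    ∏ x ∈ {a, b, c, d}, f x = f a * (f b * (f c * f d)) := by
  rw [Finset.prod_insert (by simp [hab, hac, had]), prod_three hbc hbd hcd]

/-- Comparison of `capCup (diagVec σ)` and `diagVec τ` on the vertices where they differ. -/
theorem capCup_diagVec_eq_smul {σ τ : Fin n → Fin n} (hσ : ∀ a, σ (σ a) = a) {i : Fin (n - 1)}
    {q : 𝕜} (B : Finset (Fin n)) (hB : B = {lo i, hi i, σ (lo i), σ (hi i)})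
    (hτ : ∀ a ∉ B, τ a = σ a)
    (h : ∀ s : Fin n → Fin 2, (if s (lo i) = s (hi i) then 0 else ε * cupCoeff v (s (lo i)) *
      ((∏ a ∈ B, vertexCoeff v ε σ (setPair s (lo i) (hi i) 0 1) a) -
        v * ∏ a ∈ B, vertexCoeff v ε σ (setPair s (lo i) (hi i) 1 0) a)) =
      q * ∏ a ∈ B, vertexCoeff v ε τ s a) :
    capCup v ε (lo i) (hi i) (diagVec v ε σ) = q • diagVec v ε τ := by
  ext s
  have key : ∀ t : Fin n → Fin 2, (∀ a, a ≠ lo i → a ≠ hi i → t a = s a) →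
      ∀ π : Fin n → Fin n, (∀ a ∉ B, π a = σ a) →
      diagVec v ε π t = (∏ a ∈ B, vertexCoeff v ε π t a) *
        ∏ a ∈ Bᶜ, vertexCoeff v ε σ s a := by
    intro t ht π hπ
    refine diagVec_eq_mul v ε _ fun a ha => ?_
    refine ⟨hπ a ha, ?_⟩
    simp only [hB, Finset.mem_insert, Finset.mem_singleton, not_or] at ha
    refine ⟨ht a ha.1 ha.2.1, ht _ (fun h => ha.2.2.1 ?_) (fun h => ha.2.2.2 ?_)⟩ <;>
      rw [← h, hσ]
  rw [capCup_apply, capAt, Pi.smul_apply, smul_eq_mul, key s (fun _ _ _ => rfl) τ hτ,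
    key (setPair s _ _ 0 1) (fun a h1 h2 => setPair_of_ne h1 h2 _ _ _) σ fun _ _ => rfl,
    key (setPair s _ _ 1 0) (fun a h1 h2 => setPair_of_ne h1 h2 _ _ _) σ fun _ _ => rfl,
    ← mul_assoc q, ← h s]
  split_ifs
  · rw [zero_mul]
  · ring

theorem capCup_diagVec_of_linked {σ : Fin n → Fin n} (hσ : IsHalfDiagram σ) {i : Fin (n - 1)}
    (h : σ (lo i) = hi i) :
    capCup v ε (lo i) (hi i) (diagVec v ε σ) =
      (ε * ((v : 𝕜) + (v : 𝕜)⁻¹)) • diagVec v ε σ := by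
  have hlr := lo_lt_hi i
  have h' : σ (hi i) = lo i := by rw [← h, hσ.1]
  refine capCup_diagVec_eq_smul hσ.1 {lo i, hi i} (by rw [h, h']; ext; simp; tauto)
    (fun _ _ => rfl) fun s => ?_
  simp only [Finset.prod_pair hlr.ne, vertexCoeff, h, h', setPair_left hlr.ne, setPair_right,
    hlr.ne, hlr.ne', hlr, hlr.not_gt, if_true, if_false]
  rcases fin_two_cases (s (lo i)) with h1 | h1 <;> rcases fin_two_cases (s (hi i)) with h2 | h2 <;>
    simp [h1, h2, cupCoeff] <;> ring

theorem capCup_diagVec_of_defects {σ : Fin n → Fin n} (hσ : ∀ a, σ (σ a) = a) {i : Fin (n - 1)}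
    (hl : σ (lo i) = lo i) (hr : σ (hi i) = hi i) :
    capCup v ε (lo i) (hi i) (diagVec v ε σ) = 0 := by
  have hlr := lo_lt_hi i
  rw [capCup_diagVec_eq_smul (q := 0) (τ := σ) hσ {lo i, hi i} (by rw [hl, hr]; ext; simp)
    (fun _ _ => rfl) fun s => ?_, zero_smul]
  simp [Finset.prod_pair hlr.ne, vertexCoeff, hl, hr, setPair_left hlr.ne, setPair_right]

include hε in
-- Only the two stacked vertices and their partners are affected. The cap joins two cups, or a cup
-- and a defect, along a zigzag, and the parity signs in `diagVec` absorb the resulting factor.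
theorem capCup_diagVec {σ : Fin n → Fin n} (hσ : IsHalfDiagram σ) {i : Fin (n - 1)}
    (h : σ (lo i) ≠ hi i) (hd : ¬ (σ (lo i) = lo i ∧ σ (hi i) = hi i)) :
    capCup v ε (lo i) (hi i) (diagVec v ε σ) = diagVec v ε (stack i σ) := by
  have hlr := lo_lt_hi i
  have hval : (hi i : ℕ) = lo i + 1 := rfl
  have hε' : ε = 1 ∨ ε = -1 := mul_self_eq_one_iff.1 hε
  have hB : ∀ a ∉ ({lo i, hi i, σ (lo i), σ (hi i)} : Finset (Fin n)), stack i σ a = σ a := by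
    intro a ha
    simp only [Finset.mem_insert, Finset.mem_singleton, not_or] at ha
    have h1 : σ a ≠ lo i := fun h => ha.2.2.1 (by rw [← h, hσ.1])
    have h2 : σ a ≠ hi i := fun h => ha.2.2.2 (by rw [← h, hσ.1])
    simp [stack, ha, h1, h2]
  have hsl := stack_lo i σ
  have hsr := stack_hi i σ
  have hpr : (-ε) ^ (hi i : ℕ) = -ε * (-ε) ^ (lo i : ℕ) := neg_pow_of_odd hε ⟨lo i, by omega⟩
  rw [← one_smul 𝕜 (diagVec v ε (stack i σ))]
  by_cases hl : σ (lo i) = lo i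
  · have hr : σ (hi i) ≠ hi i := fun h => hd ⟨hl, h⟩
    obtain ⟨d, hd⟩ : ∃ d, σ (hi i) = d := ⟨_, rfl⟩
    have hd' : σ d = hi i := by rw [← hd, hσ.1]
    -- The defect `lo i` cannot lie under the link of `hi i`, so the partner `d` is on the right.
    have hrd : hi i < d := by
      by_contra hno
      have h1 : d < lo i := by
        have : d ≠ hi i := by rwa [← hd]
        have : d ≠ lo i := fun h => by rw [h] at hd'; exact hlr.ne (hl.symm.trans hd')
        omega
      exact (hσ.2 d (lo i) h1 (by rwa [hd'])).2.2 hl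
    have hld := hlr.trans hrd
    have hsd : stack i σ d = d := by simp [stack, hld.ne', hrd.ne', hd', hlr.ne', hl]
    refine capCup_diagVec_eq_smul hσ.1 {lo i, hi i, d} (by rw [hl, hd]; ext; simp; tauto)
      (fun a ha => hB a (by rw [hl, hd]; simp at ha ⊢; tauto)) fun s => ?_
    rw [prod_three hlr.ne hld.ne hrd.ne, prod_three hlr.ne hld.ne hrd.ne,
      prod_three hlr.ne hld.ne hrd.ne]
    simp only [vertexCoeff, hl, hd, hd', hsl, hsr, hsd, setPair_left hlr.ne, setPair_right,
      setPair_of_ne hld.ne' hrd.ne', hlr, hrd, hlr.ne, hlr.ne', hrd.ne, hrd.ne', hlr.not_gt,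
      hrd.not_gt, if_true, if_false, hpr]
    rcases hε' with rfl | rfl <;> rcases fin_two_cases (s (lo i)) with h1 | h1 <;>
      rcases fin_two_cases (s (hi i)) with h2 | h2 <;> rcases fin_two_cases (s d) with h3 | h3 <;>
      simp [h1, h2, h3, cupCoeff, mul_comm]
  · obtain ⟨c, hc⟩ : ∃ c, σ (lo i) = c := ⟨_, rfl⟩
    have hc' : σ c = lo i := by rw [← hc, hσ.1]
    have hcl : c ≠ lo i := by rwa [← hc]
    have hcr : c ≠ hi i := by rwa [← hc]
    by_cases hr : σ (hi i) = hi i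
    · have hcl : c < lo i := by
        by_contra hno
        exact (hσ.2 (lo i) (hi i) hlr (by rw [hc]; omega)).2.2 hr
      have hcr := hcl.trans hlr
      have hsc : stack i σ c = c := by simp [stack, hcl.ne, hcr.ne, hc', hr]
      have hpc : (-ε) ^ (c : ℕ) = -ε * (-ε) ^ (lo i : ℕ) :=
        neg_pow_of_odd hε (by have := hσ.odd_add (a := c) (by rwa [hc']); rwa [hc'] at this)
      refine capCup_diagVec_eq_smul hσ.1 {lo i, hi i, c} (by rw [hc, hr]; ext; simp; tauto)
        (fun a ha => hB a (by rw [hc, hr]; simp at ha ⊢; tauto)) fun s => ?_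
      rw [prod_three hlr.ne hcl.ne' hcr.ne', prod_three hlr.ne hcl.ne' hcr.ne',
        prod_three hlr.ne hcl.ne' hcr.ne']
      simp only [vertexCoeff, hc, hc', hr, hsl, hsr, hsc, setPair_left hlr.ne, setPair_right,
        setPair_of_ne hcl.ne hcr.ne, hlr, hcl, hlr.ne, hlr.ne', hcl.ne, hcl.ne', hlr.not_gt,
        hcl.not_gt, if_true, if_false, hpr, hpc]
      rcases hε' with rfl | rfl <;> rcases fin_two_cases (s (lo i)) with h1 | h1 <;>
        rcases fin_two_cases (s (hi i)) with h2 | h2 <;> rcases fin_two_cases (s c) with h3 | h3 <;>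
        simp [h1, h2, h3, cupCoeff, mul_comm]
    obtain ⟨d, hd⟩ : ∃ d, σ (hi i) = d := ⟨_, rfl⟩
    have hd' : σ d = hi i := by rw [← hd, hσ.1]
    have hdr : d ≠ hi i := by rwa [← hd]
    have hdl : d ≠ lo i := fun h => hcr (by rw [← hc, ← h, hd'])
    have hcd : c ≠ d := fun h => hlr.ne (by rw [← hc', ← hd', h])
    have hsc : stack i σ c = d := by simp [stack, hcl, hcr, hc', hd, hdr]
    have hsd : stack i σ d = c := by simp [stack, hdl, hdr, hd', hlr.ne', hc, hcl]
    have hodd : ∀ {a b}, σ a = b → a ≠ b → (-ε) ^ (a : ℕ) = -ε * (-ε) ^ (b : ℕ) := by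
      intro a b hab hne
      refine neg_pow_of_odd hε ?_
      rcases lt_or_gt_of_ne hne with h | h
      · have := hσ.odd_add (a := a) (by rwa [hab])
        rwa [hab] at this
      · have hba : σ b = a := by rw [← hab, hσ.1]
        have := hσ.odd_add (a := b) (by rwa [hba])
        rwa [hba, add_comm] at this
    have hpc := hodd hc' hcl
    have hpd := hodd hd' hdr
    refine capCup_diagVec_eq_smul hσ.1 {lo i, hi i, c, d} (by rw [hc, hd])
      (fun a ha => hB a (by rwa [hc, hd])) fun s => ?_
    rw [prod_four hlr.ne hcl.symm hdl.symm hcr.symm hdr.symm hcd,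
      prod_four hlr.ne hcl.symm hdl.symm hcr.symm hdr.symm hcd,
      prod_four hlr.ne hcl.symm hdl.symm hcr.symm hdr.symm hcd]
    simp only [vertexCoeff, hc, hc', hd, hd', hsl, hsr, hsc, hsd, setPair_left hlr.ne,
      setPair_right, setPair_of_ne hcl hcr, setPair_of_ne hdl hdr, hlr, hlr.ne, hlr.ne', hcl,
      hdr, hcl.symm, hdr.symm, hcd, hcd.symm, hlr.not_gt, if_true,
      if_false]
    -- Four positions of the partners `c`, `d` relative to the stacked pair. In the third one the
    -- two links would cross.
    rcases lt_or_gt_of_ne hcl with hcl' | hcl' <;> rcases lt_or_gt_of_ne hdr with hdr' | hdr'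
    · have hdc : d < c := by
        have := (hσ.2 d (lo i) (by omega) (by rwa [hd'])).1
        rwa [hc] at this
      simp only [hcl', hdr', hdc, hcl'.not_gt, hdr'.not_gt, hdc.not_gt, if_true, if_false, hpc,
        hpd, hpr]
      rcases hε' with rfl | rfl <;> rcases fin_two_cases (s (lo i)) with h1 | h1 <;>
        rcases fin_two_cases (s (hi i)) with h2 | h2 <;>
        rcases fin_two_cases (s c) with h3 | h3 <;> rcases fin_two_cases (s d) with h4 | h4 <;>
        simp [h1, h2, h3, h4, cupCoeff, mul_comm, mul_left_comm]
    · have hdc : c < d := by omega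
      simp only [hcl', hdr', hdc, hcl'.not_gt, hdr'.not_gt, hdc.not_gt, if_true, if_false, hpc,
        hpr]
      rcases hε' with rfl | rfl <;> rcases fin_two_cases (s (lo i)) with h1 | h1 <;>
        rcases fin_two_cases (s (hi i)) with h2 | h2 <;>
        rcases fin_two_cases (s c) with h3 | h3 <;> rcases fin_two_cases (s d) with h4 | h4 <;>
        simp [h1, h2, h3, h4, cupCoeff, mul_comm, mul_left_comm]
    · have := (hσ.2 (lo i) (hi i) hlr (by rw [hc]; omega)).1
      rw [hd] at this
      omega
    · have hdc : d < c := by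
        have := (hσ.2 (lo i) (hi i) hlr (by rw [hc]; omega)).2.1
        rwa [hd, hc] at this
      simp only [hcl', hdr', hdc, hcl'.not_gt, hdr'.not_gt, hdc.not_gt, if_true, if_false,
        hpd, hpr]
      rcases hε' with rfl | rfl <;> rcases fin_two_cases (s (lo i)) with h1 | h1 <;>
        rcases fin_two_cases (s (hi i)) with h2 | h2 <;>
        rcases fin_two_cases (s c) with h3 | h3 <;> rcases fin_two_cases (s d) with h4 | h4 <;>
        simp [h1, h2, h3, h4, cupCoeff, mul_comm, mul_left_comm]

end DiagVec

/-! ### Half-diagram tensors are highest weight vectors with distinct leading terms. -/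

section Weight

variable {𝕜 : Type*} [Field 𝕜] {v : 𝕜ˣ} {n : ℕ}

/-- The weight of the part of a basis tensor to the left of the position `a`. -/
def leftWt (s : Fin n → Fin 2) (a : Fin n) : ℤ :=
  ∑ c, if c < a then (if s c = 0 then 1 else -1) else 0

/-- The iterated coproduct of `E` is a sum of terms `K ⊗ ⋯ ⊗ K ⊗ E ⊗ 1 ⊗ ⋯ ⊗ 1`; the factors `K`
produce the power of `v`. -/
theorem E_UCoord_apply (hv : ¬ IsOfFinOrder v) (f : Coord 𝕜 n) (s : Fin n → Fin 2) :
    UCoord v hv n (Uq.gen v .E) f s =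
      ∑ a, if s a = 0 then (v : 𝕜) ^ leftWt s a * f (Function.update s a 1) else 0 := by
  induction n with
  | zero => rw [(UCoord_zero v hv f).1]; simp
  | succ n ih =>
    obtain ⟨t, b, rfl⟩ : ∃ (t : Fin n → Fin 2) (b : Fin 2), s = Fin.snoc (α := fun _ => Fin 2) t b :=
      ⟨Fin.init s, s (Fin.last n), (Fin.snoc_init_self s).symm⟩
    have h1 : ∀ a : Fin n, leftWt (Fin.snoc (α := fun _ => Fin 2) t b) a.castSucc = leftWt t a := by
      intro a
      simp [leftWt, Fin.sum_univ_castSucc, (Fin.castSucc_lt_last a).not_gt]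
    have h2 : leftWt (Fin.snoc (α := fun _ => Fin 2) t b) (Fin.last n) = wt t := by
      simp [leftWt, wt, Fin.sum_univ_castSucc, Fin.castSucc_lt_last]
    have h3 := congrFun (slice_E v hv f b) t
    rw [slice_apply, Pi.add_apply, ih] at h3
    rw [h3, Fin.sum_univ_castSucc]
    congr 1
    · refine Finset.sum_congr rfl fun a _ => ?_
      rw [Fin.snoc_castSucc, h1, slice_apply, Fin.snoc_update]
    · rw [Fin.snoc_last, h2, Fin.update_snoc_last]
      split_ifs
      · rw [K_UCoord_apply, slice_apply]
      · rfl

variable {ε : 𝕜} {σ : Fin n → Fin n} {s : Fin n → Fin 2}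

theorem of_diagVec_ne_zero (hσ : ∀ a, σ (σ a) = a) (h : diagVec v ε σ s ≠ 0) (a : Fin n) :
    (σ a = a → s a = 0) ∧ (σ a ≠ a → s (σ a) ≠ s a) := by
  have key : ∀ a, vertexCoeff v ε σ s a ≠ 0 := fun a => Finset.prod_ne_zero_iff.1 h a (Finset.mem_univ a)
  constructor
  · intro ha
    by_contra h0
    exact key a (by simp [vertexCoeff, ha, h0])
  · intro ha heq
    rcases lt_or_gt_of_ne ha with h1 | h1
    · refine key (σ a) ?_
      simp [vertexCoeff, hσ, ha.symm, h1, heq]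
    · exact key a (by simp [vertexCoeff, ha, h1, heq])

theorem diagVec_ne_zero_iff (hε : ε * ε = 1) (hσ : ∀ a, σ (σ a) = a) :
    diagVec v ε σ s ≠ 0 ↔ ∀ a, (σ a = a → s a = 0) ∧ (σ a ≠ a → s (σ a) ≠ s a) := by
  refine ⟨fun h => of_diagVec_ne_zero hσ h, fun h => Finset.prod_ne_zero_iff.2 fun a _ => ?_⟩
  have hε0 : ε ≠ 0 := left_ne_zero_of_mul_eq_one hε
  unfold vertexCoeff
  split_ifs with h1 h2 h3 h4
  · exact one_ne_zero
  · exact absurd ((h a).1 h1) h2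
  · exact absurd h4.symm ((h a).2 h1)
  · exact mul_ne_zero (pow_ne_zero _ (neg_ne_zero.2 hε0)) (cupCoeff_ne_zero v _)
  · exact one_ne_zero

theorem sign_add_sign {x y : Fin 2} (h : y ≠ x) :
    (if x = 0 then (1 : ℤ) else -1) + (if y = 0 then 1 else -1) = 0 := by
  revert x y; decide

theorem wt_of_diagVec_ne_zero (hσ : ∀ a, σ (σ a) = a) (h : diagVec v ε σ s ≠ 0) :
    wt s = defects σ := by
  have key := of_diagVec_ne_zero hσ h
  rw [wt, ← Finset.sum_filter_add_sum_filter_not _ (fun a => σ a = a), defects, Finset.card_eq_sum_ones]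
  push_cast
  rw [← add_zero (Finset.sum _ fun _ => (1 : ℤ))]
  congr 1
  · refine Finset.sum_congr rfl fun a ha => ?_
    rw [if_pos ((key a).1 (Finset.mem_filter.1 ha).2)]
  · refine Finset.sum_involution (fun a _ => σ a) (fun a ha => ?_) (fun a ha _ => ?_)
      (fun a ha => ?_) fun a _ => hσ a
    · exact sign_add_sign ((key a).2 (Finset.mem_filter.1 ha).2)
    · exact (Finset.mem_filter.1 ha).2
    · rw [Finset.mem_filter, hσ]
      exact ⟨Finset.mem_univ _, fun h => (Finset.mem_filter.1 ha).2 h.symm⟩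

theorem K_diagVec (hv : ¬ IsOfFinOrder v) (hσ : ∀ a, σ (σ a) = a) :
    UCoord v hv n (Uq.gen v .K) (diagVec v ε σ) =
      (v : 𝕜) ^ (defects σ : ℤ) • diagVec v ε σ := by
  ext s
  rw [K_UCoord_apply, Pi.smul_apply, smul_eq_mul]
  by_cases h : diagVec v ε σ s = 0
  · rw [h, mul_zero, mul_zero]
  · rw [wt_of_diagVec_ne_zero hσ h]

theorem leftWt_eq_of_linked (hσ : IsHalfDiagram σ) {a : Fin n} (ha : a < σ a) (h0 : s a = 0)
    (h : ∀ c ∈ Finset.Ioo a (σ a), s (σ c) ≠ s c) : leftWt s (σ a) = leftWt s a + 1 := by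
  have h1 := hσ.sum_Ioo a (f := fun c => if s c = 0 then (1 : ℤ) else -1)
    fun c hc => sign_add_sign (h c hc)
  have h2 : ∑ c, (if c = a then (1 : ℤ) else 0) = 1 := by simp
  have h3 : Finset.Ioo a (σ a) = Finset.univ.filter fun c => a < c ∧ c < σ a := by ext; simp
  rw [h3, Finset.sum_filter] at h1
  calc leftWt s (σ a) = leftWt s a + ∑ c, (if c = a then (1 : ℤ) else 0) +
        ∑ c, if a < c ∧ c < σ a then (if s c = 0 then (1 : ℤ) else -1) else 0 := by
        rw [leftWt, leftWt, ← Finset.sum_add_distrib, ← Finset.sum_add_distrib]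
        refine Finset.sum_congr rfl fun c _ => ?_
        rcases lt_trichotomy c a with hc | rfl | hc
        · simp [hc, hc.trans ha, hc.ne, hc.not_gt]
        · simp [ha, h0]
        · simp [hc, hc.not_gt, hc.ne']
    _ = _ := by rw [h1, h2, add_zero]

theorem diagVec_update (hσ : IsHalfDiagram σ) {a : Fin n} (ha : a < σ a) (h0 : s a = 0)
    (h1 : s (σ a) = 0) : diagVec v ε σ (Function.update s (σ a) 1) =
      -(v : 𝕜)⁻¹ * diagVec v ε σ (Function.update s a 1) := by
  have key : ∀ t : Fin n → Fin 2, (∀ c, c ≠ a → c ≠ σ a → t c = s c) →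
      diagVec v ε σ t = (∏ c ∈ {a, σ a}, vertexCoeff v ε σ t c) *
        ∏ c ∈ {a, σ a}ᶜ, vertexCoeff v ε σ s c := by
    intro t ht
    refine diagVec_eq_mul v ε _ fun c hc => ?_
    simp only [Finset.mem_insert, Finset.mem_singleton, not_or] at hc
    refine ⟨rfl, ht c hc.1 hc.2, ht _ (fun h => hc.2 ?_) fun h => hc.1 ?_⟩
    · rw [← h, hσ.1]
    · rw [← hσ.1 c, h, hσ.1]
  rw [key _ fun c _ h => Function.update_of_ne h _ _,
    key (Function.update s a 1) fun c h _ => Function.update_of_ne h _ _, Finset.prod_pair ha.ne,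
    Finset.prod_pair ha.ne]
  simp [vertexCoeff, hσ.1, ha.ne, ha.ne', ha, ha.not_gt, h0, h1, cupCoeff]
  ring

/-- Defects carry `x₀` and contribute nothing. For a link, the terms of its two endpoints cancel:
the coordinates differ by `-v⁻¹`, and the powers of `v` by `v`, since the vertices under the link
have total weight zero. -/
theorem E_diagVec (hv : ¬ IsOfFinOrder v) (hσ : IsHalfDiagram σ) :
    UCoord v hv n (Uq.gen v .E) (diagVec v ε σ) = 0 := by
  ext s
  rw [E_UCoord_apply]
  set T : Fin n → 𝕜 := fun a =>
    if s a = 0 then (v : 𝕜) ^ leftWt s a * diagVec v ε σ (Function.update s a 1) else 0 with hT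
  have hfix : ∀ a, σ a = a → T a = 0 := by
    intro a ha
    by_contra h
    simp only [hT, ite_eq_right_iff, mul_eq_zero, not_forall, not_or] at h
    have := (of_diagVec_ne_zero hσ.1 h.2.2 a).1 ha
    simp at this
  have hone : ∀ a, σ a ≠ a → s (σ a) = 1 → T a = 0 := by
    intro a ha h1
    by_contra h
    simp only [hT, ite_eq_right_iff, mul_eq_zero, not_forall, not_or] at h
    have := (of_diagVec_ne_zero hσ.1 h.2.2 a).2 ha
    simp [ha, h1] at this
  have hpair : ∀ a, a < σ a → T a + T (σ a) = 0 := by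
    intro a ha
    rcases fin_two_cases (s (σ a)) with h1 | h1
    · rcases fin_two_cases (s a) with h0 | h0
      · by_cases hz : diagVec v ε σ (Function.update s a 1) = 0
        · simp [hT, diagVec_update hσ ha h0 h1, hz]
        · have hlw : leftWt s (σ a) = leftWt s a + 1 := by
            refine leftWt_eq_of_linked hσ ha h0 fun c hc => ?_
            obtain ⟨h2, h3⟩ := Finset.mem_Ioo.1 hc
            obtain ⟨h4, h5, h6⟩ := hσ.2 a c h2 h3
            have := (of_diagVec_ne_zero hσ.1 hz c).2 h6
            rwa [Function.update_of_ne h4.ne', Function.update_of_ne h2.ne'] at this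
          simp only [hT, h0, h1, if_true, diagVec_update hσ ha h0 h1, hlw,
            zpow_add_one₀ v.ne_zero]
          field_simp
          ring
      · have := hone (σ a) (by rw [hσ.1]; exact ha.ne) (by rwa [hσ.1])
        rw [this]
        simp [hT, h0]
    · rw [hone a ha.ne' h1]
      simp [hT, h1]
  refine Finset.sum_involution (fun a _ => σ a) (fun a _ => ?_) (fun a _ h h' => h (hfix a h'))
    (fun a _ => Finset.mem_univ _) fun a _ => hσ.1 a
  rcases lt_trichotomy a (σ a) with h | h | h
  · exact hpair a h
  · exact (congrArg₂ (· + ·) (hfix a h.symm) (hfix (σ a) (by rw [hσ.1]; exact h))).trans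
      (add_zero 0)
  · have := hpair (σ a) (by rwa [hσ.1])
    rwa [hσ.1, add_comm] at this

theorem diagVec_mem_highestWeight (hv : ¬ IsOfFinOrder v) (hσ : IsHalfDiagram σ) :
    diagVec v ε σ ∈ highestWeight (UCoord v hv n) (defects σ) :=
  mem_highestWeight.2 ⟨E_diagVec hv hσ, K_diagVec hv hσ.1⟩

/-- The index of the leading coordinate of `diagVec`: right endpoints carry `x₁`. -/
def leadIndex (σ : Fin n → Fin n) (a : Fin n) : Fin 2 := if σ a < a then 1 else 0

theorem diagVec_leadIndex_ne_zero (hε : ε * ε = 1) (hσ : ∀ a, σ (σ a) = a) :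
    diagVec v ε σ (leadIndex σ) ≠ 0 := by
  refine (diagVec_ne_zero_iff hε hσ).2 fun a => ⟨fun h => by simp [leadIndex, h], fun h => ?_⟩
  rcases lt_or_gt_of_ne h with h | h <;> simp [leadIndex, hσ, h, h.not_gt]

theorem leadIndex_injective {τ : Fin n → Fin n} (hσ : IsHalfDiagram σ) (hτ : IsHalfDiagram τ)
    (h : leadIndex σ = leadIndex τ) : σ = τ := by
  refine hσ.ext hτ fun a => ?_
  have := congrFun h a
  unfold leadIndex at this
  by_cases h1 : σ a < a <;> by_cases h2 : τ a < a <;> simp [h1, h2] at this ⊢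

/-- The sum of the positions that carry `x₁`. -/
def posSum (s : Fin n → Fin 2) : ℕ := ∑ a, if s a = 1 then (a : ℕ) else 0

theorem two_mul_posSum (hσ : ∀ a, σ (σ a) = a) (s : Fin n → Fin 2) :
    2 * posSum s =
      ∑ a, ((if s a = 1 then (a : ℕ) else 0) + if s (σ a) = 1 then (σ a : ℕ) else 0) := by
  rw [Finset.sum_add_distrib, two_mul]
  congr 1
  exact (Equiv.sum_comp (Function.Involutive.toPerm σ hσ)
    fun a => if s a = 1 then (a : ℕ) else 0).symm

/-- Each link carries exactly one `x₁`, and placing it at the right endpoint is the strictly better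
choice. So `leadIndex σ` is the unique maximum among the nonzero coordinates. -/
theorem posSum_le (hσ : ∀ a, σ (σ a) = a) (h : diagVec v ε σ s ≠ 0) :
    posSum s ≤ posSum (leadIndex σ) ∧
      (posSum s = posSum (leadIndex σ) → s = leadIndex σ) := by
  have key := of_diagVec_ne_zero hσ h
  have hle : ∀ a ∈ Finset.univ, ((if s a = 1 then (a : ℕ) else 0) +
      if s (σ a) = 1 then (σ a : ℕ) else 0) ≤ ((if leadIndex σ a = 1 then (a : ℕ) else 0) +
      if leadIndex σ (σ a) = 1 then (σ a : ℕ) else 0) := by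
    intro a _
    obtain ⟨h1, h2⟩ := key a
    simp only [leadIndex, hσ]
    rcases fin_two_cases (s a) with h3 | h3 <;> rcases fin_two_cases (s (σ a)) with h4 | h4 <;>
      grind
  have hs := Finset.sum_le_sum hle
  rw [← two_mul_posSum hσ, ← two_mul_posSum hσ] at hs
  refine ⟨by omega, fun heq => funext fun a => ?_⟩
  have hs' := (Finset.sum_eq_sum_iff_of_le hle).1
    (by rw [← two_mul_posSum hσ, ← two_mul_posSum hσ, heq]) a (Finset.mem_univ a)
  obtain ⟨h1, h2⟩ := key a
  simp only [leadIndex, hσ] at hs' ⊢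
  rcases fin_two_cases (s a) with h3 | h3 <;> rcases fin_two_cases (s (σ a)) with h4 | h4 <;>
    grind

end Weight

/-! ### The embedding of `H(k)` in tensor space. -/

section DiagMap

variable {𝕜 : Type*} [Field 𝕜] {v : 𝕜ˣ} {ε δ : 𝕜} {n : ℕ}

/-- The embedding of `H(k)` into tensor space. -/
noncomputable def diagMap (v : 𝕜ˣ) (ε : 𝕜) (n k : ℕ) : HMod 𝕜 n k →ₗ[𝕜] Coord 𝕜 n :=
  Finsupp.linearCombination 𝕜 fun h : HalfDiagram n k => diagVec v ε h.1

theorem diagMap_single {k : ℕ} (h : HalfDiagram n k) (c : 𝕜) :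
    diagMap v ε n k (Finsupp.single h c) = c • diagVec v ε h.1 := by
  simp [diagMap]

theorem diagMap_mem_highestWeight (hv : ¬ IsOfFinOrder v) {k : ℕ} (x : HMod 𝕜 n k) :
    diagMap v ε n k x ∈ highestWeight (UCoord v hv n) k := by
  induction x using Finsupp.induction_linear with
  | zero => rw [map_zero]; exact zero_mem _
  | add x y hx hy => rw [map_add]; exact add_mem hx hy
  | single h c =>
    rw [diagMap_single]
    have := diagVec_mem_highestWeight (ε := ε) hv h.2.1
    rw [h.2.2] at this
    exact Submodule.smul_mem _ c this

/-- Triangularity: at the leading index of a half-diagram in the support with maximal `posSum`, the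
tensors of all others in the support vanish. -/
theorem diagMap_injective (hε : ε * ε = 1) (k : ℕ) : Function.Injective (diagMap v ε n k) := by
  rw [← LinearMap.ker_eq_bot, LinearMap.ker_eq_bot']
  intro x hx
  by_contra hne
  obtain ⟨h, hh, hmax⟩ := Finset.exists_max_image x.support (fun h => posSum (leadIndex h.1))
    (Finsupp.support_nonempty_iff.2 hne)
  have h0 := congrFun hx (leadIndex h.1)
  rw [diagMap, Finsupp.linearCombination_apply, Finsupp.sum, Finset.sum_apply,
    Finset.sum_eq_single_of_mem h hh] at h0
  · exact mul_ne_zero (Finsupp.mem_support_iff.1 hh)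
      (diagVec_leadIndex_ne_zero hε h.2.1.1) h0
  · intro h' hh' hne
    by_contra hc
    have hc' : diagVec v ε h'.1 (leadIndex h.1) ≠ 0 := right_ne_zero_of_mul hc
    obtain ⟨h1, h2⟩ := posSum_le h'.2.1.1 hc'
    exact hne (Subtype.ext (leadIndex_injective h'.2.1 h.2.1
      (h2 (le_antisymm h1 (hmax h' hh'))).symm))

/-- Read off from weights: the number of defects is the weight of the tensor, and `capCup` commutes
with `K`. Any sign would do; `ε = 1` is used. -/
theorem defects_stack (hv : ¬ IsOfFinOrder v) {σ : Fin n → Fin n} (hσ : IsHalfDiagram σ)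
    {i : Fin (n - 1)} (h : σ (lo i) ≠ hi i) (hd : ¬ (σ (lo i) = lo i ∧ σ (hi i) = hi i)) :
    defects (stack i σ) = defects σ := by
  have hs := hσ.stack h
  have h1 := (mem_highestWeight.1 (diagVec_mem_highestWeight (ε := (1 : 𝕜)) hv hσ)).2
  have h2 := capCup_commute v hv (1 : 𝕜) (a := lo i) (b := hi i) rfl (Uq.gen v .K)
    (diagVec v 1 σ)
  rw [h1, map_smul, capCup_diagVec (by simp) hσ h hd] at h2
  have h3 := diagVec_leadIndex_ne_zero (v := v) (ε := (1 : 𝕜)) (by simp) hs.1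
  have h4 := (wt_of_diagVec_ne_zero hs.1 h3).symm.trans (wt_eq_of_ne_zero h2.symm h3)
  exact_mod_cast h4

theorem diagMap_eH (hv : ¬ IsOfFinOrder v) (hε : ε * ε = 1)
    (hδ : δ = ε * ((v : 𝕜) + (v : 𝕜)⁻¹)) (k : ℕ) (i : Fin (n - 1)) (x : HMod 𝕜 n k) :
    diagMap v ε n k (eH n δ k i x) = capCup v ε (lo i) (hi i) (diagMap v ε n k x) := by
  induction x using Finsupp.induction_linear with
  | zero => simp
  | add x y hx hy => simp only [map_add, hx, hy]
  | single h c =>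
    rw [diagMap_single, map_smul, eH, Finsupp.linearCombination_single, map_smul]
    congr 1
    obtain ⟨h1, h2⟩ := h.2
    split_ifs with h3 h4
    · rw [diagMap_single, capCup_diagVec_of_linked h1 h3, hδ]
    · rw [diagMap_single, one_smul, capCup_diagVec hε h1 h3]
      rintro ⟨h5, h6⟩
      exact (defects_stack_lt i h5 h6 h1.1).ne (h4.2.trans h2.symm)
    · rw [map_zero, capCup_diagVec_of_defects h1.1]
      · by_contra h5
        exact h4 ⟨h1.stack h3, (defects_stack hv h1 h3 fun h6 => h5 h6.1).trans h2⟩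
      · by_contra h5
        exact h4 ⟨h1.stack h3, (defects_stack hv h1 h3 fun h6 => h5 h6.2).trans h2⟩

/-- The operators by which the generators of `TL_n(δ)` act on `H(k)`, extended by zero. -/
noncomputable def cellFamily (n : ℕ) (δ : 𝕜) (k i : ℕ) : Module.End 𝕜 (HMod 𝕜 n k) :=
  if h : i < n - 1 then eH n δ k ⟨i, h⟩ else 0

theorem diagMap_cellFamily (hv : ¬ IsOfFinOrder v) (hε : ε * ε = 1)
    (hδ : δ = ε * ((v : 𝕜) + (v : 𝕜)⁻¹)) (k i : ℕ) (x : HMod 𝕜 n k) :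
    diagMap v ε n k (cellFamily n δ k i x) = capFamily v ε n i (diagMap v ε n k x) := by
  unfold cellFamily capFamily
  split_ifs with h
  · exact diagMap_eH hv hε hδ k _ x
  · simp

/-- The relations hold for the operators on tensor space and are pulled back along the injective map
`diagMap`, which avoids a direct check on diagrams. -/
theorem isTLFamily_cellFamily (hv : ¬ IsOfFinOrder v) (hε : ε * ε = 1)
    (hδ : δ = ε * ((v : 𝕜) + (v : 𝕜)⁻¹)) (k : ℕ) :
    IsTLFamily δ (n - 1) (cellFamily n δ k) := by
  have hfam := isTLFamily_capFamily v hε n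
  rw [← hδ] at hfam
  have hc := fun i x => diagMap_cellFamily (n := n) hv hε hδ k i x
  have hinj := diagMap_injective (v := v) (n := n) hε k
  refine ⟨fun i hi => ?_, fun i hi => ?_, fun i hi => ?_, fun i j hij hj => ?_⟩ <;>
    refine LinearMap.ext fun x => hinj ?_
  · have := LinearMap.congr_fun (hfam.sq i hi) (diagMap v ε n k x)
    simpa [hc] using this
  · have := LinearMap.congr_fun (hfam.up i hi) (diagMap v ε n k x)
    simpa [hc] using this
  · have := LinearMap.congr_fun (hfam.down i hi) (diagMap v ε n k x)
    simpa [hc] using this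
  · have := LinearMap.congr_fun (hfam.comm i j hij hj).eq (diagMap v ε n k x)
    simpa [hc] using this

/-- The module `H(k)`. -/
noncomputable def cellRep (hv : ¬ IsOfFinOrder v) (hε : ε * ε = 1)
    (hδ : δ = ε * ((v : 𝕜) + (v : 𝕜)⁻¹)) (n k : ℕ) : TL n δ →ₐ[𝕜] Module.End 𝕜 (HMod 𝕜 n k) :=
  TL.lift (isTLFamily_cellFamily hv hε hδ k)

theorem cellRep_gen (hv : ¬ IsOfFinOrder v) (hε : ε * ε = 1)
    (hδ : δ = ε * ((v : 𝕜) + (v : 𝕜)⁻¹)) (k : ℕ) (i : Fin (n - 1)) :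
    cellRep hv hε hδ n k (TL.gen n δ i) = eH n δ k i := by
  rw [cellRep, TL.lift_gen, cellFamily, dif_pos i.2]

theorem diagMap_cellRep (hv : ¬ IsOfFinOrder v) (hε : ε * ε = 1)
    (hδ : δ = ε * ((v : 𝕜) + (v : 𝕜)⁻¹)) (k : ℕ) (a : TL n δ) (x : HMod 𝕜 n k) :
    diagMap v ε n k (cellRep hv hε hδ n k a x) = tlRep v hε hδ n a (diagMap v ε n k x) := by
  revert x
  refine TL.induction (p := fun a => ∀ x, diagMap v ε n k (cellRep hv hε hδ n k a x) =
    tlRep v hε hδ n a (diagMap v ε n k x)) ?_ ?_ ?_ ?_ a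
  · intro c x; simp [Algebra.algebraMap_eq_smul_one]
  · intro a b ha hb x; simp [ha, hb]
  · intro a b ha hb x; simp [ha, hb]
  · intro i x
    rw [cellRep_gen, tlRep_gen, diagMap_eH hv hε hδ]

end DiagMap

end SchurWeyl

/-! ## The bimodule decomposition -/

namespace SchurWeyl

section Bimodule

variable {𝕜 : Type*} [Field 𝕜]

theorem IsSimpleRep.injective {A M N : Type*} [Ring A] [Algebra 𝕜 A] [AddCommGroup M]
    [Module 𝕜 M] [AddCommGroup N] [Module 𝕜 N] {σ : A →ₐ[𝕜] Module.End 𝕜 M}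
    {ρ : A →ₐ[𝕜] Module.End 𝕜 N} (h : IsSimpleRep σ) {L : M →ₗ[𝕜] N}
    (hL : ∀ a y, L (σ a y) = ρ a (L y)) (hne : L ≠ 0) : Function.Injective L := by
  let _ : Module A M := Module.compHom M σ.toRingHom
  let _ : Module A N := Module.compHom N ρ.toRingHom
  have _ : IsSimpleModule A M := h
  let f : M →ₗ[A] N := { L with map_smul' := hL }
  refine (LinearMap.injective_or_eq_zero f).resolve_right fun h0 => hne (LinearMap.ext fun y => ?_)
  exact LinearMap.congr_fun h0 y

theorem exists_eq_sum_xvec_tmul {k : ℕ} {W : Type*} [AddCommGroup W] [Module 𝕜 W]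
    (z : VMod 𝕜 k ⊗[𝕜] W) :
    ∃ h : ℕ → W, z = ∑ p ∈ Finset.range (k + 1), xvec 𝕜 k p ⊗ₜ[𝕜] h p := by
  induction z using TensorProduct.induction_on with
  | zero => exact ⟨0, by simp⟩
  | add x y hx hy =>
    obtain ⟨g, rfl⟩ := hx
    obtain ⟨h, rfl⟩ := hy
    exact ⟨g + h, by simp [TensorProduct.tmul_add, Finset.sum_add_distrib]⟩
  | tmul y w =>
    refine ⟨fun p => if hp : p < k + 1 then y ⟨p, hp⟩ • w else 0, ?_⟩
    have hy : y = ∑ p : Fin (k + 1), y p • xvec 𝕜 k p := by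
      conv_lhs => rw [← (Pi.basisFun 𝕜 (Fin (k + 1))).sum_repr y]
      simp only [Pi.basisFun_repr, xvec_coe]
    rw [Finset.sum_range]
    conv_lhs => rw [hy, TensorProduct.sum_tmul]
    refine Finset.sum_congr rfl fun p _ => ?_
    simp only [dif_pos p.2, TensorProduct.smul_tmul]

variable {v : 𝕜ˣ} (hv : ¬ IsOfFinOrder v) {ε δ : 𝕜} (hε : ε * ε = 1)
  (hδ : δ = ε * ((v : 𝕜) + (v : 𝕜)⁻¹)) {n k : ℕ}

theorem hwAct_xvec_zero {M : Type*} [AddCommGroup M] [Module 𝕜 M]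
    (ρ : Uq v →ₐ[𝕜] Module.End 𝕜 M) (w : M) : hwAct k ρ (xvec 𝕜 k 0) w = w := by
  have := hwAct_xvec k ρ (Nat.zero_le k)
  rw [Nat.cast_zero] at this
  rw [this]
  simp [qfact]

theorem map_hwAct {M : Type*} [AddCommGroup M] [Module 𝕜 M] {ρ : Uq v →ₐ[𝕜] Module.End 𝕜 M}
    {φ : Module.End 𝕜 M} (hφ : φ ∈ endAlg ρ) (y : VMod 𝕜 k) (w : M) :
    φ (hwAct k ρ y w) = hwAct k ρ y (φ w) := by
  have h : φ ∘ₗ (LinearMap.applyₗ w ∘ₗ hwAct k ρ) = LinearMap.applyₗ (φ w) ∘ₗ hwAct k ρ := by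
    refine (Pi.basisFun 𝕜 (Fin (k + 1))).ext fun p => ?_
    rw [← xvec_coe]
    simp only [LinearMap.comp_apply, LinearMap.applyₗ_apply_apply,
      hwAct_xvec k ρ (Nat.lt_succ_iff.1 p.2), map_smul,
      intertwines_pow (mem_endAlg_iff.1 hφ)]
  exact LinearMap.congr_fun h y

include hv in
-- Both vectors receive maps from `V(k)`. The one for `w` is injective by simplicity, and
-- semisimplicity extends the one for `w'` along it.
theorem exists_endAlg_apply_eq {w w' : Coord 𝕜 n} (hw : w ∈ highestWeight (UCoord v hv n) k)
    (hw' : w' ∈ highestWeight (UCoord v hv n) k) (hne : w ≠ 0) :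
    ∃ φ ∈ endAlg (UCoord v hv n), φ w = w' := by
  have key : ∀ u ∈ highestWeight (UCoord v hv n) k, ∀ a y,
      (LinearMap.applyₗ u ∘ₗ hwAct k (UCoord v hv n)) (VRep v hv k a y) =
        UCoord v hv n a ((LinearMap.applyₗ u ∘ₗ hwAct k (UCoord v hv n)) y) :=
    fun u hu a y => hwAct_intertwines hv k _ hu (F_pow_hw_UCoord v hv n hu) a y
  have hL : LinearMap.applyₗ w ∘ₗ hwAct k (UCoord v hv n) ≠ 0 := fun h0 => hne (by
    simpa [hwAct_xvec_zero] using LinearMap.congr_fun h0 (xvec 𝕜 k 0))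
  obtain ⟨φ, hφ, h⟩ := (isSemisimpleRep_UCoord v hv n).exists_extension (key w hw) (key w' hw')
    ((isSimpleRep_VRep hv k).injective (key w hw) hL)
  exact ⟨φ, hφ, by simpa [hwAct_xvec_zero] using h (xvec 𝕜 k 0)⟩

/-- The endomorphism taking the tensor of `x` to `w` comes from `TL_n`. With `w` in the image of
`diagMap` this shows that `H(k)` is simple; with `w` arbitrary it shows that `diagMap` reaches every
highest weight vector. -/
theorem exists_cellRep_apply_eq {x : HMod 𝕜 n k} (hx : x ≠ 0) {w : Coord 𝕜 n}
    (hw : w ∈ highestWeight (UCoord v hv n) k) :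
    ∃ a, diagMap v ε n k (cellRep hv hε hδ n k a x) = w := by
  obtain ⟨φ, hφ, h⟩ := exists_endAlg_apply_eq hv (diagMap_mem_highestWeight (ε := ε) hv x) hw
    ((map_ne_zero_iff _ (diagMap_injective hε k)).2 hx)
  obtain ⟨a, rfl⟩ := (tlRep_bijective hv hε hδ n).2 φ hφ
  exact ⟨a, by rw [diagMap_cellRep, h]⟩

theorem isSimpleRep_outerRep_cellRep (hk : k ∈ Lam n) :
    IsSimpleRep (outerRep (VRep v hv k) (cellRep hv hε hδ n k)) := by
  have _ : Nonempty (HalfDiagram n k) := exists_halfDiagram hk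
  refine isSimpleRep_outerRep hv k _ fun x y hx => ?_
  obtain ⟨a, ha⟩ := exists_cellRep_apply_eq hv hε hδ hx (diagMap_mem_highestWeight (ε := ε) hv y)
  exact ⟨a, diagMap_injective hε k ha⟩

/-- The map `V(k) ⊗ H(k) → V^{⊗n}` that sends `x₀ ⊗ h` to the tensor of `h`. -/
noncomputable def bimoduleMap (ε : 𝕜) (n k : ℕ) : VMod 𝕜 k ⊗[𝕜] HMod 𝕜 n k →ₗ[𝕜] Coord 𝕜 n :=
  TensorProduct.lift (LinearMap.lcomp 𝕜 (Coord 𝕜 n) (diagMap v ε n k) ∘ₗ hwAct k (UCoord v hv n))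

theorem bimoduleMap_tmul (y : VMod 𝕜 k) (h : HMod 𝕜 n k) :
    bimoduleMap hv ε n k (y ⊗ₜ h) = hwAct k (UCoord v hv n) y (diagMap v ε n k h) := by
  simp [bimoduleMap]

theorem bimoduleMap_outerRep (x : Uq v) (a : TL n δ) (z : VMod 𝕜 k ⊗[𝕜] HMod 𝕜 n k) :
    bimoduleMap hv ε n k (outerRep (VRep v hv k) (cellRep hv hε hδ n k) (x ⊗ₜ a) z) =
      UCoord v hv n x (tlRep v hε hδ n a (bimoduleMap hv ε n k z)) := by
  induction z using TensorProduct.induction_on with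
  | zero => simp
  | add y z hy hz => simp only [map_add, hy, hz]
  | tmul y h =>
    have hw := diagMap_mem_highestWeight (ε := ε) hv (cellRep hv hε hδ n k a h)
    rw [outerRep_tmul, TensorProduct.map_tmul, bimoduleMap_tmul, bimoduleMap_tmul,
      hwAct_intertwines hv k _ hw (F_pow_hw_UCoord v hv n hw), diagMap_cellRep,
      map_hwAct (tlRep_mem_endAlg v hε hδ n hv a)]

/-- The map `⨁ V(k) ⊗ H(k) → V^{⊗n}`. -/
noncomputable def sumMap (ε : 𝕜) (n : ℕ) :
    (⨁ k : Lam n, VMod 𝕜 k ⊗[𝕜] HMod 𝕜 n k) →ₗ[𝕜] Coord 𝕜 n :=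
  ∑ k : Lam n, bimoduleMap hv ε n k ∘ₗ DirectSum.component 𝕜 _ _ k

theorem sumMap_apply (z : ⨁ k : Lam n, VMod 𝕜 k ⊗[𝕜] HMod 𝕜 n k) :
    sumMap hv ε n z = ∑ k : Lam n, bimoduleMap hv ε n k (z k) := by
  rw [sumMap, LinearMap.sum_apply]
  rfl

theorem mem_Lam_of_highestWeight {w : Coord 𝕜 n} (hw : w ∈ highestWeight (UCoord v hv n) k)
    (hne : w ≠ 0) : k ∈ Lam n := by
  obtain ⟨s, hs⟩ := Function.ne_iff.1 hne
  have h1 := wt_eq_of_ne_zero (mem_highestWeight.1 hw).2 hs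
  obtain ⟨r, -, h2⟩ := wt_eq s
  simp only [Lam, Finset.mem_image, Finset.mem_range]
  exact ⟨r, by omega, by omega⟩

theorem bimoduleMap_mem_range {k : ℕ} (hk : k ∈ Lam n) (z : VMod 𝕜 k ⊗[𝕜] HMod 𝕜 n k) :
    bimoduleMap hv ε n k z ∈ LinearMap.range (sumMap hv ε n) := by
  refine ⟨DirectSum.lof 𝕜 (Lam n) (fun k => VMod 𝕜 k ⊗[𝕜] HMod 𝕜 n k) ⟨k, hk⟩ z, ?_⟩
  rw [sumMap_apply, Finset.sum_eq_single ⟨k, hk⟩]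
  · rw [DirectSum.lof_apply]
  · intro j _ hj
    have : DirectSum.lof 𝕜 (Lam n) (fun k => VMod 𝕜 k ⊗[𝕜] HMod 𝕜 n k) ⟨k, hk⟩ z j = 0 :=
      DFinsupp.single_eq_of_ne hj
    rw [this, map_zero]
  · simp

include hε hδ in
theorem sumMap_surjective : Function.Surjective (sumMap hv ε n) := by
  rw [← LinearMap.range_eq_top]
  refine eq_top_of_hwAct_mem v hv fun k w hw y => ?_
  by_cases hne : w = 0
  · rw [hne, map_zero]; exact zero_mem _
  have hk := mem_Lam_of_highestWeight hv hw hne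
  obtain ⟨h⟩ := exists_halfDiagram hk
  obtain ⟨a, rfl⟩ := exists_cellRep_apply_eq (ε := ε) hv hε hδ
    (x := Finsupp.single h (1 : 𝕜)) (by simp) hw
  rw [← bimoduleMap_tmul]
  exact bimoduleMap_mem_range hv hk _

theorem eq_zero_of_sum_weight {f : Lam n → Coord 𝕜 n}
    (hf : ∀ k, UCoord v hv n (Uq.gen v .K) (f k) = (v : 𝕜) ^ ((k : ℕ) : ℤ) • f k)
    (h : ∑ k, f k = 0) (k : Lam n) : f k = 0 := by
  ext s
  by_contra hs
  have h1 := congrFun h s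
  rw [Finset.sum_apply, Finset.sum_eq_single k] at h1
  · exact hs h1
  · intro j _ hjk
    by_contra hj
    have := (wt_eq_of_ne_zero (hf j) hj).symm.trans (wt_eq_of_ne_zero (hf k) hs)
    exact hjk (Subtype.ext (by exact_mod_cast this))
  · simp

theorem E_pow_F_pow_of_lt {w : Coord 𝕜 n} (hw : w ∈ highestWeight (UCoord v hv n) k) {p q : ℕ}
    (hp : p ≤ k) (hpq : p < q) :
    (UCoord v hv n (Uq.gen v .E) ^ q) ((UCoord v hv n (Uq.gen v .F) ^ p) w) = 0 := by
  obtain ⟨c, -, hc⟩ := E_pow_F_pow hv hw p hp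
  obtain ⟨r, rfl⟩ : ∃ r, q = r + 1 + p := ⟨q - p - 1, by omega⟩
  rw [pow_add, Module.End.mul_apply, hc, pow_succ, Module.End.mul_apply, map_smul,
    (mem_highestWeight.1 hw).1, smul_zero, map_zero]

include hε in
-- For the largest `p` still occurring, `E ^ p` kills all terms `F ^ q w` with `q < p` and returns
-- nonzero multiples of the highest weight vectors at `p`. Different `k` are then separated by
-- weight.
theorem sumMap_injective : Function.Injective (sumMap hv ε n) := by
  refine (injective_iff_map_eq_zero _).2 fun z hz => ?_
  choose h hh using fun k : Lam n => exists_eq_sum_xvec_tmul (z k)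
  have hw := fun (k : Lam n) p => diagMap_mem_highestWeight (ε := ε) hv (h k p)
  have hsum : ∑ k : Lam n, ∑ p ∈ Finset.range (k + 1), (qfact v p)⁻¹ •
      (UCoord v hv n (Uq.gen v .F) ^ p) (diagMap v ε n k (h k p)) = 0 := by
    rw [← hz, sumMap_apply]
    refine Finset.sum_congr rfl fun k _ => ?_
    rw [hh k, map_sum]
    refine Finset.sum_congr rfl fun p hp => ?_
    rw [bimoduleMap_tmul, hwAct_xvec _ _ (Nat.lt_succ_iff.1 (Finset.mem_range.1 hp))]
    rfl
  -- Downward induction on `p`, which starts beyond `n` because `p ≤ k ≤ n`.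
  have key : ∀ m p : ℕ, n < p + m → ∀ k : Lam n, p ≤ k → h k p = 0 := by
    intro m
    induction m with
    | zero =>
      intro p hp k hk
      obtain ⟨r, -, hr⟩ := Finset.mem_image.1 k.2
      omega
    | succ m ih =>
      intro p hp k hk
      have hE : ∀ k : Lam n, ∃ c : 𝕜, (p ≤ k → c ≠ 0) ∧ (UCoord v hv n (Uq.gen v .E) ^ p)
          (∑ q ∈ Finset.range (k + 1), (qfact v q)⁻¹ • (UCoord v hv n (Uq.gen v .F) ^ q)
            (diagMap v ε n k (h k q))) = c • diagMap v ε n k (h k p) := by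
        intro k
        by_cases hk : p ≤ k
        · obtain ⟨c, hc, hEF⟩ := E_pow_F_pow hv (hw k p) p hk
          refine ⟨(qfact v p)⁻¹ * c, fun _ => mul_ne_zero (inv_ne_zero (qfact_ne_zero v hv p)) hc, ?_⟩
          rw [map_sum, Finset.sum_eq_single p, map_smul, hEF, smul_smul]
          · intro q hq hqp
            rcases lt_or_gt_of_ne hqp with hlt | hgt
            · rw [map_smul, E_pow_F_pow_of_lt hv (hw k q) (by omega) hlt, smul_zero]
            · rw [ih q (by omega) k (Nat.lt_succ_iff.1 (Finset.mem_range.1 hq)), map_zero, map_zero,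
                smul_zero, map_zero]
          · intro hp
            exact absurd (Finset.mem_range.2 (by omega)) hp
        · refine ⟨0, fun h => absurd h hk, ?_⟩
          rw [map_sum, zero_smul]
          refine Finset.sum_eq_zero fun q hq => ?_
          have hq' := Finset.mem_range.1 hq
          rw [map_smul, E_pow_F_pow_of_lt hv (hw k q) (by omega) (by omega), smul_zero]
      choose c hc hE using hE
      have h1 := congrArg (UCoord v hv n (Uq.gen v .E) ^ p) hsum
      rw [map_sum, map_zero, Finset.sum_congr rfl fun k _ => hE k] at h1
      have h2 := eq_zero_of_sum_weight hv (fun k => by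
        rw [map_smul, (mem_highestWeight.1 (hw k p)).2, smul_comm]) h1 k
      have h3 := (smul_eq_zero.1 h2).resolve_left (hc k hk)
      exact (map_eq_zero_iff _ (diagMap_injective hε k)).1 h3
  refine DFinsupp.ext fun k => ?_
  rw [hh k]
  refine Finset.sum_eq_zero fun p hp => ?_
  rw [key (n + 1) p (by omega) k (Nat.lt_succ_iff.1 (Finset.mem_range.1 hp)),
    TensorProduct.tmul_zero]

end Bimodule

/-! ### Return from coordinates to tensor space. -/

section Transport

variable {𝕜 : Type*} [Field 𝕜] {v : 𝕜ˣ} (hv : ¬ IsOfFinOrder v) {ε δ : 𝕜} (hε : ε * ε = 1)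
  (hδ : δ = ε * ((v : 𝕜) + (v : 𝕜)⁻¹)) (n : ℕ)

/-- The action of the Temperley–Lieb algebra on tensor space. -/
noncomputable def tlTensor : TL n δ →ₐ[𝕜] Module.End 𝕜 (TSpace 𝕜 n) :=
  ((coordEquiv 𝕜 n).symm.conjAlgEquiv 𝕜).toAlgHom.comp (tlRep v hε hδ n)

theorem coordEquiv_tlTensor (a : TL n δ) (t : TSpace 𝕜 n) :
    coordEquiv 𝕜 n (tlTensor hε hδ n a t) = tlRep v hε hδ n a (coordEquiv 𝕜 n t) := by
  simp [tlTensor]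

include hv in
theorem add_inv_ne_zero : (v : 𝕜) + (v : 𝕜)⁻¹ ≠ 0 := by
  intro h
  refine hv (isOfFinOrder_iff_pow_eq_one.2 ⟨4, by norm_num, ?_⟩)
  ext
  have hv0 : (v : 𝕜) ≠ 0 := v.ne_zero
  field_simp at h
  push_cast
  -- If `v + v⁻¹ = 0` then `v ^ 2 + 1 = 0`, and `v ^ 4 - 1 = (v ^ 2 - 1) (v ^ 2 + 1)`.
  linear_combination ((v : 𝕜) ^ 2 - 1) * h

include hv in
theorem tlTensor_gen (i : Fin (n - 1)) :
    tlTensor hε hδ n (TL.gen n δ i) = δ • uAt v n i := by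
  refine LinearMap.ext fun t => (coordEquiv 𝕜 n).injective ?_
  rw [coordEquiv_tlTensor, tlRep_gen, ← coordEquiv_uAt v ε (add_inv_ne_zero hv), hδ,
    LinearMap.smul_apply]

theorem commute_UTensor_tlTensor (x : Uq v) (a : TL n δ) :
    Commute (UTensor v hv n x) (tlTensor hε hδ n a) := by
  refine LinearMap.ext fun t => (coordEquiv 𝕜 n).injective ?_
  have := LinearMap.congr_fun (tlRep_commute v hε hδ n hv a x).eq (coordEquiv 𝕜 n t)
  simpa only [Module.End.mul_apply, ← UCoord_coordEquiv v hv, coordEquiv_tlTensor] using this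

theorem conj_mem_endAlg_UCoord {φ : Module.End 𝕜 (TSpace 𝕜 n)} (hφ : φ ∈ endAlg (UTensor v hv n)) :
    (coordEquiv 𝕜 n).conj φ ∈ endAlg (UCoord v hv n) := by
  refine mem_endAlg_iff.2 fun x f => ?_
  obtain ⟨t, rfl⟩ := (coordEquiv 𝕜 n).surjective f
  rw [UCoord_coordEquiv, LinearEquiv.conj_apply_apply, LinearEquiv.conj_apply_apply,
    LinearEquiv.symm_apply_apply, LinearEquiv.symm_apply_apply, UCoord_coordEquiv,
    mem_endAlg_iff.1 hφ]

/-- Every endomorphism commuting with `U` comes from `TL_n`, so `f` commutes with all of them, and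
the double centralizer property of the semisimple `U`-module applies. -/
theorem exists_UTensor_eq {f : Module.End 𝕜 (TSpace 𝕜 n)}
    (hf : f ∈ endAlg (tlTensor (v := v) hε hδ n)) : ∃ x, UTensor v hv n x = f := by
  obtain ⟨x, hx⟩ := (isSemisimpleRep_UCoord v hv n).exists_eq (f := (coordEquiv 𝕜 n).conj f)
    fun φ hφ => by
      obtain ⟨a, rfl⟩ := (tlRep_bijective hv hε hδ n).2 φ hφ
      refine LinearMap.ext fun g => ?_
      obtain ⟨t, rfl⟩ := (coordEquiv 𝕜 n).surjective g
      rw [Module.End.mul_apply, Module.End.mul_apply, ← coordEquiv_tlTensor,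
        LinearEquiv.conj_apply_apply, LinearEquiv.conj_apply_apply, LinearEquiv.symm_apply_apply,
        LinearEquiv.symm_apply_apply, ← coordEquiv_tlTensor, mem_endAlg_iff.1 hf]
  refine ⟨x, LinearMap.ext fun t => (coordEquiv 𝕜 n).injective ?_⟩
  rw [← UCoord_coordEquiv, hx, LinearEquiv.conj_apply_apply, LinearEquiv.symm_apply_apply]

include hv in
theorem tlTensor_injective : Function.Injective (tlTensor (v := v) hε hδ n) := by
  refine (injective_iff_map_eq_zero _).2 fun a ha => (tlRep_bijective hv hε hδ n).1 a ?_
  refine LinearMap.ext fun g => ?_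
  obtain ⟨t, rfl⟩ := (coordEquiv 𝕜 n).surjective g
  rw [← coordEquiv_tlTensor, ha, LinearMap.zero_apply, map_zero, LinearMap.zero_apply]

theorem exists_tlTensor_eq {φ : Module.End 𝕜 (TSpace 𝕜 n)} (hφ : φ ∈ endAlg (UTensor v hv n)) :
    ∃ a, tlTensor (v := v) hε hδ n a = φ := by
  obtain ⟨a, ha⟩ := (tlRep_bijective hv hε hδ n).2 _ (conj_mem_endAlg_UCoord hv n hφ)
  refine ⟨a, LinearMap.ext fun t => (coordEquiv 𝕜 n).injective ?_⟩
  rw [coordEquiv_tlTensor, ha, LinearEquiv.conj_apply_apply, LinearEquiv.symm_apply_apply]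

/-- The decomposition of tensor space into the `V(k) ⊗ H(k)`. -/
noncomputable def bimoduleEquiv :
    TSpace 𝕜 n ≃ₗ[𝕜] ⨁ k : Lam n, VMod 𝕜 k ⊗[𝕜] HMod 𝕜 n k :=
  (coordEquiv 𝕜 n).trans (LinearEquiv.ofBijective (sumMap hv ε n)
    ⟨sumMap_injective hv hε, sumMap_surjective hv hε hδ⟩).symm

theorem sumMap_bimoduleEquiv (t : TSpace 𝕜 n) :
    sumMap hv ε n (bimoduleEquiv hv hε hδ n t) = coordEquiv 𝕜 n t :=
  LinearEquiv.apply_symm_apply (LinearEquiv.ofBijective (sumMap hv ε n)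
    ⟨sumMap_injective hv hε, sumMap_surjective hv hε hδ⟩) _

theorem bimoduleEquiv_apply (y : Uq v ⊗[𝕜] TL n δ) (t : TSpace 𝕜 n) :
    bimoduleEquiv hv hε hδ n (Algebra.TensorProduct.lift (UTensor v hv n) (tlTensor hε hδ n)
      (commute_UTensor_tlTensor hv hε hδ n) y t) =
      DirectSum.lmap (fun k : Lam n => outerRep (VRep v hv k) (cellRep hv hε hδ n k) y)
        (bimoduleEquiv hv hε hδ n t) := by
  induction y using TensorProduct.induction_on with
  | zero =>
    refine DFinsupp.ext fun k => ?_
    rw [DirectSum.lmap_apply]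
    simp
  | add y z hy hz =>
    refine DFinsupp.ext fun k => ?_
    have hy' := DFunLike.congr_fun hy k
    have hz' := DFunLike.congr_fun hz k
    rw [DirectSum.lmap_apply] at hy' hz' ⊢
    rw [map_add, LinearMap.add_apply, map_add, DirectSum.add_apply, hy', hz', map_add,
      LinearMap.add_apply]
  | tmul x a =>
    refine sumMap_injective (ε := ε) hv hε ?_
    rw [sumMap_bimoduleEquiv, Algebra.TensorProduct.lift_tmul, Module.End.mul_apply,
      ← UCoord_coordEquiv v hv, coordEquiv_tlTensor, sumMap_apply,
      ← sumMap_bimoduleEquiv hv hε hδ n t, sumMap_apply, map_sum, map_sum]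
    exact Finset.sum_congr rfl fun k _ => (bimoduleMap_outerRep hv hε hδ x a _).symm

end Transport

end SchurWeyl

theorem theorem8p2 {𝕜 : Type*} [Field 𝕜] (v : 𝕜ˣ) (hv : ¬ IsOfFinOrder v) (δ : 𝕜)
    (hδ : δ = (v : 𝕜) + (v : 𝕜)⁻¹ ∨ δ = -((v : 𝕜) + (v : 𝕜)⁻¹)) (n : ℕ) (hn : 0 < n) :
    -- the action of `TL_n(δ)` on tensor space, and the modules `H(k)`
    ∃ (ρ : TL n δ →ₐ[𝕜] Module.End 𝕜 (TSpace 𝕜 n))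
      (η : ∀ k : Lam n, TL n δ →ₐ[𝕜] Module.End 𝕜 (HMod 𝕜 n k)),
      (∀ i, ρ (TL.gen n δ i) = δ • uAt v n i) ∧
      (∀ k i, η k (TL.gen n δ i) = eH n δ k i) ∧
      -- the actions of `U` and `TL_n(δ)` on tensor space commute
      ∃ hcomm : ∀ (x : Uq v) (a : TL n δ), Commute (UTensor v hv n x) (ρ a),
        -- the induced map `U → End_{TL_n(δ)}(V^{⊗n})` is surjective
        (∃ f : Uq v →ₐ[𝕜] endAlg ρ,
          (∀ x, (f x : Module.End 𝕜 (TSpace 𝕜 n)) = UTensor v hv n x) ∧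
          Function.Surjective f) ∧
        -- the induced map `TL_n(δ) → End_U(V^{⊗n})` is an isomorphism
        (∃ g : TL n δ ≃ₐ[𝕜] endAlg (UTensor v hv n),
          ∀ a, (g a : Module.End 𝕜 (TSpace 𝕜 n)) = ρ a) ∧
        -- each `V(k) ⊗ H(k)` is a simple `U ⊗ TL_n(δ)`-module
        (∀ k : Lam n, IsSimpleRep (outerRep (VRep v hv k) (η k))) ∧
        -- `V^{⊗n}` is the direct sum of the `V(k) ⊗ H(k)`
        ∃ Φ : TSpace 𝕜 n ≃ₗ[𝕜] ⨁ k : Lam n, VMod 𝕜 k ⊗[𝕜] HMod 𝕜 n k,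
          ∀ (y : Uq v ⊗[𝕜] TL n δ) (t : TSpace 𝕜 n) (k : Lam n),
            Φ (Algebra.TensorProduct.lift (UTensor v hv n) ρ hcomm y t) k =
              outerRep (VRep v hv k) (η k) y (Φ t k) := by
  obtain ⟨ε, hε, hδ⟩ : ∃ ε : 𝕜, ε * ε = 1 ∧ δ = ε * ((v : 𝕜) + (v : 𝕜)⁻¹) := by
    rcases hδ with hδ | hδ
    · exact ⟨1, by simp, by simpa using hδ⟩
    · exact ⟨-1, by simp, by simpa using hδ⟩
  refine ⟨tlTensor hε hδ n, fun k => cellRep hv hε hδ n k, tlTensor_gen hv hε hδ n,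
    fun k i => cellRep_gen hv hε hδ k i, commute_UTensor_tlTensor hv hε hδ n, ?_, ?_,
    fun k => isSimpleRep_outerRep_cellRep hv hε hδ k.2, bimoduleEquiv hv hε hδ n,
    fun y t k => ?_⟩
  · have hmem : ∀ x, UTensor v hv n x ∈ endAlg (tlTensor (v := v) hε hδ n) := fun x =>
      mem_endAlg_iff.2 fun a => LinearMap.congr_fun (commute_UTensor_tlTensor hv hε hδ n x a).eq
    refine ⟨(UTensor v hv n).codRestrict _ hmem, fun _ => rfl, fun f => ?_⟩
    obtain ⟨x, hx⟩ := exists_UTensor_eq hv hε hδ n f.2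
    exact ⟨x, Subtype.ext hx⟩
  · have hmem : ∀ a, tlTensor (v := v) hε hδ n a ∈ endAlg (UTensor v hv n) := fun a =>
      mem_endAlg_iff.2 fun x =>
        LinearMap.congr_fun (commute_UTensor_tlTensor hv hε hδ n x a).eq.symm
    refine ⟨AlgEquiv.ofBijective ((tlTensor (v := v) hε hδ n).codRestrict _ hmem)
      ⟨fun a b hab => tlTensor_injective hv hε hδ n (congrArg Subtype.val hab), fun φ => ?_⟩,
      fun _ => rfl⟩
    obtain ⟨a, ha⟩ := exists_tlTensor_eq hv hε hδ n φ.2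
    exact ⟨a, Subtype.ext ha⟩
  · rw [bimoduleEquiv_apply, DirectSum.lmap_apply]
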